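/- **Setting.** Let $T\ge 2$ and $\delta\in(0,1)$. An oblivious adversary fixes $q_1,\dots,q_T\in[0,1]$. In round $t$ a forecaster draws $p_t\in[0,1]$ from a distribution $\mathcal P_t$ that is determined by the history and, independently given the history, $y_t\sim\mathrm{Ber}(q_t)$ is drawn and revealed. Let $C=\min_{p\in[0,1]}\sum_{t=1}^T|q_t-p|$, which the forecaster knows, and $$\mathrm{Cal}_2=\sum_{p:\,n(p)>0}n(p)\Big|\tfrac1{n(p)}\sum_{t:\,p_t=p}(y_t-p)\Big|^2,\quad n(p)=\#\{t:p_t=p\},\qquad \mathrm{PCal}_2=\sum_{t=1}^T\mathbb E_{p\sim\mathcal P_t}\big[(\bar\rho_p-p)^2\big],\quad \bar\rho_p=\frac{\sum_t\mathcal P_t(p)y_t}{\sum_t\mathcal P_t(p)} .$$ **Algorithm** (parameters $T$, $C$ and $\iota>0$). Epoch $m=1,2,\dots$ lasts $s_m=2^m$ rounds, until round $T$ is reached. In epoch $1$ the predictions in $[0,1]$ are arbitrary. In epoch $m\ge2$ let $\hat y_m$ be the average outcome of epoch $m-1$, let $r_m=\sqrt{\iota/s_{m-1}}+C/s_{m-1}$,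 $I_m=[a_m,b_m]=[\hat y_m-2r_m,\hat y_m+2r_m]\cap[0,1]$, $N_m=\lceil(s_m|I_m|^2/\iota)^{1/3}\rceil$, $K=\lceil(1+C)^{1/3}/\iota\rceil$ and $Q=\lceil\log_2T\rceil$. The partition $\Pi_m$ of $[0,1]$ consists of $I_m$ cut into $N_m$ intervals of equal length and, for $q=0,\dots,Q$, of each nonempty band $$[a_m-(2^{q+1}-1)r_m,\;a_m-(2^q-1)r_m)\cap[0,1],\qquad (b_m+(2^q-1)r_m,\;b_m+(2^{q+1}-1)r_m]\cap[0,1],$$ cut into $K$ intervals of equal length. Let $\mathcal Z_m$ be the set of all end points of the intervals in $\Pi_m$. Throughout the epoch each $s\in\mathcal Z_m$ runs projected online gradient descent on $[0,1]$, from an arbitrary initial action, with losses $a\mapsto\mathcal P_t(s)(a-y_t)^2$ and step sizes $1/\big(2\sum_{\tau\le t}\mathcal P_\tau(s)\big)$ (the sum is over the rounds of the epoch up to $t$; as long as it is $0$, the action is kept). If $a_{s,t}$ is its action and $[l,u]$ the interval of $\Pi_m$ that contains it, then $\mathcal Q_t(s,\cdot)$ puts mass $\frac{u-a_{s,t}}{u-l}$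 on $l$ and $\frac{a_{s,t}-l}{u-l}$ on $u$. The distribution $\mathcal P_t$ is any stationary distribution on $\mathcal Z_m$ of the row-stochastic matrix $\mathcal Q_t$. **Theorem.** There are absolute constants $c_0,A>0$ and $k\in\mathbb N$ such that for all $T\ge2$, $\delta\in(0,1)$, $q_1,\dots,q_T\in[0,1]$ and every $\iota\ge c_0\log(T/\delta)$ (in particular for $\iota=c_0\log(T/\delta)$): 1. For every forecaster that runs this algorithm, whatever the arbitrary choices are, $$\Pr\big[\mathrm{PCal}_2\le A(\iota^3+C^{1/3}\iota^2)\big]\ge1-\delta\qquad\text{and}\qquad\Pr\big[\mathrm{Cal}_2\le A(\iota^3+C^{1/3}\iota^2)\big]\ge1-\delta .$$ 2. The computational complexity per round is $\tilde O((1+C)^{2/3})$: one real-RAM program (unit-cost arithmetic, comparisons, real powers and logarithms on reals; rounding up a real costs additionally its rounded value), the same for all inputs $T$, $C$, $\iota$ and all outcomes, runs this algorithm for some admissible choices. In each of the $T$ rounds it lists the exact distribution $\mathcal P_t$ (support points and probabilities), and its number of steps in the round, plus one step per listed point for drawing $p_t$, is at most $A(1+C)^{2/3}(\log T)^k$. 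-/

import Mathlib

namespace Calib

/-! ### Protocol

A history lists the pairs (prediction, outcome) of the rounds played so far, NEWEST FIRST, so that
the tail of a history is the history before its last round. Rounds are numbered `0, 1, 2, …`; the
round that follows a history `h` has number `h.length`. -/

abbrev History : Type := List (ℝ × Bool)

/-- A forecaster: the conditional law `𝒫_t` of the next prediction, as a function of the history. -/
abbrev Forecaster : Type := History → PMF ℝ

/-- An outcome as a real number, `0` or `1`. -/
def outcome (b : Bool) : ℝ := if b then 1 else 0

/-- The Bernoulli distribution with mean `q`. -/
noncomputable def ber (q : unitInterval) : PMF Bool :=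
  PMF.ofFintype (fun b => if b then ENNReal.ofReal (q : ℝ) else ENNReal.ofReal (1 - (q : ℝ))) (by
    have h0 : (0 : ℝ) ≤ (q : ℝ) := q.2.1
    have h1 : (0 : ℝ) ≤ 1 - (q : ℝ) := sub_nonneg.2 q.2.2
    simp [← ENNReal.ofReal_add h0 h1])

/-- The law of the history after `n` rounds: in each round, given the history, the prediction `p`
is drawn from the forecaster's distribution and, independently, the outcome is drawn from the
Bernoulli distribution whose mean was fixed in advance. -/
noncomputable def law (F : Forecaster) (q : ℕ → unitInterval) : ℕ → PMF History
  | 0 => PMF.pure []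
  | n + 1 => (law F q n).bind fun h => (F h).bind fun p => (ber (q n)).map fun y => (p, y) :: h

/-- `sumRounds f h`: the sum of `f (history before round t) (prediction, outcome of round t)` over
all rounds `t` of `h`. -/
def sumRounds (f : History → ℝ × Bool → ℝ) : History → ℝ
  | [] => 0
  | x :: h => sumRounds f h + f h x

/-! ### Calibration errors and non-stationarity -/

/-- The number `n(p)` of rounds in which `p` was predicted. -/
noncomputable def visits (h : History) (p : ℝ) : ℝ :=
  sumRounds (fun _ x => if x.1 = p then 1 else 0) h

/-- The `ℓ₂`-calibration error. -/
noncomputable def cal2 (h : History) : ℝ :=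
  ∑ p ∈ (h.map Prod.fst).toFinset,
    visits h p *
      |1 / visits h p * sumRounds (fun _ x => if x.1 = p then outcome x.2 - x.1 else 0) h| ^ 2

/-- `ρ̄_p`, the average outcome with round `t` weighted by `𝒫_t(p)`. -/
noncomputable def rhoBar (F : Forecaster) (h : History) (p : ℝ) : ℝ :=
  sumRounds (fun h' x => (F h' p).toReal * outcome x.2) h /
    sumRounds (fun h' _ => (F h' p).toReal) h

/-- The pseudo `ℓ₂`-calibration error `∑_t E_{p ∼ 𝒫_t} (ρ̄_p - p)²`. -/
noncomputable def pcal2 (F : Forecaster) (h : History) : ℝ :=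
  sumRounds (fun h' _ => ∑' p : ℝ, (F h' p).toReal * (rhoBar F h p - p) ^ 2) h

/-- The minimal `ℓ₁` deviation `C = min_{p ∈ [0,1]} ∑_{t < T} |q_t - p|` (the infimum of a
continuous function on a compact set, hence attained). -/
noncomputable def deviation (q : ℕ → unitInterval) (T : ℕ) : ℝ :=
  ⨅ p : unitInterval, ∑ t ∈ Finset.range T, |(q t : ℝ) - (p : ℝ)|

/-! ### Epochs and the non-uniform partition

A partition is a finite set of pairs `(l, u)`, `l < u`, standing for the intervals with these end
points. Neighbouring intervals share an end point; which of the two owns it is immaterial, because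
the rounding below sends an end point to itself. -/

/-- The epoch of round `n`: epoch `m ≥ 1` consists of the `2 ^ m` rounds `2^m - 2, …, 2^(m+1) - 3`. -/
def epoch (n : ℕ) : ℕ := Nat.log 2 (n + 2)

/-- The average outcome over epoch `m - 1`. -/
noncomputable def prevMean (m : ℕ) (h : History) : ℝ :=
  sumRounds (fun h' x => if epoch h'.length = m - 1 then outcome x.2 else 0) h / 2 ^ (m - 1)

/-- `r_m = √(ι / s_{m-1}) + C / s_{m-1}` with `s_m = 2 ^ m`. -/
noncomputable def radius (C ι : ℝ) (m : ℕ) : ℝ :=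
  Real.sqrt (ι / 2 ^ (m - 1)) + C / 2 ^ (m - 1)

/-- `Clip_{[0,1]}`. -/
noncomputable def clip (x : ℝ) : ℝ := min (max x 0) 1

/-- The partition of the interval from `l` to `u` into `N` intervals of equal length (no interval
at all if the given one is empty). -/
noncomputable def unifPart (l u : ℝ) (N : ℕ) : Finset (ℝ × ℝ) :=
  if l < u then
    (Finset.range N).image fun k : ℕ => (l + k / N * (u - l), l + (k + 1) / N * (u - l))
  else ∅

/-- Left end point `a_m` of the inner region, when the previous epoch had average outcome `y`. -/
noncomputable def innerL (C ι : ℝ) (m : ℕ) (y : ℝ) : ℝ := clip (y - 2 * radius C ι m)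

/-- Right end point `b_m` of the inner region. -/
noncomputable def innerR (C ι : ℝ) (m : ℕ) (y : ℝ) : ℝ := clip (y + 2 * radius C ι m)

/-- `N_m = ⌈(s_m |I_m|² / ι)^{1/3}⌉`. -/
noncomputable def innerCount (C ι : ℝ) (m : ℕ) (y : ℝ) : ℕ :=
  ⌈(2 ^ m * (innerR C ι m y - innerL C ι m y) ^ 2 / ι) ^ (1 / 3 : ℝ)⌉₊

/-- `K = ⌈(1 + C)^{1/3} / ι⌉`. -/
noncomputable def outerCount (C ι : ℝ) : ℕ := ⌈(1 + C) ^ (1 / 3 : ℝ) / ι⌉₊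

/-- `Q = ⌈log₂ T⌉`. -/
noncomputable def bandMax (T : ℕ) : ℕ := ⌈Real.logb 2 T⌉₊

/-- Partition of the left band `[a - (2^(j+1) - 1) r, a - (2^j - 1) r) ∩ [0,1]` into `K` intervals. -/
noncomputable def leftBand (a r : ℝ) (K j : ℕ) : Finset (ℝ × ℝ) :=
  unifPart (clip (a - (2 ^ (j + 1) - 1) * r)) (clip (a - (2 ^ j - 1) * r)) K

/-- Partition of the right band `(b + (2^j - 1) r, b + (2^(j+1) - 1) r] ∩ [0,1]` into `K` intervals. -/
noncomputable def rightBand (b r : ℝ) (K j : ℕ) : Finset (ℝ × ℝ) :=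
  unifPart (clip (b + (2 ^ j - 1) * r)) (clip (b + (2 ^ (j + 1) - 1) * r)) K

/-- The partition `Π_m` of epoch `m`, when the previous epoch had average outcome `y`. -/
noncomputable def partition (T : ℕ) (C ι : ℝ) (m : ℕ) (y : ℝ) : Finset (ℝ × ℝ) :=
  unifPart (innerL C ι m y) (innerR C ι m y) (innerCount C ι m y) ∪
    (Finset.range (bandMax T + 1)).biUnion fun j =>
      leftBand (innerL C ι m y) (radius C ι m) (outerCount C ι) j ∪
        rightBand (innerR C ι m y) (radius C ι m) (outerCount C ι) j

/-- The set `𝒵` of all end points of the intervals of a partition. -/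
noncomputable def endpoints (P : Finset (ℝ × ℝ)) : Finset ℝ :=
  P.image Prod.fst ∪ P.image Prod.snd

/-! ### The base algorithm

Every end point `s` runs online gradient descent; a stationary distribution of the rounded actions
is the forecaster's distribution. -/

/-- `a` belongs to the interval `J` (each `a ∈ [0,1]` belongs to exactly one interval). -/
def Owns (J : ℝ × ℝ) (a : ℝ) : Prop := J.1 ≤ a ∧ (a < J.2 ∨ (a = 1 ∧ J.2 = 1))

open Classical in
/-- `H(a)({z})`: the mean-preserving rounding of `a` to the end points of the interval `J` that
contains it, with probabilities `(J.2 - a) / (J.2 - J.1)` and `(a - J.1) / (J.2 - J.1)`. -/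
noncomputable def rounding (P : Finset (ℝ × ℝ)) (a z : ℝ) : ℝ :=
  ∑ J ∈ P, if Owns J a then
    (if z = J.1 then (J.2 - a) / (J.2 - J.1)
      else if z = J.2 then (a - J.1) / (J.2 - J.1) else 0)
  else 0

/-- Projected online gradient descent of the instance `s`, restarted in each epoch: the current
action `a_{s,t} ∈ [0,1]` and the accumulated weight `∑_τ 𝒫_τ(s)` of the current epoch. The loss of
round `t` is `𝒫_t(s) (a - y_t)²`, which is `2 𝒫_t(s)`-strongly convex, and the step size is the one
for strongly convex losses, `1 / ∑_{τ ≤ t} 2 𝒫_τ(s)`. (While all weights are zero so are the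
gradients, and the action stays.) `start m s` is the initial action in epoch `m`. -/
noncomputable def ogd (F : Forecaster) (start : ℕ → ℝ → ℝ) (s : ℝ) : History → ℝ × ℝ
  | [] => (start (epoch 0) s, 0)
  | x :: h =>
    if epoch (h.length + 1) ≠ epoch h.length then (start (epoch (h.length + 1)) s, 0)
    else
      let a := (ogd F start s h).1
      let w := (F h s).toReal
      let W := (ogd F start s h).2 + w
      (clip (a - 1 / (2 * W) * (2 * w * (a - outcome x.2))), W)

/-- `F` runs the algorithm for horizon `T` with parameters `C` and `ι`: in the first epoch it
predicts arbitrarily in `[0,1]`; in every round of a later epoch its distribution lives on the end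
points of the partition of that epoch and is stationary for the row-stochastic matrix with rows
`H(a_{s,t})`, where `a_{s,t}` are the actions of the gradient descent instances. The initial actions
of the instances, and the choice among several stationary distributions, are arbitrary. -/
def RunsAlgorithm (T : ℕ) (C ι : ℝ) (F : Forecaster) : Prop :=
  ∃ start : ℕ → ℝ → ℝ, (∀ m s, start m s ∈ Set.Icc (0 : ℝ) 1) ∧
    ∀ h : History, h.length < T →
      (epoch h.length = 1 → (F h).support ⊆ Set.Icc (0 : ℝ) 1) ∧
      (2 ≤ epoch h.length →
        let m := epoch h.length
        let P := partition T C ι m (prevMean m h)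
        (F h).support ⊆ (endpoints P : Set ℝ) ∧
        ∀ z ∈ endpoints P, (F h z).toReal =
          ∑ s ∈ endpoints P, (F h s).toReal * rounding P (ogd F start s h).1 z)

/-! ### Machine model

A real random access machine in structured form. The memory consists of arrays of natural numbers
and arrays of real numbers; a program is a fixed finite piece of code that works for all inputs.
Each operation of an expression, each assignment, each test and each passage through a loop costs
one step; rounding a real number up to a natural number costs, in addition, as many steps as the
result says (as if it were found by counting). -/

structure Store where
  nat : ℕ → ℕ → ℕ
  real : ℕ → ℕ → ℝ

/-- Integer expressions; `get a i` is entry `i` of integer array number `a`, `sub` is truncated. -/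
inductive NExp where
  | const (c : ℕ)
  | get (a : ℕ) (i : NExp)
  | add (e f : NExp)
  | sub (e f : NExp)

/-- Real expressions; `get a i` is entry `i` of real array number `a`. -/
inductive RExp where
  | ofNat (e : NExp)
  | get (a : ℕ) (i : NExp)
  | add (e f : RExp)
  | sub (e f : RExp)
  | mul (e f : RExp)
  | div (e f : RExp)
  | pow (e f : RExp)
  | log (e : RExp)

/-- Tests `e ≤ f`. -/
inductive Test where
  | natLe (e f : NExp)
  | realLe (e f : RExp)

/-- Programs. `setNat a i e`, `setReal a i e` and `setCeil a i e` store the value of `e` (rounded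
up, for `setCeil`) in entry `i` of array `a`; `loop e s` executes `s` as many times as the value of
`e` on entry says. -/
inductive Prog where
  | skip
  | setNat (a : ℕ) (i e : NExp)
  | setReal (a : ℕ) (i : NExp) (e : RExp)
  | setCeil (a : ℕ) (i : NExp) (e : RExp)
  | seq (s t : Prog)
  | ite (b : Test) (s t : Prog)
  | loop (e : NExp) (s : Prog)

def NExp.eval (σ : Store) : NExp → ℕ
  | .const c => c
  | .get a i => σ.nat a (i.eval σ)
  | .add e f => e.eval σ + f.eval σ
  | .sub e f => e.eval σ - f.eval σ

def NExp.cost : NExp → ℕ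
  | .const _ => 1
  | .get _ i => i.cost + 1
  | .add e f => e.cost + f.cost + 1
  | .sub e f => e.cost + f.cost + 1

noncomputable def RExp.eval (σ : Store) : RExp → ℝ
  | .ofNat e => (e.eval σ : ℝ)
  | .get a i => σ.real a (i.eval σ)
  | .add e f => e.eval σ + f.eval σ
  | .sub e f => e.eval σ - f.eval σ
  | .mul e f => e.eval σ * f.eval σ
  | .div e f => e.eval σ / f.eval σ
  | .pow e f => e.eval σ ^ f.eval σ
  | .log e => Real.log (e.eval σ)

def RExp.cost : RExp → ℕ
  | .ofNat e => e.cost + 1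
  | .get _ i => i.cost + 1
  | .add e f => e.cost + f.cost + 1
  | .sub e f => e.cost + f.cost + 1
  | .mul e f => e.cost + f.cost + 1
  | .div e f => e.cost + f.cost + 1
  | .pow e f => e.cost + f.cost + 1
  | .log e => e.cost + 1

def Test.Holds (σ : Store) : Test → Prop
  | .natLe e f => e.eval σ ≤ f.eval σ
  | .realLe e f => e.eval σ ≤ f.eval σ

def Test.cost : Test → ℕ
  | .natLe e f => e.cost + f.cost + 1
  | .realLe e f => e.cost + f.cost + 1

def Store.setNat (σ : Store) (a i v : ℕ) : Store :=
  { σ with nat := Function.update σ.nat a (Function.update (σ.nat a) i v) }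

def Store.setReal (σ : Store) (a i : ℕ) (v : ℝ) : Store :=
  { σ with real := Function.update σ.real a (Function.update (σ.real a) i v) }

open Classical in
/-- Execution: the final store and the number of steps. -/
noncomputable def Prog.run : Prog → Store → Store × ℕ
  | .skip, σ => (σ, 0)
  | .setNat a i e, σ => (σ.setNat a (i.eval σ) (e.eval σ), i.cost + e.cost + 1)
  | .setReal a i e, σ => (σ.setReal a (i.eval σ) (e.eval σ), i.cost + e.cost + 1)
  | .setCeil a i e, σ =>
      (σ.setNat a (i.eval σ) ⌈e.eval σ⌉₊, i.cost + e.cost + ⌈e.eval σ⌉₊ + 1)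
  | .seq s t, σ =>
      let r := s.run σ
      let r' := t.run r.1
      (r'.1, r.2 + r'.2)
  | .ite b s t, σ =>
      let r := if b.Holds σ then s.run σ else t.run σ
      (r.1, b.cost + r.2 + 1)
  | .loop e s, σ =>
      (fun p : Store × ℕ => ((s.run p.1).1, p.2 + (s.run p.1).2 + 1))^[e.eval σ] (σ, e.cost + 1)

/-- The initial store: `T` in entry 0 of integer array 0, `C` and `ι` in entries 0 and 1 of real
array 0, zero elsewhere. -/
noncomputable def initStore (T : ℕ) (C ι : ℝ) : Store :=
  (({ nat := fun _ _ => 0, real := fun _ _ => 0 } : Store).setNat 0 0 T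
    |>.setReal 0 0 C).setReal 0 1 ι

/-- The store after the program has been executed for the round that follows the outcomes `ys`
(newest first), and the number of steps of this last execution. The program is executed once per
round, on the store that its previous execution left, with the newest outcome put in entry 0 of
integer array 1. -/
noncomputable def roundRun (prog : Prog) (T : ℕ) (C ι : ℝ) : List Bool → Store × ℕ
  | [] => prog.run (initStore T C ι)
  | y :: ys => prog.run ((roundRun prog T C ι ys).1.setNat 1 0 (if y then 1 else 0))

/-- Number of points that the store lists as its output. -/
def Store.outSize (σ : Store) : ℕ := σ.nat 2 0

/-- The store lists the distribution `p` as its output: points in real array 1, their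
probabilities in real array 2. -/
def Store.Outputs (σ : Store) (p : PMF ℝ) : Prop :=
  (∀ i < σ.outSize, 0 ≤ σ.real 2 i) ∧
    ∀ z : ℝ, (p z).toReal =
      ∑ i ∈ Finset.range σ.outSize, if σ.real 1 i = z then σ.real 2 i else 0

/-- The cost of a round: the steps of the program, and one step per listed point for drawing the
prediction from the listed distribution. -/
noncomputable def roundCost (prog : Prog) (T : ℕ) (C ι : ℝ) (ys : List Bool) : ℕ :=
  (roundRun prog T C ι ys).2 + (roundRun prog T C ι ys).1.outSize

end Calib

/-! Fix a minimiser `p` of `∑ |q_t - p|`, whose value is `C`; it enters only the analysis. Within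
one epoch, the squared bias of a point divided by its weight is exactly the regret, in square loss
weighted by `𝒫_t`, of that point against the best constant (`exists_bias_sq_div_eq`). So the
pseudo-calibration error of an epoch is a swap regret. Stationarity turns it into external regrets:
drawing from `𝒫_t` is the same as drawing an instance and rounding its action, and mean-preserving
rounding of `a` to `l, u` raises the expected square loss by exactly the variance `(u - a)(a - l)`
(`stationary_loss_le`). Each instance has logarithmic regret by strong convexity (`regret_le`). An
epoch therefore costs the number of points times a logarithm, plus the rounding variance.

The partition is shaped to make this variance small. With high probability the previous mean is
within `r_m` of `p`. In the inner region the variance is at most `(|I|/N)²/4`, and `N` is chosen so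
that this sums to order `(1+C)^{1/3} ι`. In an outer band the distance from the action to `p` is at
least the width of the band, so the variance is at most `(a - p)²/(4K²)` (`rounding_variance_le`).
It remains to bound `V`, the total of `𝒫_t(s)(a_s - p)²`. Regret against the constant `p` bounds `V`
up to a linear term `∑ drift (y_t - p)`. Its part `q_t - p` costs at most `2C`; its martingale part
is absorbed, because the squared drift is at most four times the spread, so that `V` is at most
`V/2` plus known terms (`total_spread_le`). Since `K ≥ (1+C)^{1/3}/ι`, the contribution `C/K²` is at
most `(1+C)^{1/3} ι²` (`sum_epochPcal_le`). Epochs are combined by Cauchy–Schwarz (`sq_sum_div_le`).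

The realised error `Cal_2` follows because visit counts and realised biases concentrate around their
weighted versions (`failsRarely_visits`, `visitBias_sq_div_le`). All tail bounds come from
exponential supermartingales, with a union bound over every point that can occur
(`calibration_bounds`).

For the running time, there are `O((1+C)^{1/3} log T)` points and each row of the transition matrix
has only two nonzero entries. Conjugate gradients for the Gram operator of `1 - Q` cost linear time
per step and are exact after as many steps as there are points (`cg_stationary`), so a round takes
quadratic time in the number of points. A small program logic (`Ok`) proves correctness and cost
together. -/

namespace Calib

/-! ### Sums over the rounds of a history -/

@[simp] theorem sumRounds_nil (f : History → ℝ × Bool → ℝ) : sumRounds f [] = 0 := rfl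

@[simp] theorem sumRounds_cons (f : History → ℝ × Bool → ℝ) (x : ℝ × Bool) (h : History) :
    sumRounds f (x :: h) = sumRounds f h + f h x := rfl

theorem sumRounds_mono {f g : History → ℝ × Bool → ℝ} : ∀ {h : History},
    (∀ h' x, (x :: h') <:+ h → f h' x ≤ g h' x) → sumRounds f h ≤ sumRounds g h
  | [], _ => le_rfl
  | x :: h, H => add_le_add
      (sumRounds_mono fun h' y hs => H h' y (hs.trans (List.suffix_cons x h)))
      (H h x List.suffix_rfl)

theorem sumRounds_congr {f g : History → ℝ × Bool → ℝ} {h : History}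
    (H : ∀ h' x, (x :: h') <:+ h → f h' x = g h' x) : sumRounds f h = sumRounds g h :=
  le_antisymm (sumRounds_mono fun h' x hs => (H h' x hs).le)
    (sumRounds_mono fun h' x hs => (H h' x hs).ge)

@[simp] theorem sumRounds_zero (h : History) : sumRounds (fun _ _ => 0) h = 0 := by
  induction h <;> simp [*]

theorem sumRounds_nonneg {f : History → ℝ × Bool → ℝ} {h : History}
    (H : ∀ h' x, (x :: h') <:+ h → 0 ≤ f h' x) : 0 ≤ sumRounds f h := by
  rw [← sumRounds_zero h]; exact sumRounds_mono H

theorem sumRounds_add (f g : History → ℝ × Bool → ℝ) (h : History) :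
    sumRounds (fun h' x => f h' x + g h' x) h = sumRounds f h + sumRounds g h := by
  induction h with
  | nil => simp
  | cons x h ih => simp only [sumRounds_cons, ih]; ring

theorem sumRounds_sub (f g : History → ℝ × Bool → ℝ) (h : History) :
    sumRounds (fun h' x => f h' x - g h' x) h = sumRounds f h - sumRounds g h := by
  induction h with
  | nil => simp
  | cons x h ih => simp only [sumRounds_cons, ih]; ring

theorem sumRounds_mul (c : ℝ) (f : History → ℝ × Bool → ℝ) (h : History) :
    sumRounds (fun h' x => c * f h' x) h = c * sumRounds f h := by
  induction h with
  | nil => simp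
  | cons x h ih => simp only [sumRounds_cons, ih]; ring

theorem sumRounds_finset_sum {α : Type*} (s : Finset α) (f : α → History → ℝ × Bool → ℝ)
    (h : History) :
    sumRounds (fun h' x => ∑ i ∈ s, f i h' x) h = ∑ i ∈ s, sumRounds (f i) h := by
  induction h with
  | nil => simp
  | cons x h ih => simp only [sumRounds_cons, ih, Finset.sum_add_distrib]

theorem sumRounds_length (f : ℕ → ℝ) (h : History) :
    sumRounds (fun h' _ => f h'.length) h = ∑ t ∈ Finset.range h.length, f t := by
  induction h with
  | nil => simp
  | cons x h ih => simp only [sumRounds_cons, ih, List.length_cons, Finset.sum_range_succ]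

theorem abs_sumRounds_le (f : History → ℝ × Bool → ℝ) (h : History) :
    |sumRounds f h| ≤ sumRounds (fun h' x => |f h' x|) h := by
  induction h with
  | nil => simp
  | cons x h ih => exact (abs_add_le _ _).trans (by simpa using ih)

/-- The sum over the rounds of epoch `m`. -/
noncomputable def epochSum (m : ℕ) (f : History → ℝ × Bool → ℝ) (h : History) : ℝ :=
  sumRounds (fun h' x => if epoch h'.length = m then f h' x else 0) h

@[simp] theorem epochSum_nil (m : ℕ) (f : History → ℝ × Bool → ℝ) : epochSum m f [] = 0 := rfl

theorem epochSum_cons (m : ℕ) (f : History → ℝ × Bool → ℝ) (x : ℝ × Bool) (h : History) :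
    epochSum m f (x :: h) = epochSum m f h + if epoch h.length = m then f h x else 0 := rfl

theorem epochSum_mono {m : ℕ} {f g : History → ℝ × Bool → ℝ} {h : History}
    (H : ∀ h' x, (x :: h') <:+ h → epoch h'.length = m → f h' x ≤ g h' x) :
    epochSum m f h ≤ epochSum m g h :=
  sumRounds_mono fun h' x hs => by split_ifs with he; exacts [H h' x hs he, le_rfl]

theorem epochSum_congr {m : ℕ} {f g : History → ℝ × Bool → ℝ} {h : History}
    (H : ∀ h' x, (x :: h') <:+ h → epoch h'.length = m → f h' x = g h' x) :
    epochSum m f h = epochSum m g h :=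
  sumRounds_congr fun h' x hs => by split_ifs with he; exacts [H h' x hs he, rfl]

theorem epochSum_nonneg {m : ℕ} {f : History → ℝ × Bool → ℝ} {h : History}
    (H : ∀ h' x, (x :: h') <:+ h → epoch h'.length = m → 0 ≤ f h' x) : 0 ≤ epochSum m f h :=
  sumRounds_nonneg fun h' x hs => by split_ifs with he; exacts [H h' x hs he, le_rfl]

theorem epochSum_add (m : ℕ) (f g : History → ℝ × Bool → ℝ) (h : History) :
    epochSum m (fun h' x => f h' x + g h' x) h = epochSum m f h + epochSum m g h := by
  simp only [epochSum, ← sumRounds_add]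
  exact sumRounds_congr fun h' x _ => by split_ifs <;> simp

theorem epochSum_sub (m : ℕ) (f g : History → ℝ × Bool → ℝ) (h : History) :
    epochSum m (fun h' x => f h' x - g h' x) h = epochSum m f h - epochSum m g h := by
  simp only [epochSum, ← sumRounds_sub]
  exact sumRounds_congr fun h' x _ => by split_ifs <;> simp

theorem epochSum_mul (m : ℕ) (c : ℝ) (f : History → ℝ × Bool → ℝ) (h : History) :
    epochSum m (fun h' x => c * f h' x) h = c * epochSum m f h := by
  simp only [epochSum, ← sumRounds_mul]
  exact sumRounds_congr fun h' x _ => by split_ifs <;> simp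

theorem epochSum_finset_sum {α : Type*} (m : ℕ) (s : Finset α)
    (f : α → History → ℝ × Bool → ℝ) (h : History) :
    epochSum m (fun h' x => ∑ i ∈ s, f i h' x) h = ∑ i ∈ s, epochSum m (f i) h := by
  simp only [epochSum, ← sumRounds_finset_sum]
  exact sumRounds_congr fun h' x _ => by split_ifs <;> simp

theorem abs_epochSum_le (m : ℕ) (f : History → ℝ × Bool → ℝ) (h : History) :
    |epochSum m f h| ≤ epochSum m (fun h' x => |f h' x|) h :=
  (abs_sumRounds_le _ _).trans (sumRounds_mono fun h' x _ => by split_ifs <;> simp)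

/-! ### Arithmetic of the doubling epochs -/

theorem epoch_pos (n : ℕ) : 1 ≤ epoch n :=
  Nat.log_pos (by norm_num) (by omega)

theorem epoch_mono {a b : ℕ} (h : a ≤ b) : epoch a ≤ epoch b := Nat.log_mono_right (by omega)

theorem epoch_eq_iff {n m : ℕ} (hm : 1 ≤ m) : epoch n = m ↔ 2 ^ m ≤ n + 2 ∧ n + 2 < 2 ^ (m + 1) := by
  unfold epoch; rw [Nat.log_eq_iff]; exact Or.inl (by omega)

theorem epoch_le_of_suffix {h h' : History} {x : ℝ × Bool} (hs : (x :: h') <:+ h) :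
    epoch h'.length ≤ epoch (h.length - 1) := by
  have := hs.length_le
  simp only [List.length_cons] at this
  exact epoch_mono (by omega)

theorem sum_epochSum_two (f : History → ℝ × Bool → ℝ) (h : History) :
    ∑ m ∈ Finset.Icc 2 (epoch (h.length - 1)), epochSum m f h =
      sumRounds (fun h' x => if 2 ≤ epoch h'.length then f h' x else 0) h := by
  simp only [epochSum, ← sumRounds_finset_sum]
  refine sumRounds_congr fun h' x hs => ?_
  rw [Finset.sum_ite_eq]
  simp only [Finset.mem_Icc, epoch_le_of_suffix hs, and_true]

theorem sumRounds_eq_epochSum (f : History → ℝ × Bool → ℝ) (h : History) :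
    sumRounds f h =
      epochSum 1 f h + ∑ m ∈ Finset.Icc 2 (epoch (h.length - 1)), epochSum m f h := by
  rw [sum_epochSum_two, epochSum, ← sumRounds_add]
  refine sumRounds_congr fun h' x _ => ?_
  have := epoch_pos h'.length
  by_cases h2 : 2 ≤ epoch h'.length
  · rw [if_neg (by omega), if_pos h2, zero_add]
  · rw [if_pos (by omega), if_neg h2, add_zero]

theorem epochSum_eq_zero {m : ℕ} {f : History → ℝ × Bool → ℝ} {h : History}
    (H : ∀ t < h.length, epoch t ≠ m) : epochSum m f h = 0 :=
  (sumRounds_congr (g := fun _ _ => 0) fun h' x hs => if_neg (H _ (by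
    have := hs.length_le
    simp only [List.length_cons] at this
    omega))).trans (sumRounds_zero h)

/-- Epochs increase with the round, so an epoch that is over receives no further terms. Consequently
the previous mean, and with it the partition, is constant throughout an epoch. -/
theorem epochSum_of_suffix {f : History → ℝ × Bool → ℝ} {m : ℕ} {h' : History} (hm : m < epoch h'.length) :
    ∀ {h : History}, h' <:+ h → epochSum m f h = epochSum m f h'
  | [], hs => by rw [List.suffix_nil.1 hs]
  | x :: h, hs => by
    rcases List.suffix_cons_iff.1 hs with rfl | hs'
    · rfl
    · rw [epochSum_cons, epochSum_of_suffix hm hs', if_neg, add_zero]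
      have := epoch_mono hs'.length_le
      omega

theorem prevMean_eq (m : ℕ) (h : History) :
    prevMean m h = epochSum (m - 1) (fun _ x => outcome x.2) h / 2 ^ (m - 1) := rfl

theorem prevMean_of_suffix {m : ℕ} {h' h : History} (hm : 1 ≤ m) (he : m ≤ epoch h'.length)
    (hs : h' <:+ h) : prevMean m h' = prevMean m h := by
  rw [prevMean_eq, prevMean_eq, epochSum_of_suffix (by omega) hs]

theorem epochSum_one (m : ℕ) (h : History) :
    epochSum m (fun _ _ => 1) h = ((Finset.range h.length).filter (fun t => epoch t = m)).card := by
  rw [epochSum, sumRounds_length (fun t => if epoch t = m then 1 else 0)]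
  simp

theorem filter_epoch_subset {m : ℕ} (hm : 1 ≤ m) (n : ℕ) :
    (Finset.range n).filter (fun t => epoch t = m) ⊆ Finset.Ico (2 ^ m - 2) (2 ^ (m + 1) - 2) := by
  intro t ht
  have := (epoch_eq_iff hm).1 (Finset.mem_filter.1 ht).2
  rw [Finset.mem_Ico]; omega

theorem epochSum_one_le {m : ℕ} (hm : 1 ≤ m) (h : History) :
    epochSum m (fun _ _ => 1) h ≤ 2 ^ m := by
  rw [epochSum_one]
  have := Finset.card_le_card (filter_epoch_subset hm h.length)
  rw [Nat.card_Ico] at this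
  have h2 : 2 ^ (m + 1) - 2 - (2 ^ m - 2) ≤ 2 ^ m := by rw [pow_succ]; omega
  exact_mod_cast this.trans h2

theorem epochSum_one_eq {m : ℕ} (hm : 1 ≤ m) {h : History} (he : m < epoch h.length) :
    epochSum m (fun _ _ => 1) h = 2 ^ m := by
  rw [epochSum_one]
  have h1 : (Finset.range h.length).filter (fun t => epoch t = m)
      = Finset.Ico (2 ^ m - 2) (2 ^ (m + 1) - 2) := by
    refine (filter_epoch_subset hm _).antisymm fun t ht => ?_
    rw [Finset.mem_Ico] at ht
    have h3 : 2 ^ (m + 1) ≤ h.length + 2 := by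
      have : 2 ^ (m + 1) ≤ 2 ^ epoch h.length := Nat.pow_le_pow_right (by norm_num) he
      exact this.trans (Nat.pow_log_le_self 2 (by omega))
    have h2 : 2 ≤ 2 ^ m := by simpa using Nat.pow_le_pow_right (n := 2) (by norm_num) hm
    rw [Finset.mem_filter, Finset.mem_range, epoch_eq_iff hm]
    omega
  rw [h1, Nat.card_Ico]
  have h2 : 2 ≤ 2 ^ m := by simpa using Nat.pow_le_pow_right (n := 2) (by norm_num) hm
  have : 2 ^ (m + 1) - 2 - (2 ^ m - 2) = 2 ^ m := by rw [pow_succ]; omega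
  rw [this]; norm_num

theorem outcome_mem (b : Bool) : outcome b ∈ Set.Icc (0 : ℝ) 1 := by
  cases b <;> simp [outcome]

theorem prevMean_mem {m : ℕ} (hm : 1 ≤ m) (h : History) : prevMean m h ∈ Set.Icc (0 : ℝ) 1 := by
  rw [prevMean_eq]
  have h0 : 0 ≤ epochSum (m - 1) (fun _ x => outcome x.2) h :=
    epochSum_nonneg fun _ x _ _ => (outcome_mem x.2).1
  have h1 : epochSum (m - 1) (fun _ x => outcome x.2) h ≤ epochSum (m - 1) (fun _ _ => 1) h :=
    epochSum_mono fun _ x _ _ => (outcome_mem x.2).2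
  refine ⟨by positivity, (div_le_one (by positivity)).2 ?_⟩
  -- For `m = 1` there is no preceding epoch: the sum is empty and the mean is `0`. The program does
  -- use this value in its first epoch.
  rcases Nat.eq_or_lt_of_le hm with rfl | hm
  · have : epochSum (1 - 1) (fun _ x => outcome x.2) h = 0 := by
      refine (sumRounds_congr (g := fun _ _ => 0) fun h' x _ => if_neg ?_).trans (sumRounds_zero h)
      have := epoch_pos h'.length; omega
    rw [this]; positivity
  · exact h1.trans (epochSum_one_le (by omega) h)

/-! ### Exponential supermartingales -/

theorem tsum_bind_mul {α β : Type*} (p : PMF α) (f : α → PMF β) (g : β → ENNReal) :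
    ∑' b, p.bind f b * g b = ∑' a, p a * ∑' b, f a b * g b := by
  simp only [PMF.bind_apply, ← ENNReal.tsum_mul_right, ← ENNReal.tsum_mul_left]
  rw [ENNReal.tsum_comm]
  simp only [mul_assoc]

theorem tsum_map_mul {α β : Type*} (p : PMF α) (f : α → β) (g : β → ENNReal) :
    ∑' b, p.map f b * g b = ∑' a, p a * g (f a) := by
  rw [← PMF.bind_pure_comp, tsum_bind_mul]
  refine tsum_congr fun a => ?_
  congr 1
  rw [tsum_eq_single (f a)]
  · simp [PMF.pure_apply]
  · intro b hb; simp [PMF.pure_apply, hb]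

/-- The one-round expectation of `φ` given the history `h`. -/
noncomputable def roundExp (F : Forecaster) (q : ℕ → unitInterval) (h : History)
    (φ : ℝ × Bool → ENNReal) : ENNReal :=
  ∑' p, F h p * ∑ y, ber (q h.length) y * φ (p, y)

theorem law_succ_tsum (F : Forecaster) (q : ℕ → unitInterval) (n : ℕ) (g : History → ENNReal) :
    ∑' h, law F q (n + 1) h * g h =
      ∑' h, law F q n h * ∑' p, F h p * ∑ y, ber (q n) y * g ((p, y) :: h) := by
  simp only [law, tsum_bind_mul, tsum_map_mul, tsum_fintype]

theorem mem_support_law {F : Forecaster} {q : ℕ → unitInterval} : ∀ {n : ℕ} {h : History},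
    h ∈ (law F q n).support →
      h.length = n ∧ ∀ h' x, (x :: h') <:+ h → x.1 ∈ (F h').support
  | 0, h, hh => by
    simp only [law, PMF.support_pure, Set.mem_singleton_iff] at hh
    subst hh
    exact ⟨rfl, fun h' x hs => absurd hs.length_le (by simp)⟩
  | n + 1, h, hh => by
    simp only [law, PMF.mem_support_bind_iff, PMF.mem_support_map_iff] at hh
    obtain ⟨h₀, h1, p, hp, y, -, rfl⟩ := hh
    obtain ⟨hl, hs⟩ := mem_support_law h1
    refine ⟨by simp [hl], fun h' x hsuf => ?_⟩
    rcases List.suffix_cons_iff.1 hsuf with heq | hsuf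
    · injection heq with h3 h4; subst h3; subst h4; exact hp
    · exact hs h' x hsuf

/-- Given the history, the factor of the newest round has mean at most `1`, so the expected product
does not grow with `n`. -/
theorem law_exp_sumRounds_le {F : Forecaster} {q : ℕ → unitInterval}
    {φ : History → ℝ × Bool → ℝ}
    (H : ∀ h, roundExp F q h (fun x => ENNReal.ofReal (Real.exp (φ h x))) ≤ 1) (n : ℕ) :
    ∑' h, law F q n h * ENNReal.ofReal (Real.exp (sumRounds φ h)) ≤ 1 := by
  induction n with
  | zero => simp [law, PMF.pure_apply]
  | succ n ih =>
    rw [law_succ_tsum]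
    refine (ENNReal.tsum_le_tsum fun h => ?_).trans ih
    by_cases hh : h ∈ (law F q n).support
    · refine mul_le_mul_right ?_ _
      have hl := (mem_support_law hh).1
      subst hl
      simp only [sumRounds_cons, Real.exp_add]
      have : ∀ p y, ber (q h.length) y * ENNReal.ofReal (Real.exp (sumRounds φ h) * Real.exp (φ h (p, y)))
          = ENNReal.ofReal (Real.exp (sumRounds φ h)) *
            (ber (q h.length) y * ENNReal.ofReal (Real.exp (φ h (p, y)))) := by
        intro p y
        rw [ENNReal.ofReal_mul (Real.exp_nonneg _)]; ring
      simp only [this, ← Finset.mul_sum, mul_left_comm _ (ENNReal.ofReal (Real.exp (sumRounds φ h)))]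
      rw [ENNReal.tsum_mul_left]
      exact mul_le_of_le_one_right' (H h)
    · rw [PMF.mem_support_iff, not_not] at hh
      simp [hh]

/-- Markov's inequality for the supermartingale. Every concentration bound below is an instance,
with a suitable `φ`. -/
theorem law_tail_le {F : Forecaster} {q : ℕ → unitInterval} {φ : History → ℝ × Bool → ℝ}
    (H : ∀ h, roundExp F q h (fun x => ENNReal.ofReal (Real.exp (φ h x))) ≤ 1) (n : ℕ) (x : ℝ) :
    (law F q n).toOuterMeasure {h | x < sumRounds φ h} ≤ ENNReal.ofReal (Real.exp (-x)) := by
  rw [PMF.toOuterMeasure_apply]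
  calc _ ≤ ∑' h, law F q n h * ENNReal.ofReal (Real.exp (sumRounds φ h)) *
        ENNReal.ofReal (Real.exp (-x)) := by
        refine ENNReal.tsum_le_tsum fun h => ?_
        by_cases hx : x < sumRounds φ h
        · rw [Set.indicator_of_mem (by exact hx), mul_assoc,
            ← ENNReal.ofReal_mul (Real.exp_nonneg _), ← Real.exp_add]
          refine le_mul_of_one_le_right' ?_
          rw [← ENNReal.ofReal_one]
          exact ENNReal.ofReal_le_ofReal (Real.one_le_exp (by linarith))
        · rw [Set.indicator_of_notMem (by exact hx)]; exact zero_le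
    _ ≤ _ := by
        rw [ENNReal.tsum_mul_right]
        exact mul_le_of_le_one_left' (law_exp_sumRounds_le H n)

/-- Symmetrisation: by convexity `exp (-g a)` is at most `a exp (-g) + 1 - a`, the moment generating
function of an independent copy at `-g`. The product is `1 + 2a(1-a)(cosh g - 1) ≤ cosh g`.
Hoeffding's sharper constant `1/8` is not needed. -/
theorem bernoulli_mgf_le {a g : ℝ} (h0 : 0 ≤ a) (h1 : a ≤ 1) :
    a * Real.exp (g * (1 - a)) + (1 - a) * Real.exp (-(g * a)) ≤ Real.exp (g ^ 2 / 2) := by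
  have hc : Real.exp (-(g * a)) ≤ a * Real.exp (-g) + (1 - a) * 1 := by
    have := convexOn_exp.2 (Set.mem_univ (-g)) (Set.mem_univ (0 : ℝ)) h0 (sub_nonneg.2 h1)
      (by ring)
    simp only [smul_eq_mul, mul_zero, add_zero, Real.exp_zero] at this
    rwa [show -(g * a) = a * -g by ring]
  have hcosh := Real.cosh_le_exp_half_sq g
  refine le_trans ?_ hcosh
  rw [show g * (1 - a) = g + -(g * a) by ring, Real.exp_add]
  have hpos := Real.exp_pos g
  calc a * (Real.exp g * Real.exp (-(g * a))) + (1 - a) * Real.exp (-(g * a))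
      = (a * Real.exp g + (1 - a)) * Real.exp (-(g * a)) := by ring
    _ ≤ (a * Real.exp g + (1 - a)) * (a * Real.exp (-g) + (1 - a) * 1) :=
        mul_le_mul_of_nonneg_left hc (by nlinarith)
    _ = a ^ 2 * (Real.exp g * Real.exp (-g)) + (1 - a) ^ 2 + 2 * a * (1 - a) * Real.cosh g := by
        rw [Real.cosh_eq]; ring
    _ = 1 + 2 * a * (1 - a) * (Real.cosh g - 1) := by
        rw [← Real.exp_add, add_neg_cancel, Real.exp_zero]; ring
    _ ≤ Real.cosh g := by
        have := Real.one_le_cosh g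
        nlinarith [mul_nonneg (sub_nonneg.2 this) (sq_nonneg (1 - 2 * a)),
          mul_nonneg (sub_nonneg.2 this) (sq_nonneg a), mul_nonneg (sub_nonneg.2 this) (sq_nonneg (1 - a))]

/-- From `exp x ≤ 1 + x + x²` for `|x| ≤ 1`. The exponent carries the factor `a`, so fluctuations of
the visits to a point are measured by its own weight and not by the length of the epoch. -/
theorem bernoulli_mgf_le' {a v : ℝ} (h0 : 0 ≤ a) (h1 : a ≤ 1) (hv : |v| ≤ 1) :
    a * Real.exp (v * (1 - a)) + (1 - a) * Real.exp (-(v * a)) ≤ Real.exp (v ^ 2 * a) := by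
  have key : ∀ x : ℝ, |x| ≤ 1 → Real.exp x ≤ 1 + x + x ^ 2 := fun x hx => by
    have := abs_le.1 (Real.abs_exp_sub_one_sub_id_le hx); linarith
  have b1 : |v * (1 - a)| ≤ 1 := by
    rw [abs_mul, abs_of_nonneg (sub_nonneg.2 h1)]
    exact mul_le_one₀ hv (by linarith) (by linarith)
  have b2 : |-(v * a)| ≤ 1 := by
    rw [abs_neg, abs_mul, abs_of_nonneg h0]
    exact mul_le_one₀ hv h0 h1
  have e1 := mul_le_mul_of_nonneg_left (key _ b1) h0
  have e2 := mul_le_mul_of_nonneg_left (key _ b2) (sub_nonneg.2 h1)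
  have e3 := Real.add_one_le_exp (v ^ 2 * a)
  nlinarith [mul_nonneg (sq_nonneg v) (sq_nonneg a)]

theorem ber_true (q : unitInterval) : ber q true = ENNReal.ofReal q := rfl

theorem ber_false (q : unitInterval) : ber q false = ENNReal.ofReal (1 - q) := rfl

theorem roundExp_outcome_le (F : Forecaster) (q : ℕ → unitInterval) (g : History → ℝ)
    (h : History) :
    roundExp F q h (fun x => ENNReal.ofReal (Real.exp
      (g h * (outcome x.2 - q h.length) - g h ^ 2 / 2))) ≤ 1 := by
  have hq := (q h.length).2
  have hq1 : (0 : ℝ) ≤ 1 - q h.length := sub_nonneg.2 hq.2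
  have : ∑ y, ber (q h.length) y * ENNReal.ofReal (Real.exp
      (g h * (outcome y - q h.length) - g h ^ 2 / 2)) ≤ 1 := by
    rw [Fintype.sum_bool, ber_true, ber_false, ← ENNReal.ofReal_mul hq.1,
      ← ENNReal.ofReal_mul hq1, ← ENNReal.ofReal_add
        (mul_nonneg hq.1 (Real.exp_nonneg _)) (mul_nonneg hq1 (Real.exp_nonneg _))]
    refine ENNReal.ofReal_le_one.2 ?_
    have := bernoulli_mgf_le (g := g h) hq.1 hq.2
    simp only [outcome, if_true, Bool.false_eq_true, if_false, Real.exp_sub]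
    rw [← mul_div_assoc, ← mul_div_assoc, ← add_div, div_le_one (Real.exp_pos _), zero_sub, mul_neg]
    exact this
  have h2 : ∀ p, F h p * ∑ y, ber (q h.length) y * ENNReal.ofReal (Real.exp
      (g h * (outcome y - q h.length) - g h ^ 2 / 2)) ≤ F h p := fun p =>
    (mul_le_mul_right this _).trans (mul_one _).le
  exact (ENNReal.tsum_le_tsum h2).trans (PMF.tsum_coe (F h)).le

theorem tsum_mul_ite (μ : PMF ℝ) (p₀ : ℝ) (A B : ENNReal) :
    ∑' p, μ p * (if p = p₀ then A else B) = μ p₀ * A + (1 - μ p₀) * B := by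
  have h0 := ENNReal.tsum_eq_add_tsum_ite (f := fun p => μ p * (if p = p₀ then A else B)) p₀
  rw [h0, if_pos rfl]
  congr 1
  have h1 : μ p₀ + ∑' p, (if p = p₀ then 0 else μ p) = 1 :=
    (ENNReal.tsum_eq_add_tsum_ite (f := μ) p₀).symm.trans (PMF.tsum_coe μ)
  have h2 : ∑' p, (if p = p₀ then 0 else μ p) = 1 - μ p₀ :=
    ENNReal.eq_sub_of_add_eq (μ.apply_ne_top p₀) (by rw [add_comm]; exact h1)
  rw [← h2, ← ENNReal.tsum_mul_right]
  exact tsum_congr fun p => by split_ifs <;> simp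

theorem toReal_le_one (μ : PMF ℝ) (p : ℝ) : (μ p).toReal ≤ 1 := by
  simpa using ENNReal.toReal_mono ENNReal.one_ne_top (μ.coe_le_one p)

/-- The multiplier `v` may depend on the outcome of the same round: prediction and outcome are
independent given the history, so the Bernoulli bound for the indicator of `p₀` applies for each
fixed outcome. This admits `v` proportional to `y - p₀`, which compares realised with weighted
biases. -/
theorem roundExp_visit_le (F : Forecaster) (q : ℕ → unitInterval) (p₀ : ℝ)
    (v : History → Bool → ℝ) (hv : ∀ h y, |v h y| ≤ 1) (h : History) :
    roundExp F q h (fun x => ENNReal.ofReal (Real.exp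
      (v h x.2 * ((if x.1 = p₀ then 1 else 0) - (F h p₀).toReal)
        - v h x.2 ^ 2 * (F h p₀).toReal))) ≤ 1 := by
  set a := (F h p₀).toReal with ha
  have hF : F h p₀ = ENNReal.ofReal a := (ENNReal.ofReal_toReal ((F h).apply_ne_top p₀)).symm
  have h0 : 0 ≤ a := ENNReal.toReal_nonneg
  have h1 : a ≤ 1 := toReal_le_one _ _
  have key : ∀ y, ∑' p, F h p * ENNReal.ofReal (Real.exp
      (v h y * ((if p = p₀ then 1 else 0) - a) - v h y ^ 2 * a)) ≤ 1 := by
    intro y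
    have : ∀ p, ENNReal.ofReal (Real.exp (v h y * ((if p = p₀ then 1 else 0) - a) - v h y ^ 2 * a))
        = if p = p₀ then ENNReal.ofReal (Real.exp (v h y * (1 - a)) / Real.exp (v h y ^ 2 * a))
          else ENNReal.ofReal (Real.exp (-(v h y * a)) / Real.exp (v h y ^ 2 * a)) := by
      intro p
      split_ifs <;> simp [Real.exp_sub]
    simp only [this]
    rw [tsum_mul_ite, hF, ← ENNReal.ofReal_one, ← ENNReal.ofReal_sub _ h0,
      ← ENNReal.ofReal_mul h0, ← ENNReal.ofReal_mul (by linarith),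
      ← ENNReal.ofReal_add (by positivity) (mul_nonneg (by linarith) (by positivity))]
    refine ENNReal.ofReal_le_ofReal ?_
    rw [← mul_div_assoc, ← mul_div_assoc, ← add_div, div_le_one (Real.exp_pos _)]
    exact bernoulli_mgf_le' h0 h1 (hv h y)
  unfold roundExp
  simp only [Finset.mul_sum]
  rw [Summable.tsum_finsetSum fun _ _ => ENNReal.summable]
  calc _ = ∑ y, ber (q h.length) y * ∑' p, F h p * ENNReal.ofReal (Real.exp
      (v h y * ((if p = p₀ then 1 else 0) - a) - v h y ^ 2 * a)) := by
        refine Finset.sum_congr rfl fun y _ => ?_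
        rw [← ENNReal.tsum_mul_left]
        exact tsum_congr fun p => by ring
    _ ≤ ∑ y, ber (q h.length) y * 1 := Finset.sum_le_sum fun y _ => mul_le_mul_right (key y) _
    _ = 1 := by
        simp only [mul_one]
        exact (tsum_fintype _).symm.trans (PMF.tsum_coe _)

/-! ### Partitions as chains of consecutive intervals -/

theorem clip_mem (x : ℝ) : clip x ∈ Set.Icc (0 : ℝ) 1 :=
  ⟨le_min (le_max_right _ _) zero_le_one, min_le_right _ _⟩

theorem clip_of_mem {x : ℝ} (hx : x ∈ Set.Icc (0 : ℝ) 1) : clip x = x := by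
  rw [clip, max_eq_left hx.1, min_eq_left hx.2]

theorem clip_mono {x y : ℝ} (h : x ≤ y) : clip x ≤ clip y :=
  min_le_min_right _ (max_le_max_right _ h)

theorem clip_of_nonpos {x : ℝ} (h : x ≤ 0) : clip x = 0 := by
  rw [clip, max_eq_right h, min_eq_left zero_le_one]

theorem clip_of_one_le {x : ℝ} (h : 1 ≤ x) : clip x = 1 := by
  rw [clip, max_eq_left (by linarith), min_eq_right h]

theorem le_of_clip_pos {x : ℝ} (h : 0 < clip x) : clip x ≤ x := by
  rcases le_or_gt x 0 with hx | hx
  · rw [clip_of_nonpos hx] at h; exact absurd h (lt_irrefl _)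
  · rw [clip, max_eq_left hx.le]; exact min_le_left _ _

theorem le_of_clip_lt_one {x : ℝ} (h : clip x < 1) : x ≤ clip x := by
  rcases le_or_gt 1 x with hx | hx
  · rw [clip_of_one_le hx] at h; exact absurd h (lt_irrefl _)
  · rw [clip, min_eq_left (max_le hx.le zero_le_one)]; exact le_max_left _ _

theorem clip_sub_clip_le {x y d : ℝ} (hd : 0 ≤ d) (h : y - x ≤ d) : clip y - clip x ≤ d := by
  unfold clip
  rcases max_cases y 0 with ⟨h1, h2⟩ | ⟨h1, h2⟩ <;> rcases max_cases x 0 with ⟨h3, h4⟩ | ⟨h3, h4⟩ <;>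
    rw [h1, h3] <;>
    rcases min_cases y 1 with ⟨h5, h6⟩ | ⟨h5, h6⟩ <;> rcases min_cases x 1 with ⟨h7, h8⟩ | ⟨h7, h8⟩ <;>
    rcases min_cases (0 : ℝ) 1 with ⟨h9, h10⟩ | ⟨h9, h10⟩ <;> simp only [h5, h7, h9] <;> linarith

theorem sq_clip_sub_le {x u : ℝ} (hu : u ∈ Set.Icc (0 : ℝ) 1) : (clip x - u) ^ 2 ≤ (x - u) ^ 2 := by
  rcases le_or_gt x 0 with hx | hx
  · rw [clip_of_nonpos hx]; nlinarith [hu.1]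
  · rcases le_or_gt 1 x with h1 | h1
    · rw [clip_of_one_le h1]; nlinarith [hu.2]
    · rw [clip_of_mem ⟨hx.le, h1.le⟩]

/-- `P` consists of the intervals between consecutive points of the increasing sequence
`z 0, …, z n`, which runs from `0` to `e`. -/
structure Chain (P : Finset (ℝ × ℝ)) (z : ℕ → ℝ) (n : ℕ) (e : ℝ) : Prop where
  lt : ∀ i < n, z i < z (i + 1)
  eq : P = (Finset.range n).image fun i => (z i, z (i + 1))
  zero : z 0 = 0
  last : z n = e

namespace Chain
variable {P : Finset (ℝ × ℝ)} {z : ℕ → ℝ} {n : ℕ} {e : ℝ}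

theorem mono (h : Chain P z n e) {i j : ℕ} (hij : i ≤ j) (hj : j ≤ n) : z i ≤ z j := by
  induction j, hij using Nat.le_induction with
  | base => exact le_rfl
  | succ j hij ih => exact (ih (by omega)).trans (h.lt j (by omega)).le

theorem strictMono (h : Chain P z n e) {i j : ℕ} (hij : i < j) (hj : j ≤ n) : z i < z j :=
  (h.lt i (by omega)).trans_le (h.mono hij hj)

theorem inj (h : Chain P z n e) {i j : ℕ} (hi : i ≤ n) (hj : j ≤ n) (hz : z i = z j) : i = j := by
  rcases lt_trichotomy i j with hlt | rfl | hlt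
  · exact absurd hz (h.strictMono hlt hj).ne
  · rfl
  · exact absurd hz.symm (h.strictMono hlt hi).ne

theorem endpoints_eq (h : Chain P z n e) (hn : 0 < n) :
    endpoints P = (Finset.range (n + 1)).image z := by
  ext w
  simp only [endpoints, h.eq, Finset.mem_union, Finset.mem_image, Finset.mem_range]
  constructor
  · rintro (⟨_, ⟨i, hi, rfl⟩, rfl⟩ | ⟨_, ⟨i, hi, rfl⟩, rfl⟩)
    · exact ⟨i, by omega, rfl⟩
    · exact ⟨i + 1, by omega, rfl⟩
  · rintro ⟨i, hi, rfl⟩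
    rcases Nat.lt_or_ge i n with hin | hin
    · exact Or.inl ⟨_, ⟨i, hin, rfl⟩, rfl⟩
    · exact Or.inr ⟨_, ⟨n - 1, by omega, rfl⟩, by simp only; congr 1; omega⟩

theorem injOn (h : Chain P z n e) : Set.InjOn z (Finset.range (n + 1)) := fun i hi j hj hij => by
  simp only [Finset.coe_range, Set.mem_Iio] at hi hj
  exact h.inj (by omega) (by omega) hij

theorem sum_endpoints (h : Chain P z n e) (hn : 0 < n) (f : ℝ → ℝ) :
    ∑ w ∈ endpoints P, f w = ∑ i ∈ Finset.range (n + 1), f (z i) := by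
  rw [h.endpoints_eq hn, Finset.sum_image h.injOn]

theorem card_endpoints_le (h : Chain P z n e) (hn : 0 < n) : (endpoints P).card ≤ n + 1 := by
  rw [h.endpoints_eq hn]
  simpa using Finset.card_image_le (s := Finset.range (n + 1)) (f := z)

theorem endpoints_mem_Icc (h : Chain P z n 1) (hn : 0 < n) {w : ℝ} (hw : w ∈ endpoints P) :
    w ∈ Set.Icc (0 : ℝ) 1 := by
  rw [h.endpoints_eq hn, Finset.mem_image] at hw
  obtain ⟨i, hi, rfl⟩ := hw
  rw [Finset.mem_range] at hi
  exact ⟨h.zero ▸ h.mono (Nat.zero_le i) (by omega), h.last ▸ h.mono (Nat.lt_succ_iff.1 hi) le_rfl⟩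

theorem exists_owner (h : Chain P z n 1) {a : ℝ} (ha : a ∈ Set.Icc (0 : ℝ) 1) :
    ∃ i < n, Owns (z i, z (i + 1)) a := by
  by_contra! hno
  -- Without an owner every breakpoint stays below `a`. The last interval also owns the point `1`,
  -- so failing there even gives `z n < a`, against `a ≤ 1`; the alternative `i = 0` would mean `n =
  -- 0`, hence `0 = 1`.
  have : ∀ i ≤ n, z i ≤ a ∧ (i = n → z n < a ∨ i = 0) := by
    intro i
    induction i with
    | zero => exact fun _ => ⟨h.zero ▸ ha.1, fun _ => Or.inr rfl⟩
    | succ i ih =>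
      intro hi
      obtain ⟨h1, -⟩ := ih (by omega)
      have h2 := hno i hi
      simp only [Owns, not_and, not_or, not_lt] at h2
      obtain ⟨h3, h4⟩ := h2 h1
      refine ⟨h3, fun hin => Or.inl ?_⟩
      subst hin
      rw [h.last] at h3 h4 ⊢
      exact lt_of_le_of_ne h3 fun h5 => h4 h5.symm rfl
  obtain ⟨h1, h2⟩ := this n le_rfl
  rcases h2 rfl with h3 | h3
  · rw [h.last] at h3; exact absurd ha.2 (not_le.2 h3)
  · subst h3
    have := h.zero.symm.trans h.last; norm_num at this

theorem owner_unique (h : Chain P z n 1) {a : ℝ} {i j : ℕ} (hi : i < n) (hj : j < n)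
    (hoi : Owns (z i, z (i + 1)) a) (hoj : Owns (z j, z (j + 1)) a) : i = j := by
  have key : ∀ {i j : ℕ}, j < n → Owns (z i, z (i + 1)) a → Owns (z j, z (j + 1)) a → ¬ i < j := by
    intro i j hj hoi hoj hij
    have h1 := h.mono (show i + 1 ≤ j from hij) hj.le
    rcases hoi.2 with h2 | ⟨-, h2⟩
    · exact absurd (h1.trans hoj.1) (not_le.2 h2)
    · have h3 := (h.lt j hj).trans_le (h.mono (show j + 1 ≤ n from hj) le_rfl)
      rw [h.last] at h3
      simp only at h2
      linarith
  exact le_antisymm (not_lt.1 (key hi hoj hoi)) (not_lt.1 (key hj hoi hoj))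

theorem rounding_eq (h : Chain P z n 1) {a : ℝ} {i : ℕ} (hi : i < n)
    (ho : Owns (z i, z (i + 1)) a) (w : ℝ) :
    rounding P a w = if w = z i then (z (i + 1) - a) / (z (i + 1) - z i)
      else if w = z (i + 1) then (a - z i) / (z (i + 1) - z i) else 0 := by
  have hinj : Set.InjOn (fun i => (z i, z (i + 1))) (Finset.range n) := by
    intro i hi j hj hij
    simp only [Finset.coe_range, Set.mem_Iio] at hi hj
    exact h.inj hi.le hj.le (Prod.ext_iff.1 hij).1
  unfold rounding
  conv_lhs => rw [h.eq]
  rw [Finset.sum_image hinj, Finset.sum_eq_single_of_mem i (Finset.mem_range.2 hi), if_pos ho]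
  intro j hj hji
  rw [if_neg fun hoj => hji (h.owner_unique (Finset.mem_range.1 hj) hi hoj ho)]

theorem sum_rounding (h : Chain P z n 1) {a : ℝ} (ha : a ∈ Set.Icc (0 : ℝ) 1) :
    ∃ J ∈ P, J.1 ≤ a ∧ a ≤ J.2 ∧ J.1 < J.2 ∧ ∀ f : ℝ → ℝ, ∑ w ∈ endpoints P, rounding P a w * f w =
      (J.2 - a) / (J.2 - J.1) * f J.1 + (a - J.1) / (J.2 - J.1) * f J.2 := by
  obtain ⟨i, hi, ho⟩ := h.exists_owner ha
  have hlt := h.lt i hi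
  have hJ : (z i, z (i + 1)) ∈ P := by
    rw [h.eq]; exact Finset.mem_image_of_mem (fun i => (z i, z (i + 1))) (Finset.mem_range.2 hi)
  refine ⟨_, hJ, ho.1, ho.2.elim le_of_lt fun h1 => (h1.1.trans h1.2.symm).le, hlt, fun f => ?_⟩
  have h1 : ∀ w, rounding P a w * f w =
      (if w = z i then (z (i + 1) - a) / (z (i + 1) - z i) * f (z i) else 0) +
      (if w = z (i + 1) then (a - z i) / (z (i + 1) - z i) * f (z (i + 1)) else 0) := by
    intro w
    rw [h.rounding_eq hi ho]
    by_cases hw : w = z i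
    · rw [if_pos hw, if_pos hw, if_neg (by rw [hw]; exact hlt.ne), hw, add_zero]
    · rw [if_neg hw, if_neg hw]
      by_cases hw' : w = z (i + 1) <;> simp [hw']
  simp only [h1, Finset.sum_add_distrib]
  rw [Finset.sum_ite_eq' , Finset.sum_ite_eq', if_pos, if_pos]
  · exact Finset.mem_union_right _ (Finset.mem_image_of_mem _ hJ)
  · exact Finset.mem_union_left _ (Finset.mem_image_of_mem _ hJ)

/-- Only agreement with the old sequence up to `n` and the values after it are required of `z'`. In
this form the lemma serves both the abstract construction and the array that the program extends in
place. -/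
theorem append {l u : ℝ} {N : ℕ} {z' : ℕ → ℝ} (h : Chain P z n l) (hlu : l < u) (hN : 0 < N)
    (h1 : ∀ i ≤ n, z' i = z i) (h2 : ∀ k < N, z' (n + (k + 1)) = l + ((k : ℝ) + 1) / N * (u - l)) :
    Chain (P ∪ unifPart l u N) z' (n + N) u := by
  have hN' : (0 : ℝ) < N := by exact_mod_cast hN
  have h3 : ∀ k ≤ N, z' (n + k) = l + (k : ℝ) / N * (u - l) := by
    intro k hk
    rcases k with _ | k
    · simp [h1, h.last]
    · rw [h2 k hk]; push_cast; rfl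
  refine ⟨fun i hi => ?_, ?_, by rw [h1 0 (Nat.zero_le n), h.zero], ?_⟩
  · rcases Nat.lt_or_ge i n with hin | hin
    · rw [h1 i hin.le, h1 (i + 1) hin]; exact h.lt i hin
    · obtain ⟨k, rfl⟩ := Nat.exists_eq_add_of_le hin
      rw [h3 k (by omega), add_assoc, h3 (k + 1) (by omega)]
      push_cast
      have : (k : ℝ) / N < ((k : ℝ) + 1) / N := by gcongr; linarith
      nlinarith
  · rw [unifPart, if_pos hlu, h.eq]
    ext J
    simp only [Finset.mem_union, Finset.mem_image, Finset.mem_range]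
    constructor
    · rintro (⟨i, hi, rfl⟩ | ⟨k, hk, rfl⟩)
      · exact ⟨i, by omega, by rw [h1 i hi.le, h1 (i + 1) hi]⟩
      · exact ⟨n + k, by omega, by rw [h3 k hk.le, add_assoc, h3 (k + 1) hk]; push_cast; rfl⟩
    · rintro ⟨i, hi, rfl⟩
      rcases Nat.lt_or_ge i n with hin | hin
      · exact Or.inl ⟨i, hin, by rw [h1 i hin.le, h1 (i + 1) hin]⟩
      · obtain ⟨k, rfl⟩ := Nat.exists_eq_add_of_le hin
        exact Or.inr ⟨k, by omega, by
          rw [h3 k (by omega), add_assoc, h3 (k + 1) (by omega)]; push_cast; rfl⟩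
  · rw [h3 N le_rfl, div_self hN'.ne']; ring

theorem append_empty {u : ℝ} (N : ℕ) (h : Chain P z n e) (hlu : e = u) :
    Chain (P ∪ unifPart e u N) z n u := by
  rw [unifPart, if_neg (by rw [hlu]; exact lt_irrefl _), Finset.union_empty]
  exact hlu ▸ h

theorem exists_append {u : ℝ} {N : ℕ} (h : Chain P z n e) (hlu : e ≤ u) (hN : 0 < N) :
    ∃ z' n', n' ≤ n + N ∧ Chain (P ∪ unifPart e u N) z' n' u := by
  rcases hlu.eq_or_lt with heq | hlt
  · exact ⟨z, n, by omega, h.append_empty N heq⟩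
  · refine ⟨fun i => if i ≤ n then z i else e + ((i - n : ℕ) : ℝ) / N * (u - e), n + N, le_rfl,
      h.append hlt hN (fun i hi => if_pos hi) fun k _ => ?_⟩
    rw [if_neg (by omega), show n + (k + 1) - n = k + 1 by omega]
    push_cast; rfl

theorem nil : Chain ∅ (fun _ => 0) 0 0 := ⟨fun i hi => absurd hi (Nat.not_lt_zero i), rfl, rfl, rfl⟩

end Chain

/-! ### The partition of an epoch as a chain from 0 to 1, and its rounding variance -/

section
variable {T : ℕ} {C ι : ℝ} {m : ℕ} {y : ℝ}

theorem radius_pos (hι : 0 < ι) (hC : 0 ≤ C) : 0 < radius C ι m := by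
  have : 0 < Real.sqrt (ι / 2 ^ (m - 1)) := Real.sqrt_pos.2 (by positivity)
  unfold radius; positivity

theorem innerL_lt_innerR (hι : 0 < ι) (hC : 0 ≤ C) (hy : y ∈ Set.Icc (0 : ℝ) 1) :
    innerL C ι m y < innerR C ι m y := by
  have hr := radius_pos (m := m) hι hC
  unfold innerL innerR
  have h1 : clip (y - 2 * radius C ι m) ≤ y := by
    conv_rhs => rw [← clip_of_mem hy]
    exact clip_mono (by linarith)
  have h2 : y ≤ clip (y + 2 * radius C ι m) := by
    conv_lhs => rw [← clip_of_mem hy]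
    exact clip_mono (by linarith)
  refine lt_of_le_of_ne (h1.trans h2) fun h3 => ?_
  have h4 : clip (y - 2 * radius C ι m) = y := le_antisymm h1 (h3 ▸ h2)
  have h5 : clip (y + 2 * radius C ι m) = y := h3 ▸ h4
  rcases hy.1.eq_or_lt with h0 | h0
  · have := le_of_clip_lt_one (x := y + 2 * radius C ι m) (by rw [h5, ← h0]; norm_num)
    linarith
  · have := le_of_clip_pos (x := y - 2 * radius C ι m) (by rw [h4]; exact h0)
    linarith

theorem innerCount_pos (hι : 0 < ι) (hC : 0 ≤ C) (hy : y ∈ Set.Icc (0 : ℝ) 1) :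
    0 < innerCount C ι m y := by
  have := sub_pos.2 (innerL_lt_innerR (m := m) hι hC hy)
  exact Nat.ceil_pos.2 (by positivity)

theorem outerCount_pos (hι : 0 < ι) (hC : 0 ≤ C) : 0 < outerCount C ι :=
  Nat.ceil_pos.2 (by positivity)

theorem le_two_pow_bandMax (hT : 1 ≤ T) : (T : ℝ) ≤ 2 ^ bandMax T := by
  have hT' : (0 : ℝ) < T := by exact_mod_cast hT
  have := Nat.le_ceil (Real.logb 2 T)
  rw [Real.logb_le_iff_le_rpow one_lt_two hT', Real.rpow_natCast] at this
  exact this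

/-- The radius is at least `1/T`, because `ι ≥ 1` and `2^(m-1) ≤ T`, while `2^(bandMax T + 1) - 1 ≥
T`. Hence the outermost bands reach the ends of `[0,1]` and nothing is left uncovered. -/
theorem one_le_band_mul_radius (hT : 1 ≤ T) (hι : 1 ≤ ι) (hC : 0 ≤ C) (hm : 1 ≤ m)
    (hmT : 2 ^ m ≤ T + 1) : 1 ≤ (2 ^ (bandMax T + 1) - 1) * radius C ι m := by
  have hT' : (1 : ℝ) ≤ T := by exact_mod_cast hT
  have h1 := le_two_pow_bandMax hT
  have hs : (2 : ℝ) ^ (m - 1) ≤ T := by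
    have h3 : 2 ^ m = 2 ^ (m - 1) * 2 := by rw [← pow_succ]; congr 1; omega
    have h4 : 2 ^ (m - 1) ≤ T := by omega
    exact_mod_cast h4
  have h2 : 1 / (T : ℝ) ≤ radius C ι m := by
    have : 1 / (T : ℝ) ≤ Real.sqrt (ι / 2 ^ (m - 1)) := by
      refine Real.le_sqrt_of_sq_le ?_
      rw [div_pow, one_pow, div_le_div_iff₀ (by positivity) (by positivity)]
      nlinarith [mul_le_mul hι hs (by positivity) (by linarith)]
    have h5 : 0 ≤ C / 2 ^ (m - 1) := by positivity
    unfold radius; linarith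
  have h3 : (T : ℝ) ≤ 2 ^ (bandMax T + 1) - 1 := by rw [pow_succ]; linarith
  calc (1 : ℝ) = T * (1 / T) := by field_simp
    _ ≤ _ := mul_le_mul h3 h2 (by positivity) (by linarith)

/-- The bands on the left of the inner region with the `k` largest indices. -/
noncomputable def leftPart (T : ℕ) (C ι : ℝ) (m : ℕ) (y : ℝ) (k : ℕ) : Finset (ℝ × ℝ) :=
  (Finset.range k).biUnion fun i =>
    leftBand (innerL C ι m y) (radius C ι m) (outerCount C ι) (bandMax T - i)

/-- The bands on the left, the inner region, and the first `k` bands on the right. -/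
noncomputable def midPart (T : ℕ) (C ι : ℝ) (m : ℕ) (y : ℝ) (k : ℕ) : Finset (ℝ × ℝ) :=
  (leftPart T C ι m y (bandMax T + 1) ∪
    unifPart (innerL C ι m y) (innerR C ι m y) (innerCount C ι m y)) ∪
    (Finset.range k).biUnion fun i => rightBand (innerR C ι m y) (radius C ι m) (outerCount C ι) i

/-- End point shared by the left bands with indices `bandMax T - k` and `bandMax T - k + 1`. -/
noncomputable def leftBreak (T : ℕ) (C ι : ℝ) (m : ℕ) (y : ℝ) (k : ℕ) : ℝ :=
  clip (innerL C ι m y - (2 ^ (bandMax T + 1 - k) - 1) * radius C ι m)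

/-- End point shared by the right bands with indices `k - 1` and `k`. -/
noncomputable def rightBreak (C ι : ℝ) (m : ℕ) (y : ℝ) (k : ℕ) : ℝ :=
  clip (innerR C ι m y + (2 ^ k - 1) * radius C ι m)

theorem leftPart_succ {k : ℕ} (hk : k ≤ bandMax T) :
    leftPart T C ι m y (k + 1) = leftPart T C ι m y k ∪
      unifPart (leftBreak T C ι m y k) (leftBreak T C ι m y (k + 1)) (outerCount C ι) := by
  rw [leftPart, Finset.range_add_one, Finset.biUnion_insert, Finset.union_comm, leftPart, leftBand,
    leftBreak, leftBreak, show bandMax T + 1 - (k + 1) = bandMax T - k by omega,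
    show bandMax T + 1 - k = bandMax T - k + 1 by omega]

theorem midPart_succ (k : ℕ) :
    midPart T C ι m y (k + 1) = midPart T C ι m y k ∪
      unifPart (rightBreak C ι m y k) (rightBreak C ι m y (k + 1)) (outerCount C ι) := by
  rw [midPart, Finset.range_add_one, Finset.biUnion_insert, midPart, Finset.union_assoc _ _ (unifPart _ _ (outerCount C ι))]
  congr 1
  rw [Finset.union_comm]; rfl

theorem midPart_bandMax : midPart T C ι m y (bandMax T + 1) = partition T C ι m y := by
  ext J
  simp only [midPart, leftPart, partition, Finset.mem_union, Finset.mem_biUnion, Finset.mem_range]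
  constructor
  · rintro ((⟨i, hi, h⟩ | h) | ⟨i, hi, h⟩)
    · exact Or.inr ⟨_, by omega, Or.inl h⟩
    · exact Or.inl h
    · exact Or.inr ⟨i, hi, Or.inr h⟩
  · rintro (h | ⟨j, hj, h | h⟩)
    · exact Or.inl (Or.inr h)
    · exact Or.inl (Or.inl ⟨bandMax T - j, by omega, by
        rwa [show bandMax T - (bandMax T - j) = j by omega]⟩)
    · exact Or.inr ⟨j, hj, h⟩

theorem leftBreak_zero (hT : 1 ≤ T) (hι : 1 ≤ ι) (hC : 0 ≤ C) (hm : 1 ≤ m)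
    (hmT : 2 ^ m ≤ T + 1) : leftBreak T C ι m y 0 = 0 :=
  clip_of_nonpos (by
    have := one_le_band_mul_radius hT hι hC hm hmT
    have := (clip_mem (y - 2 * radius C ι m)).2
    rw [Nat.sub_zero]; unfold innerL; linarith)

theorem leftBreak_last : leftBreak T C ι m y (bandMax T + 1) = innerL C ι m y := by
  simp only [leftBreak, Nat.sub_self, pow_zero, sub_self, zero_mul, sub_zero]
  exact clip_of_mem (clip_mem _)

theorem rightBreak_zero : rightBreak C ι m y 0 = innerR C ι m y := by
  simp only [rightBreak, pow_zero, sub_self, zero_mul, add_zero]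
  exact clip_of_mem (clip_mem _)

theorem rightBreak_last (hT : 1 ≤ T) (hι : 1 ≤ ι) (hC : 0 ≤ C) (hm : 1 ≤ m)
    (hmT : 2 ^ m ≤ T + 1) : rightBreak C ι m y (bandMax T + 1) = 1 :=
  clip_of_one_le (by
    have := one_le_band_mul_radius hT hι hC hm hmT
    have := (clip_mem (y + 2 * radius C ι m)).1
    unfold innerR; linarith)

theorem leftBreak_le (hι : 0 < ι) (hC : 0 ≤ C) (k : ℕ) :
    leftBreak T C ι m y k ≤ leftBreak T C ι m y (k + 1) := by
  have hr := radius_pos (m := m) hι hC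
  have : (2 : ℝ) ^ (bandMax T + 1 - (k + 1)) ≤ 2 ^ (bandMax T + 1 - k) :=
    pow_le_pow_right₀ one_le_two (by omega)
  exact clip_mono (by nlinarith)

theorem rightBreak_le (hι : 0 < ι) (hC : 0 ≤ C) (k : ℕ) :
    rightBreak C ι m y k ≤ rightBreak C ι m y (k + 1) := by
  have hr := radius_pos (m := m) hι hC
  have : (2 : ℝ) ^ k ≤ 2 ^ (k + 1) := pow_le_pow_right₀ one_le_two (by omega)
  exact clip_mono (by nlinarith)

/-- The pieces are glued from left to right: left bands with decreasing index, the inner region,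
right bands with increasing index. Bands that clipping shrinks to a point contribute no interval,
which is why `n` is only bounded above. -/
theorem exists_chain (hT : 1 ≤ T) (hι : 1 ≤ ι) (hC : 0 ≤ C) (hm : 1 ≤ m)
    (hmT : 2 ^ m ≤ T + 1) (hy : y ∈ Set.Icc (0 : ℝ) 1) :
    ∃ z n, 0 < n ∧ n ≤ innerCount C ι m y + 2 * ((bandMax T + 1) * outerCount C ι) ∧
      Chain (partition T C ι m y) z n 1 := by
  have hι0 : 0 < ι := by linarith
  have hK := outerCount_pos hι0 hC
  have hleft : ∀ k ≤ bandMax T + 1, ∃ z n, n ≤ k * outerCount C ι ∧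
      Chain (leftPart T C ι m y k) z n (leftBreak T C ι m y k) := by
    intro k
    induction k with
    | zero => exact fun _ => ⟨_, 0, by omega, leftBreak_zero hT hι hC hm hmT ▸ Chain.nil⟩
    | succ k ih =>
      intro hk
      obtain ⟨z, n, hn, hz⟩ := ih (by omega)
      obtain ⟨z', n', hn', hz'⟩ := hz.exists_append (leftBreak_le hι0 hC k) hK
      exact ⟨z', n', by have := Nat.add_one_mul k (outerCount C ι); omega, by rw [leftPart_succ (by omega)]; exact hz'⟩
  have hmid : ∀ k, ∃ z n, n ≤ (bandMax T + 1) * outerCount C ι + innerCount C ι m y + k * outerCount C ι ∧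
      Chain (midPart T C ι m y k) z n (rightBreak C ι m y k) := by
    intro k
    induction k with
    | zero =>
      obtain ⟨z, n, hn, hz⟩ := hleft _ le_rfl
      rw [leftBreak_last] at hz
      obtain ⟨z', n', hn', hz'⟩ := hz.exists_append (innerL_lt_innerR hι0 hC hy).le
        (innerCount_pos (m := m) hι0 hC hy)
      refine ⟨z', n', by omega, ?_⟩
      rw [rightBreak_zero, midPart, Finset.range_zero, Finset.biUnion_empty, Finset.union_empty]
      exact hz'
    | succ k ih =>
      obtain ⟨z, n, hn, hz⟩ := ih
      obtain ⟨z', n', hn', hz'⟩ := hz.exists_append (rightBreak_le hι0 hC k) hK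
      exact ⟨z', n', by have := Nat.add_one_mul k (outerCount C ι); omega, by rw [midPart_succ]; exact hz'⟩
  obtain ⟨z, n, hn, hz⟩ := hmid (bandMax T + 1)
  rw [rightBreak_last hT hι hC hm hmT, midPart_bandMax] at hz
  refine ⟨z, n, Nat.pos_of_ne_zero fun h0 => ?_, by omega, hz⟩
  subst h0
  exact zero_ne_one (hz.zero.symm.trans hz.last)

theorem unifPart_length {l u : ℝ} {N : ℕ} {J : ℝ × ℝ} (hJ : J ∈ unifPart l u N) :
    l < u ∧ l ≤ J.1 ∧ J.2 ≤ u ∧ J.2 - J.1 = (u - l) / N := by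
  unfold unifPart at hJ
  split_ifs at hJ with hlu
  · simp only [Finset.mem_image, Finset.mem_range] at hJ
    obtain ⟨k, hk, rfl⟩ := hJ
    have hN : (0 : ℝ) < N := by exact_mod_cast (Nat.zero_le k).trans_lt hk
    have h2 : ((k : ℝ) + 1) / N ≤ 1 := (div_le_one hN).2 (by exact_mod_cast hk)
    refine ⟨hlu, ?_, ?_, by field_simp; ring⟩
    · have : 0 ≤ (k : ℝ) / N * (u - l) := mul_nonneg (by positivity) (by linarith)
      simp only; linarith
    · have := mul_le_mul_of_nonneg_right h2 (sub_pos.2 hlu).le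
      simp only; linarith
  · simp at hJ

/-- The left side is at most a quarter of the squared length of `J`. An interval of band `j` has
length at most `2^j r / K`. The band starts `(2^j - 1) r` beyond an inner region reaching `2r` from
`y`, and `p` is within `r` of `y`, so `|a - p| ≥ 2^j r`: the variance is charged to `(a - p)²`. -/
theorem rounding_variance_le (hι : 0 < ι) (hC : 0 ≤ C) {J : ℝ × ℝ}
    (hJ : J ∈ partition T C ι m y) {a p : ℝ} (h1 : J.1 ≤ a) (h2 : a ≤ J.2)
    (hp : |y - p| ≤ radius C ι m) :
    (J.2 - a) * (a - J.1) ≤ ((innerR C ι m y - innerL C ι m y) / innerCount C ι m y) ^ 2 / 4 +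
      (a - p) ^ 2 / (4 * outerCount C ι ^ 2) := by
  have hr := radius_pos (m := m) hι hC
  have hK : (0 : ℝ) < outerCount C ι := by exact_mod_cast outerCount_pos hι hC
  obtain ⟨hp1, hp2⟩ := abs_le.1 hp
  have hq : (J.2 - a) * (a - J.1) ≤ (J.2 - J.1) ^ 2 / 4 := by nlinarith [sq_nonneg (J.2 - a - (a - J.1))]
  refine hq.trans ?_
  have outer : ∀ j : ℕ, J.2 - J.1 ≤ 2 ^ j * radius C ι m / outerCount C ι →
      2 ^ j * radius C ι m ≤ |a - p| → (J.2 - J.1) ^ 2 / 4 ≤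
      ((innerR C ι m y - innerL C ι m y) / innerCount C ι m y) ^ 2 / 4 +
      (a - p) ^ 2 / (4 * outerCount C ι ^ 2) := by
    intro j h3 h4
    have h5 : (J.2 - J.1) ^ 2 ≤ (|a - p| / outerCount C ι) ^ 2 :=
      pow_le_pow_left₀ (by linarith) (h3.trans (by gcongr)) 2
    rw [div_pow, sq_abs] at h5
    have h6 : (a - p) ^ 2 / (4 * outerCount C ι ^ 2) = (a - p) ^ 2 / outerCount C ι ^ 2 / 4 := by
      field_simp
    rw [h6]
    have : 0 ≤ ((innerR C ι m y - innerL C ι m y) / innerCount C ι m y) ^ 2 := sq_nonneg _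
    linarith
  have hwidth : ∀ j : ℕ, ((2 : ℝ) ^ (j + 1) - 1) * radius C ι m - (2 ^ j - 1) * radius C ι m =
      2 ^ j * radius C ι m := fun j => by rw [pow_succ]; ring
  simp only [partition, Finset.mem_union, Finset.mem_biUnion] at hJ
  rcases hJ with hJ | ⟨j, -, hJ | hJ⟩
  · rw [(unifPart_length hJ).2.2.2]
    have : 0 ≤ (a - p) ^ 2 / (4 * (outerCount C ι : ℝ) ^ 2) := by positivity
    linarith
  · obtain ⟨h3, h4, h5, h6⟩ := unifPart_length hJ
    have hb := hwidth j
    have hj : (1 : ℝ) ≤ 2 ^ j := one_le_pow₀ one_le_two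
    refine outer j ?_ ?_
    · rw [h6]
      gcongr
      refine clip_sub_clip_le (by positivity) ?_
      linarith
    -- Clipping to a positive value never raises a number, so a nonempty left band gives honest
    -- inequalities for the unclipped end points, first for the band and then for `innerL`. On the
    -- right, values below `1` play this role.
    · have h7 : 0 < clip (innerL C ι m y - (2 ^ j - 1) * radius C ι m) :=
        (clip_mem _).1.trans_lt h3
      have h8 := le_of_clip_pos h7
      have h9 : 0 < innerL C ι m y := by nlinarith
      have h10 : innerL C ι m y ≤ y - 2 * radius C ι m := le_of_clip_pos h9
      rw [le_abs]; right
      linarith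
  · obtain ⟨h3, h4, h5, h6⟩ := unifPart_length hJ
    have hb := hwidth j
    have hj : (1 : ℝ) ≤ 2 ^ j := one_le_pow₀ one_le_two
    refine outer j ?_ ?_
    · rw [h6]
      gcongr
      refine clip_sub_clip_le (by positivity) ?_
      linarith
    · have h7 : clip (innerR C ι m y + (2 ^ j - 1) * radius C ι m) < 1 :=
        h3.trans_le (clip_mem _).2
      have h8 := le_of_clip_lt_one h7
      have h9 : innerR C ι m y < 1 := by nlinarith
      have h10 : y + 2 * radius C ι m ≤ innerR C ι m y := le_of_clip_lt_one h9
      rw [le_abs]; left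
      linarith

/-! ### Sizes -/

theorem innerR_sub_innerL_le (hι : 0 < ι) (hC : 0 ≤ C) :
    innerR C ι m y - innerL C ι m y ≤ 4 * radius C ι m := by
  have hr := radius_pos (m := m) hι hC
  exact clip_sub_clip_le (by positivity) (by linarith)

/-- Put `s = 2^(m-1)`. If `C ≤ s`, the length is at most `4r` and `s r² ≤ 2ι + 2C²/s ≤ 2ι + 2C`. If
`C > s`, the trivial bound `1` on the length suffices. -/
theorem inner_ratio_le (hι : 1 ≤ ι) (hC : 0 ≤ C) (hm : 1 ≤ m) (hy : y ∈ Set.Icc (0 : ℝ) 1) :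
    2 ^ m * (innerR C ι m y - innerL C ι m y) ^ 2 / ι ≤ 64 * (1 + C) := by
  have hι0 : 0 < ι := by linarith
  have h0 := innerL_lt_innerR (m := m) hι0 hC hy
  have h1 := innerR_sub_innerL_le (m := m) (y := y) hι0 hC
  have h2 : innerR C ι m y - innerL C ι m y ≤ 1 := by
    have := (clip_mem (y + 2 * radius C ι m)).2
    have := (clip_mem (y - 2 * radius C ι m)).1
    unfold innerR innerL; linarith
  set d := innerR C ι m y - innerL C ι m y
  have hd : 0 < d := sub_pos.2 h0
  have hs : (2 : ℝ) ^ m = 2 * 2 ^ (m - 1) := by rw [← pow_succ']; congr 1; omega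
  rw [hs]
  set s : ℝ := 2 ^ (m - 1) with hsdef
  have hs0 : 0 < s := by positivity
  rw [div_le_iff₀ hι0]
  rcases le_or_gt C s with hCs | hCs
  · have h3 : d ^ 2 ≤ 16 * (2 * (ι / s) + 2 * (C / s) ^ 2) := by
      have h4 : d ^ 2 ≤ (4 * radius C ι m) ^ 2 := pow_le_pow_left₀ hd.le h1 2
      have h5 : Real.sqrt (ι / s) ^ 2 = ι / s := Real.sq_sqrt (by positivity)
      have h6 : radius C ι m = Real.sqrt (ι / s) + C / s := rfl
      rw [h6] at h4
      nlinarith [sq_nonneg (Real.sqrt (ι / s) - C / s)]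
    have h4 : s * d ^ 2 ≤ 16 * (2 * ι + 2 * C * (C / s)) := by
      calc s * d ^ 2 ≤ s * (16 * (2 * (ι / s) + 2 * (C / s) ^ 2)) := by gcongr
        _ = _ := by field_simp
    have h5 : C / s ≤ 1 := (div_le_one hs0).2 hCs
    nlinarith [mul_le_mul_of_nonneg_left h5 hC, mul_le_mul_of_nonneg_left hι hC]
  · have : d ^ 2 ≤ 1 := pow_le_one₀ hd.le h2
    nlinarith

theorem rpow_third_le_four (hC : 0 ≤ C) : (64 * (1 + C)) ^ (1 / 3 : ℝ) = 4 * (1 + C) ^ (1 / 3 : ℝ) := by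
  rw [Real.mul_rpow (by norm_num) (by linarith), show (64 : ℝ) = 4 ^ (3 : ℝ) by norm_num,
    ← Real.rpow_mul (by norm_num)]
  norm_num

theorem innerCount_le (hι : 1 ≤ ι) (hC : 0 ≤ C) (hm : 1 ≤ m) (hy : y ∈ Set.Icc (0 : ℝ) 1) :
    (innerCount C ι m y : ℝ) ≤ 4 * (1 + C) ^ (1 / 3 : ℝ) + 1 := by
  refine (Nat.ceil_lt_add_one (by positivity)).le.trans ?_
  rw [← rpow_third_le_four hC]
  have := inner_ratio_le hι hC hm hy
  gcongr

/-- With `X = 2^m |I|² / ι` the left side is `ι X / N²`, and `N ≥ X^{1/3}` makes it at most `ι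
X^{1/3}`. The exponent `1/3` balances the number of intervals against the rounding variance. -/
theorem inner_variance_le (hι : 1 ≤ ι) (hC : 0 ≤ C) (hm : 1 ≤ m) (hy : y ∈ Set.Icc (0 : ℝ) 1) :
    2 ^ m * ((innerR C ι m y - innerL C ι m y) / innerCount C ι m y) ^ 2 ≤
      4 * (1 + C) ^ (1 / 3 : ℝ) * ι := by
  have hι0 : 0 < ι := by linarith
  set X := 2 ^ m * (innerR C ι m y - innerL C ι m y) ^ 2 / ι with hX
  have hX0 : 0 < X := by
    have := sub_pos.2 (innerL_lt_innerR (m := m) hι0 hC hy)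
    positivity
  have hN : X ^ (1 / 3 : ℝ) ≤ innerCount C ι m y := Nat.le_ceil _
  have hXp : 0 < X ^ (1 / 3 : ℝ) := by positivity
  have hcube : (X ^ (1 / 3 : ℝ)) ^ 3 = X := by
    rw [← Real.rpow_natCast, ← Real.rpow_mul hX0.le]; norm_num
  have h1 : 2 ^ m * ((innerR C ι m y - innerL C ι m y) / innerCount C ι m y) ^ 2 =
      ι * (X / innerCount C ι m y ^ 2) := by
    rw [hX]; field_simp
  rw [h1]
  have h2 : X / (innerCount C ι m y : ℝ) ^ 2 ≤ X ^ (1 / 3 : ℝ) := by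
    calc X / (innerCount C ι m y : ℝ) ^ 2 ≤ X / (X ^ (1 / 3 : ℝ)) ^ 2 := by gcongr
      _ = X ^ (1 / 3 : ℝ) := by
        rw [div_eq_iff (by positivity)]
        nth_rewrite 1 [← hcube]; ring
  have h3 : X ^ (1 / 3 : ℝ) ≤ 4 * (1 + C) ^ (1 / 3 : ℝ) := by
    rw [← rpow_third_le_four hC]
    have := inner_ratio_le hι hC hm hy
    gcongr
  rw [mul_comm _ ι]
  gcongr
  exact h2.trans h3

theorem outerCount_le (hι : 0 < ι) (hC : 0 ≤ C) :
    (outerCount C ι : ℝ) ≤ (1 + C) ^ (1 / 3 : ℝ) / ι + 1 :=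
  (Nat.ceil_lt_add_one (by positivity)).le

end

/-! ### Regret of projected online gradient descent -/

/-- The potential is `W (a - u)²`. Projection only brings the action closer to `u`, and with step
size `1/(2(W + w))` all quadratic terms cancel except `w² (a - y)² / (W + w)`. Since `w ≤ 1` this is
at most `2w/(1 + W + w)`, which the increment of `2 log (1 + W)` dominates. -/
theorem ogd_step_le {a u y w W : ℝ} (ha : a ∈ Set.Icc (0 : ℝ) 1) (hu : u ∈ Set.Icc (0 : ℝ) 1)
    (hy : y ∈ Set.Icc (0 : ℝ) 1) (hw0 : 0 ≤ w) (hw1 : w ≤ 1) (hW : 0 ≤ W) :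
    w * ((a - y) ^ 2 - (u - y) ^ 2) +
      (W + w) * (clip (a - 1 / (2 * (W + w)) * (2 * w * (a - y))) - u) ^ 2 - W * (a - u) ^ 2 ≤
      2 * Real.log (1 + (W + w)) - 2 * Real.log (1 + W) := by
  rcases (add_nonneg hW hw0).eq_or_lt with h0 | hpos
  · have hw : w = 0 := by linarith
    have hW' : W = 0 := by linarith
    simp [hw, hW']
  have hlog : w / (1 + (W + w)) ≤ Real.log (1 + (W + w)) - Real.log (1 + W) := by
    have h1 := Real.one_sub_inv_le_log_of_pos (x := (1 + (W + w)) / (1 + W)) (by positivity)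
    rw [Real.log_div (by positivity) (by positivity), inv_div] at h1
    refine le_trans (le_of_eq ?_) h1
    field_simp
    ring
  have hsq : (W + w) * (clip (a - 1 / (2 * (W + w)) * (2 * w * (a - y))) - u) ^ 2 ≤
      (W + w) * ((a - 1 / (2 * (W + w)) * (2 * w * (a - y))) - u) ^ 2 :=
    mul_le_mul_of_nonneg_left (sq_clip_sub_le hu) hpos.le
  have hexp : (W + w) * ((a - 1 / (2 * (W + w)) * (2 * w * (a - y))) - u) ^ 2 =
      (W + w) * (a - u) ^ 2 - 2 * w * (a - y) * (a - u) + w ^ 2 / (W + w) * (a - y) ^ 2 := by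
    field_simp
    ring
  have hay : (a - y) ^ 2 ≤ 1 := by
    rw [sq_le_one_iff_abs_le_one, abs_le]
    constructor <;> linarith [ha.1, ha.2, hy.1, hy.2]
  have h2 : w ^ 2 / (W + w) * (a - y) ^ 2 ≤ 2 * (w / (1 + (W + w))) := by
    calc w ^ 2 / (W + w) * (a - y) ^ 2 ≤ w ^ 2 / (W + w) * 1 := by gcongr
      _ ≤ 2 * (w / (1 + (W + w))) := by
        rw [mul_one, ← mul_div_assoc, div_le_div_iff₀ hpos (by positivity)]
        nlinarith [mul_nonneg hw0 hW, mul_nonneg hw0 (sub_nonneg.2 hw1),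
          mul_nonneg (mul_nonneg hw0 hW) (sub_nonneg.2 hw1),
          mul_nonneg (mul_nonneg hw0 hw0) (sub_nonneg.2 hw1)]
  nlinarith

section
variable {F : Forecaster} {start : ℕ → ℝ → ℝ}

theorem ogd_cons (s : ℝ) (x : ℝ × Bool) (h : History) :
    ogd F start s (x :: h) =
      if epoch (h.length + 1) ≠ epoch h.length then (start (epoch (h.length + 1)) s, 0)
      else (clip ((ogd F start s h).1 - 1 / (2 * ((ogd F start s h).2 + (F h s).toReal)) *
        (2 * (F h s).toReal * ((ogd F start s h).1 - outcome x.2))),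
        (ogd F start s h).2 + (F h s).toReal) := rfl

theorem ogd_mem (hstart : ∀ m s, start m s ∈ Set.Icc (0 : ℝ) 1) (s : ℝ) (h : History) :
    (ogd F start s h).1 ∈ Set.Icc (0 : ℝ) 1 := by
  rcases h with _ | ⟨x, h⟩
  · exact hstart _ _
  · rw [ogd_cons]
    split_ifs
    · exact hstart _ _
    · exact clip_mem _

theorem epochSum_new {m : ℕ} {f : History → ℝ × Bool → ℝ} {x : ℝ × Bool} {h : History}
    (h1 : epoch h.length ≠ m) (h2 : epoch (h.length + 1) = m) : epochSum m f (x :: h) = 0 := by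
  refine epochSum_eq_zero fun t ht => ?_
  have h3 := epoch_mono (Nat.le_succ h.length)
  rw [List.length_cons] at ht
  have h4 : epoch t ≤ epoch h.length := epoch_mono (Nat.lt_succ_iff.1 ht)
  rw [Nat.succ_eq_add_one] at h3
  omega

theorem ogd_weight (s : ℝ) (h : History) :
    (ogd F start s h).2 = epochSum (epoch h.length) (fun h' _ => (F h' s).toReal) h := by
  induction h with
  | nil => rfl
  | cons x h ih =>
    rw [ogd_cons, List.length_cons]
    split_ifs with he
    · exact (epochSum_new (fun h1 => he h1.symm) rfl).symm
    · rw [not_not] at he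
      rw [he, epochSum_cons, if_pos rfl, ih]

/-- The regret of the instance `s` against the action `u` over epoch `m`. -/
noncomputable def regret (F : Forecaster) (start : ℕ → ℝ → ℝ) (m : ℕ) (s u : ℝ) (h : History) : ℝ :=
  epochSum m (fun h' x => (F h' s).toReal *
    (((ogd F start s h').1 - outcome x.2) ^ 2 - (u - outcome x.2) ^ 2)) h

theorem epochSum_weight_nonneg (m : ℕ) (s : ℝ) (h : History) :
    0 ≤ epochSum m (fun h' _ => (F h' s).toReal) h :=
  epochSum_nonneg fun _ _ _ _ => ENNReal.toReal_nonneg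

/-- The second claim, which keeps the potential, drives the induction while epoch `m` is running. At
the end of the epoch the action is reset and only the first claim survives. -/
theorem regret_le (hstart : ∀ m s, start m s ∈ Set.Icc (0 : ℝ) 1) (m : ℕ) (s : ℝ) {u : ℝ}
    (hu : u ∈ Set.Icc (0 : ℝ) 1) (h : History) :
    regret F start m s u h ≤ 2 * Real.log (1 + epochSum m (fun h' _ => (F h' s).toReal) h) ∧
    (epoch h.length = m → regret F start m s u h +
      epochSum m (fun h' _ => (F h' s).toReal) h * ((ogd F start s h).1 - u) ^ 2 ≤
        2 * Real.log (1 + epochSum m (fun h' _ => (F h' s).toReal) h)) := by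
  induction h with
  | nil => simp [regret]
  | cons x h ih =>
    by_cases he : epoch h.length = m
    · have h1 := ih.2 he
      have h2 := ogd_step_le (ogd_mem (F := F) hstart s h) hu (outcome_mem x.2)
        (ENNReal.toReal_nonneg (a := F h s)) (toReal_le_one _ _) (epochSum_weight_nonneg (F := F) m s h)
      have h3 : regret F start m s u (x :: h) = regret F start m s u h + (F h s).toReal *
          (((ogd F start s h).1 - outcome x.2) ^ 2 - (u - outcome x.2) ^ 2) := by
        rw [regret, epochSum_cons, if_pos he]; rfl
      rw [h3, epochSum_cons, if_pos he]
      refine ⟨?_, fun he' => ?_⟩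
      · have h4 : 0 ≤ (epochSum m (fun h' _ => (F h' s).toReal) h + (F h s).toReal) *
          (clip ((ogd F start s h).1 - 1 / (2 * (epochSum m (fun h' _ => (F h' s).toReal) h +
            (F h s).toReal)) * (2 * (F h s).toReal * ((ogd F start s h).1 - outcome x.2))) - u) ^ 2 :=
          mul_nonneg (add_nonneg (epochSum_weight_nonneg m s h) ENNReal.toReal_nonneg) (sq_nonneg _)
        linarith
      · rw [List.length_cons] at he'
        have h5 := ogd_weight (F := F) (start := start) s h
        rw [he] at h5
        rw [ogd_cons, if_neg (by rw [he', he]; exact fun hn => hn rfl), h5]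
        linarith
    · have h3 : regret F start m s u (x :: h) = regret F start m s u h := by
        rw [regret, epochSum_cons, if_neg he, add_zero]; rfl
      refine ⟨by rw [h3, epochSum_cons, if_neg he, add_zero]; exact ih.1, fun he' => ?_⟩
      rw [List.length_cons] at he'
      rw [regret, epochSum_new he he', epochSum_new he he']
      simp

theorem epochSum_weight_le {m : ℕ} (s : ℝ) (h : History) :
    epochSum m (fun h' _ => (F h' s).toReal) h ≤ h.length := by
  calc epochSum m (fun h' _ => (F h' s).toReal) h ≤ sumRounds (fun _ _ => (1 : ℝ)) h :=
        sumRounds_mono fun h' x _ => by split_ifs; exacts [toReal_le_one _ _, zero_le_one]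
    _ = h.length := by
        rw [sumRounds_length (fun _ => (1 : ℝ))]; simp

theorem regret_le_log (hstart : ∀ m s, start m s ∈ Set.Icc (0 : ℝ) 1) (m : ℕ) (s : ℝ) {u : ℝ}
    (hu : u ∈ Set.Icc (0 : ℝ) 1) (h : History) :
    regret F start m s u h ≤ 2 * Real.log (1 + h.length) := by
  refine (regret_le hstart m s hu h).1.trans ?_
  have := epochSum_weight_nonneg (F := F) m s h
  have := epochSum_weight_le (F := F) (m := m) s h
  gcongr

/-! ### Calibration error of one epoch -/

/-- The weighted bias `∑_{t ∈ m} 𝒫_t(p) (y_t - p)` of the predictions `p` in epoch `m`. -/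
noncomputable def bias (F : Forecaster) (m : ℕ) (h : History) (p : ℝ) : ℝ :=
  epochSum m (fun h' x => (F h' p).toReal * (outcome x.2 - p)) h

/-- The total weight `∑_{t ∈ m} 𝒫_t(p)` of the prediction `p` in epoch `m`. -/
noncomputable def weight (F : Forecaster) (m : ℕ) (h : History) (p : ℝ) : ℝ :=
  epochSum m (fun h' _ => (F h' p).toReal) h

/-- The weighted square loss is quadratic in the constant predicted, with minimum at the weighted
average outcome `u`, and `p` exceeds the minimum by weight times `(p - u)²`. Without weight both
sides are `0` by the convention for division. -/
theorem exists_bias_sq_div_eq (m : ℕ) (h : History) (p : ℝ) :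
    ∃ u ∈ Set.Icc (0 : ℝ) 1, bias F m h p ^ 2 / weight F m h p =
      epochSum m (fun h' x => (F h' p).toReal *
        ((p - outcome x.2) ^ 2 - (u - outcome x.2) ^ 2)) h := by
  set W := weight F m h p with hW
  set Y := epochSum m (fun h' x => (F h' p).toReal * outcome x.2) h with hY
  have hW0 : 0 ≤ W := epochSum_weight_nonneg m p h
  have hY0 : 0 ≤ Y := epochSum_nonneg fun _ x _ _ =>
    mul_nonneg ENNReal.toReal_nonneg (outcome_mem x.2).1
  have hYW : Y ≤ W := epochSum_mono fun _ x _ _ =>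
    mul_le_of_le_one_right ENNReal.toReal_nonneg (outcome_mem x.2).2
  have hb : bias F m h p = Y - p * W := by
    rw [bias, hY, hW, weight, ← epochSum_mul, ← epochSum_sub]
    exact epochSum_congr fun _ _ _ _ => by ring
  have hr : ∀ u, epochSum m (fun h' x => (F h' p).toReal *
        ((p - outcome x.2) ^ 2 - (u - outcome x.2) ^ 2)) h = (p ^ 2 - u ^ 2) * W - 2 * (p - u) * Y := by
    intro u
    rw [hY, hW, weight, ← epochSum_mul, ← epochSum_mul, ← epochSum_sub]
    exact epochSum_congr fun _ _ _ _ => by ring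
  rcases hW0.eq_or_lt with h0 | hpos
  · exact ⟨0, ⟨le_rfl, zero_le_one⟩, by
      rw [hr, ← h0, show Y = 0 by linarith]; simp⟩
  · refine ⟨Y / W, ⟨by positivity, (div_le_one hpos).2 hYW⟩, ?_⟩
    rw [hr, hb]
    field_simp
    ring

end

/-- The points on which the forecaster's distribution lives in epoch `m`. -/
noncomputable def points (T : ℕ) (C ι : ℝ) (m : ℕ) (h : History) : Finset ℝ :=
  endpoints (partition T C ι m (prevMean m h))

theorem points_of_suffix {T : ℕ} {C ι : ℝ} {m : ℕ} {h' h : History} {x : ℝ × Bool} (hm : 2 ≤ m)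
    (he : epoch h'.length = m) (hs : (x :: h') <:+ h) : points T C ι m h' = points T C ι m h := by
  rw [points, points, prevMean_of_suffix (by omega) he.ge ((List.suffix_cons x h').trans hs)]

/-- Average of `(a_s - p)²` over the instances, weighted with the forecaster's distribution. -/
noncomputable def spread (F : Forecaster) (start : ℕ → ℝ → ℝ) (T : ℕ) (C ι p : ℝ) (h : History) : ℝ :=
  ∑ s ∈ points T C ι (epoch h.length) h, (F h s).toReal * ((ogd F start s h).1 - p) ^ 2

/-- Average of `2 (a_s - p)` over the instances, weighted with the forecaster's distribution. -/
noncomputable def drift (F : Forecaster) (start : ℕ → ℝ → ℝ) (T : ℕ) (C ι p : ℝ) (h : History) : ℝ :=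
  ∑ s ∈ points T C ι (epoch h.length) h, (F h s).toReal * (2 * ((ogd F start s h).1 - p))

theorem sum_toReal_le_one (μ : PMF ℝ) (s : Finset ℝ) : ∑ p ∈ s, (μ p).toReal ≤ 1 := by
  rw [← ENNReal.toReal_sum fun p _ => μ.apply_ne_top p, ← ENNReal.toReal_one]
  refine ENNReal.toReal_mono ENNReal.one_ne_top ?_
  rw [← PMF.tsum_coe μ]
  exact ENNReal.sum_le_tsum s

/-- Cauchy–Schwarz with the square roots of the weights, whose squares sum to at most `1`. This is
what later allows the noise to be absorbed by the spread itself. -/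
theorem drift_sq_le (F : Forecaster) (start : ℕ → ℝ → ℝ) (T : ℕ) (C ι p : ℝ) (h : History) :
    drift F start T C ι p h ^ 2 ≤ 4 * spread F start T C ι p h := by
  set Z := points T C ι (epoch h.length) h with hZ
  have h1 : ∑ s ∈ Z, (F h s).toReal ≤ 1 := sum_toReal_le_one _ _
  have hV : 0 ≤ spread F start T C ι p h :=
    Finset.sum_nonneg fun s _ => mul_nonneg ENNReal.toReal_nonneg (sq_nonneg _)
  have h2 := Finset.sum_mul_sq_le_sq_mul_sq Z (fun s => Real.sqrt (F h s).toReal)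
    (fun s => Real.sqrt (F h s).toReal * (2 * ((ogd F start s h).1 - p)))
  have e1 : ∀ s, Real.sqrt (F h s).toReal * (Real.sqrt (F h s).toReal *
      (2 * ((ogd F start s h).1 - p))) = (F h s).toReal * (2 * ((ogd F start s h).1 - p)) := fun s => by
    rw [← mul_assoc, Real.mul_self_sqrt ENNReal.toReal_nonneg]
  have e2 : ∀ s, (Real.sqrt (F h s).toReal * (2 * ((ogd F start s h).1 - p))) ^ 2 =
      4 * ((F h s).toReal * ((ogd F start s h).1 - p) ^ 2) := fun s => by
    rw [mul_pow, Real.sq_sqrt ENNReal.toReal_nonneg]; ring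
  simp only [e1, e2, Real.sq_sqrt ENNReal.toReal_nonneg, ← Finset.mul_sum] at h2
  have h3 : drift F start T C ι p h ^ 2 ≤ (∑ s ∈ Z, (F h s).toReal) * (4 * spread F start T C ι p h) := h2
  nlinarith

theorem abs_drift_le {F : Forecaster} {start : ℕ → ℝ → ℝ}
    (hstart : ∀ m s, start m s ∈ Set.Icc (0 : ℝ) 1) (T : ℕ) (C ι : ℝ) {p : ℝ}
    (hp : p ∈ Set.Icc (0 : ℝ) 1) (h : History) : |drift F start T C ι p h| ≤ 2 := by
  have hV : spread F start T C ι p h ≤ 1 := by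
    refine (Finset.sum_le_sum fun s _ => ?_).trans (sum_toReal_le_one (F h) _)
    refine mul_le_of_le_one_right ENNReal.toReal_nonneg ?_
    have := ogd_mem (F := F) hstart s h
    rw [sq_le_one_iff_abs_le_one, abs_le]
    constructor <;> linarith [this.1, this.2, hp.1, hp.2]
  have := drift_sq_le F start T C ι p h
  exact abs_le_of_sq_le_sq (by linarith) (by norm_num)

section
variable {F : Forecaster} {start : ℕ → ℝ → ℝ} {T : ℕ} {C ι : ℝ}

/-- `F` satisfies the stationarity equations of the algorithm with initial actions `start`. -/
def Stationary (F : Forecaster) (start : ℕ → ℝ → ℝ) (T : ℕ) (C ι : ℝ) : Prop :=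
  ∀ h : History, h.length < T → 2 ≤ epoch h.length →
    let m := epoch h.length
    let P := partition T C ι m (prevMean m h)
    (F h).support ⊆ (endpoints P : Set ℝ) ∧
    ∀ z ∈ endpoints P, (F h z).toReal =
      ∑ s ∈ endpoints P, (F h s).toReal * rounding P (ogd F start s h).1 z

theorem two_pow_epoch_le {t T : ℕ} (ht : t < T) : 2 ^ epoch t ≤ T + 1 :=
  (Nat.pow_log_le_self 2 (by omega)).trans (by omega)

/-- By stationarity a draw from the forecaster is a draw of an instance `s` followed by rounding its
action. Rounding preserves the mean, so the square loss grows by exactly the rounding variance,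
which `rounding_variance_le` bounds. -/
theorem stationary_loss_le (hstat : Stationary F start T C ι)
    (hstart : ∀ m s, start m s ∈ Set.Icc (0 : ℝ) 1) (hι : 1 ≤ ι) (hC : 0 ≤ C) {h : History}
    (hT : h.length < T) {m : ℕ} (hm : epoch h.length = m) (h2 : 2 ≤ m) {p y : ℝ}
    (hp : |prevMean m h - p| ≤ radius C ι m) :
    ∑ s ∈ points T C ι m h, (F h s).toReal * (s - y) ^ 2 ≤
      ∑ s ∈ points T C ι m h, (F h s).toReal * ((ogd F start s h).1 - y) ^ 2 +
      (((innerR C ι m (prevMean m h) - innerL C ι m (prevMean m h)) /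
        innerCount C ι m (prevMean m h)) ^ 2 / 4 +
      spread F start T C ι p h / (4 * outerCount C ι ^ 2)) := by
  have hst := (hstat h hT (hm ▸ h2)).2
  have hmT : 2 ^ m ≤ T + 1 := hm ▸ two_pow_epoch_le hT
  obtain ⟨z, n, hn, -, hz⟩ := exists_chain (T := T) (by omega) hι hC (by omega) hmT
    (prevMean_mem (m := m) (by omega) h)
  simp only [hm] at hst
  set P := partition T C ι m (prevMean m h) with hP
  set c := ((innerR C ι m (prevMean m h) - innerL C ι m (prevMean m h)) /
        innerCount C ι m (prevMean m h)) ^ 2 / 4 with hc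
  have hc0 : 0 ≤ c := by positivity
  have hround : ∀ s, ∑ w ∈ endpoints P, rounding P (ogd F start s h).1 w * (w - y) ^ 2 ≤
      ((ogd F start s h).1 - y) ^ 2 + (c + ((ogd F start s h).1 - p) ^ 2 / (4 * outerCount C ι ^ 2)) := by
    intro s
    obtain ⟨J, hJ, h3, h4, h5, h6⟩ := hz.sum_rounding (ogd_mem (F := F) hstart s h)
    rw [h6 fun w => (w - y) ^ 2]
    have h7 := rounding_variance_le (by linarith) hC hJ h3 h4 hp
    have h8 : J.2 - J.1 ≠ 0 := (sub_pos.2 h5).ne'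
    have h9 : (J.2 - (ogd F start s h).1) / (J.2 - J.1) * (J.1 - y) ^ 2 +
        ((ogd F start s h).1 - J.1) / (J.2 - J.1) * (J.2 - y) ^ 2 =
        ((ogd F start s h).1 - y) ^ 2 + (J.2 - (ogd F start s h).1) * ((ogd F start s h).1 - J.1) := by
      field_simp
      ring
    rw [h9]
    linarith
  have e1 : ∑ w ∈ points T C ι m h, (F h w).toReal * (w - y) ^ 2 =
      ∑ s ∈ points T C ι m h, (F h s).toReal *
        ∑ w ∈ endpoints P, rounding P (ogd F start s h).1 w * (w - y) ^ 2 := by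
    calc _ = ∑ w ∈ endpoints P, ∑ s ∈ endpoints P,
          (F h s).toReal * rounding P (ogd F start s h).1 w * (w - y) ^ 2 :=
          Finset.sum_congr rfl fun w hw => by rw [hst w hw, Finset.sum_mul]
      _ = _ := by
          rw [Finset.sum_comm]
          refine Finset.sum_congr rfl fun s _ => ?_
          rw [Finset.mul_sum]
          exact Finset.sum_congr rfl fun w _ => by ring
  rw [e1]
  calc _ ≤ ∑ s ∈ points T C ι m h, (F h s).toReal * (((ogd F start s h).1 - y) ^ 2 +
          (c + ((ogd F start s h).1 - p) ^ 2 / (4 * outerCount C ι ^ 2))) :=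
        Finset.sum_le_sum fun s _ => mul_le_mul_of_nonneg_left (hround s) ENNReal.toReal_nonneg
    _ = ∑ s ∈ points T C ι m h, (F h s).toReal * ((ogd F start s h).1 - y) ^ 2 +
        ((∑ s ∈ points T C ι m h, (F h s).toReal) * c +
          (∑ s ∈ points T C ι m h, (F h s).toReal * ((ogd F start s h).1 - p) ^ 2) /
            (4 * outerCount C ι ^ 2)) := by
        rw [Finset.sum_mul, Finset.sum_div, ← Finset.sum_add_distrib, ← Finset.sum_add_distrib]
        exact Finset.sum_congr rfl fun s _ => by ring
    _ ≤ _ := by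
        have h1 := sum_toReal_le_one (F h) (points T C ι m h)
        have h3 := mul_le_mul_of_nonneg_right h1 hc0
        rw [spread, hm]
        linarith

/-- The pseudo-calibration error of epoch `m` on its points. -/
noncomputable def epochPcal (F : Forecaster) (T : ℕ) (C ι : ℝ) (m : ℕ) (h : History) : ℝ :=
  ∑ p ∈ points T C ι m h, bias F m h p ^ 2 / weight F m h p

/-- The reduction from swap to external regret: the point `s` competes with its own best constant `u
s`, and after stationarity it is the instance `s` that faces the same `u s`. -/
theorem epochPcal_le (hstat : Stationary F start T C ι)
    (hstart : ∀ m s, start m s ∈ Set.Icc (0 : ℝ) 1) (hι : 1 ≤ ι) (hC : 0 ≤ C) {h : History}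
    (hT : h.length ≤ T) {m : ℕ} (h2 : 2 ≤ m) {p : ℝ}
    (hp : |prevMean m h - p| ≤ radius C ι m) :
    epochPcal F T C ι m h ≤ (points T C ι m h).card * (2 * Real.log (1 + h.length)) +
      (1 + C) ^ (1 / 3 : ℝ) * ι +
      epochSum m (fun h' _ => spread F start T C ι p h') h / (4 * outerCount C ι ^ 2) := by
  choose u hu hb using fun s => exists_bias_sq_div_eq (F := F) m h s
  set c := ((innerR C ι m (prevMean m h) - innerL C ι m (prevMean m h)) /
        innerCount C ι m (prevMean m h)) ^ 2 / 4 with hc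
  have hy := prevMean_mem (m := m) (by omega) h
  have hround : epochPcal F T C ι m h ≤ ∑ s ∈ points T C ι m h, regret F start m s (u s) h +
      (c * epochSum m (fun _ _ => 1) h + 1 / (4 * outerCount C ι ^ 2) *
        epochSum m (fun h' _ => spread F start T C ι p h') h) := by
    unfold epochPcal regret
    simp only [hb]
    rw [← epochSum_finset_sum, ← epochSum_finset_sum, ← epochSum_mul, ← epochSum_mul,
      ← epochSum_add, ← epochSum_add]
    refine epochSum_mono fun h' x hs he => ?_
    have hl := hs.length_le
    rw [List.length_cons] at hl
    have hpm := prevMean_of_suffix (m := m) (by omega) he.ge ((List.suffix_cons x h').trans hs)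
    have hpt := points_of_suffix (T := T) (C := C) (ι := ι) h2 he hs
    have := stationary_loss_le hstat hstart hι hC (h := h') (by omega) he h2 (p := p)
      (y := outcome x.2) (by rwa [hpm])
    rw [hpm, hpt, ← hc] at this
    simp only [mul_sub, Finset.sum_sub_distrib]
    rw [mul_one, one_div_mul_eq_div]
    linarith
  have h1 : ∑ s ∈ points T C ι m h, regret F start m s (u s) h ≤
      (points T C ι m h).card * (2 * Real.log (1 + h.length)) := by
    rw [← nsmul_eq_mul]
    exact Finset.sum_le_card_nsmul _ _ _ fun s _ => regret_le_log hstart m s (hu s) h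
  have h3 := inner_variance_le hι hC (m := m) (by omega) hy
  have h4 : c * epochSum m (fun _ _ => 1) h ≤ (1 + C) ^ (1 / 3 : ℝ) * ι := by
    have := mul_le_mul_of_nonneg_left (epochSum_one_le (m := m) (by omega) h)
      (show 0 ≤ c by positivity)
    rw [hc] at this ⊢
    linarith
  rw [one_div_mul_eq_div] at hround
  linarith

/-- Weighted sum of the identity `(a - p)² = (a - y)² - (p - y)² + 2(a - p)(y - p)`. -/
theorem epochSum_spread_eq {m : ℕ} (h2 : 2 ≤ m) (p : ℝ) (h : History) :
    epochSum m (fun h' _ => spread F start T C ι p h') h =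
      ∑ s ∈ points T C ι m h, regret F start m s p h +
      epochSum m (fun h' x => drift F start T C ι p h' * (outcome x.2 - p)) h := by
  unfold regret
  rw [← epochSum_finset_sum, ← epochSum_add]
  refine epochSum_congr fun h' x hs he => ?_
  rw [spread, drift, he, points_of_suffix h2 he hs, Finset.sum_mul, ← Finset.sum_add_distrib]
  exact Finset.sum_congr rfl fun s _ => by ring

theorem epochSum_spread_le (hstart : ∀ m s, start m s ∈ Set.Icc (0 : ℝ) 1) {m : ℕ} (h2 : 2 ≤ m)
    {p : ℝ} (hp : p ∈ Set.Icc (0 : ℝ) 1) (h : History) :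
    epochSum m (fun h' _ => spread F start T C ι p h') h ≤
      (points T C ι m h).card * (2 * Real.log (1 + h.length)) +
      epochSum m (fun h' x => drift F start T C ι p h' * (outcome x.2 - p)) h := by
  rw [epochSum_spread_eq h2]
  refine add_le_add_left ?_ _
  rw [← nsmul_eq_mul]
  exact Finset.sum_le_card_nsmul _ _ _ fun s _ => regret_le_log hstart m s hp h

end

/-! ### The pseudo-calibration error over all epochs -/

/-- All logarithmic quantities (regret of an instance, number of epochs, number of bands) are
replaced by `ι`, since the final bound is expressed in powers of `ι`. -/
theorem log_one_add_le {T : ℕ} {ι : ℝ} (hT : 2 ≤ T) (hι : 10 * Real.log T ≤ ι) :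
    Real.log (1 + T) ≤ ι ∧ (epoch (T - 1) : ℝ) ≤ ι ∧ (bandMax T : ℝ) + 1 ≤ ι ∧ 1 ≤ ι := by
  have hT' : (2 : ℝ) ≤ T := by exact_mod_cast hT
  have hl2 := Real.log_two_gt_d9
  have hl2' := Real.log_two_lt_d9
  have hlT : Real.log 2 ≤ Real.log T := Real.log_le_log (by norm_num) hT'
  have h1 : Real.log (1 + T) ≤ 2 * Real.log T := by
    rw [two_mul, ← Real.log_mul (by positivity) (by positivity)]
    exact Real.log_le_log (by positivity) (by nlinarith)
  refine ⟨by linarith, ?_, ?_, by linarith⟩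
  · have h2 : (2 : ℝ) ^ epoch (T - 1) ≤ 1 + T := by
      have := two_pow_epoch_le (t := T - 1) (T := T) (by omega)
      have h3 : ((2 ^ epoch (T - 1) : ℕ) : ℝ) ≤ ((T + 1 : ℕ) : ℝ) := by exact_mod_cast this
      push_cast at h3; linarith
    have h3 := Real.log_le_log (by positivity) h2
    rw [Real.log_pow] at h3
    nlinarith
  · have h2 := (Nat.ceil_lt_add_one (Real.logb_nonneg one_lt_two (show (1 : ℝ) ≤ T by linarith))).le
    have h3 : Real.logb 2 T ≤ 2 * Real.log T := by
      rw [Real.logb, div_le_iff₀ (by linarith)]; nlinarith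
    unfold bandMax
    linarith

section
variable {F : Forecaster} {start : ℕ → ℝ → ℝ} {T : ℕ} {C ι : ℝ}

theorem chain_card_le {z : ℕ → ℝ} {n m : ℕ} {y : ℝ} (hι : 1 ≤ ι) (hQ : (bandMax T : ℝ) + 1 ≤ ι)
    (hC : 0 ≤ C) (hm : 1 ≤ m)
    (hy : y ∈ Set.Icc (0 : ℝ) 1) (hn : 0 < n)
    (hle : n ≤ innerCount C ι m y + 2 * ((bandMax T + 1) * outerCount C ι))
    (hz : Chain (partition T C ι m y) z n 1) :
    ((endpoints (partition T C ι m y)).card : ℝ) ≤ 6 * (1 + C) ^ (1 / 3 : ℝ) + 4 * ι := by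
  have h1 : ((endpoints (partition T C ι m y)).card : ℝ) ≤ n + 1 := by
    exact_mod_cast hz.card_endpoints_le hn
  have h2 : (n : ℝ) ≤ innerCount C ι m y + 2 * (((bandMax T : ℝ) + 1) * outerCount C ι) := by
    exact_mod_cast hle
  have h3 := innerCount_le hι hC hm hy
  have h4 := outerCount_le (ι := ι) (by linarith) hC
  have h5 : ((bandMax T : ℝ) + 1) * outerCount C ι ≤ ι * ((1 + C) ^ (1 / 3 : ℝ) / ι + 1) := by gcongr
  rw [mul_add, mul_div_cancel₀ _ (by positivity), mul_one] at h5
  linarith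

theorem points_card_le (hT : 2 ≤ T) (hι : 10 * Real.log T ≤ ι) (hC : 0 ≤ C) {m : ℕ} (h2 : 2 ≤ m)
    (hm : m ≤ epoch (T - 1)) (h : History) :
    ((points T C ι m h).card : ℝ) ≤ 6 * (1 + C) ^ (1 / 3 : ℝ) + 4 * ι := by
  obtain ⟨-, -, hQ, hι1⟩ := log_one_add_le hT hι
  have hy := prevMean_mem (m := m) (by omega) h
  have hmT : 2 ^ m ≤ T + 1 := (Nat.pow_le_pow_right (by norm_num) hm).trans
    (two_pow_epoch_le (by omega))
  obtain ⟨z, n, hn, hle, hz⟩ := exists_chain (T := T) (by omega) hι1 hC (by omega) hmT hy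
  exact chain_card_le hι1 hQ hC (by omega) hy hn hle hz

theorem sum_points_card_le (hT : 2 ≤ T) (hι : 10 * Real.log T ≤ ι) (hC : 0 ≤ C) (h : History) :
    ∑ m ∈ Finset.Icc 2 (epoch (T - 1)), ((points T C ι m h).card : ℝ) ≤
      ι * (6 * (1 + C) ^ (1 / 3 : ℝ) + 4 * ι) := by
  obtain ⟨-, hM, -, hι1⟩ := log_one_add_le hT hι
  have h1 := Finset.sum_le_card_nsmul (Finset.Icc 2 (epoch (T - 1)))
    (fun m => ((points T C ι m h).card : ℝ)) (6 * (1 + C) ^ (1 / 3 : ℝ) + 4 * ι) fun m hm =>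
      points_card_le hT hι hC (Finset.mem_Icc.1 hm).1 (Finset.mem_Icc.1 hm).2 h
  rw [nsmul_eq_mul] at h1
  refine h1.trans (mul_le_mul_of_nonneg_right ?_ (by positivity))
  refine le_trans ?_ hM
  rw [Nat.card_Icc]
  exact_mod_cast (show epoch (T - 1) + 1 - 2 ≤ epoch (T - 1) by omega)

/-- `drift`, set to zero in the first epoch. -/
noncomputable def lead (F : Forecaster) (start : ℕ → ℝ → ℝ) (T : ℕ) (C ι p : ℝ) (h : History) : ℝ :=
  if 2 ≤ epoch h.length then drift F start T C ι p h else 0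

/-- A self-bounding argument for the left side `V`. The linear term splits along `y - p = (y - q) +
(q - p)`. With multiplier `lead / 4` the noise is at most `4x + (1/8) ∑ lead² ≤ 4x + V/2`; the other
part is at most `2 ∑ |q - p|` because `|lead| ≤ 2`. Solving for `V` doubles everything, whence the
factors `2`, `8` and `4`. -/
theorem total_spread_le (hstart : ∀ m s, start m s ∈ Set.Icc (0 : ℝ) 1) {q : ℕ → unitInterval}
    {h : History} {p x : ℝ} (hp : p ∈ Set.Icc (0 : ℝ) 1)
    (hnoise : sumRounds (fun h' y => lead F start T C ι p h' / 4 * (outcome y.2 - q h'.length) -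
      (lead F start T C ι p h' / 4) ^ 2 / 2) h ≤ x) :
    ∑ m ∈ Finset.Icc 2 (epoch (h.length - 1)),
        epochSum m (fun h' _ => spread F start T C ι p h') h ≤
      2 * (∑ m ∈ Finset.Icc 2 (epoch (h.length - 1)),
        ((points T C ι m h).card : ℝ) * (2 * Real.log (1 + h.length))) + 8 * x +
      4 * ∑ t ∈ Finset.range h.length, |(q t : ℝ) - p| := by
  set V := ∑ m ∈ Finset.Icc 2 (epoch (h.length - 1)),
    epochSum m (fun h' _ => spread F start T C ι p h') h with hV
  have h1 := Finset.sum_le_sum (s := Finset.Icc 2 (epoch (h.length - 1))) fun m hm =>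
    epochSum_spread_le (F := F) (T := T) (C := C) (ι := ι) hstart (Finset.mem_Icc.1 hm).1 hp h
  rw [Finset.sum_add_distrib, ← hV, sum_epochSum_two] at h1
  have h2 : sumRounds (fun h' y => lead F start T C ι p h' ^ 2) h ≤ 4 * V := by
    rw [hV, sum_epochSum_two, ← sumRounds_mul]
    refine sumRounds_mono fun h' y _ => ?_
    unfold lead
    split_ifs
    · exact drift_sq_le F start T C ι p h'
    · simp
  have h3 : sumRounds (fun h' y => lead F start T C ι p h' * (q h'.length - p)) h ≤
      2 * ∑ t ∈ Finset.range h.length, |(q t : ℝ) - p| := by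
    rw [← sumRounds_length (fun t => |(q t : ℝ) - p|), ← sumRounds_mul]
    refine sumRounds_mono fun h' y _ => (le_abs_self _).trans ?_
    rw [abs_mul]
    refine mul_le_mul_of_nonneg_right ?_ (abs_nonneg _)
    unfold lead
    split_ifs
    · exact abs_drift_le hstart T C ι hp h'
    · simp
  have h4 : sumRounds (fun h' y => if 2 ≤ epoch h'.length then
      drift F start T C ι p h' * (outcome y.2 - p) else 0) h =
      4 * sumRounds (fun h' y => lead F start T C ι p h' / 4 * (outcome y.2 - q h'.length) -
      (lead F start T C ι p h' / 4) ^ 2 / 2) h +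
      (1 / 8 * sumRounds (fun h' y => lead F start T C ι p h' ^ 2) h +
      sumRounds (fun h' y => lead F start T C ι p h' * (q h'.length - p)) h) := by
    rw [← sumRounds_mul, ← sumRounds_mul, ← sumRounds_add, ← sumRounds_add]
    refine sumRounds_congr fun h' y _ => ?_
    unfold lead
    split_ifs <;> ring
  linarith

theorem sum_epochPcal_le (hstat : Stationary F start T C ι)
    (hstart : ∀ m s, start m s ∈ Set.Icc (0 : ℝ) 1) (hT : 2 ≤ T) (hι : 10 * Real.log T ≤ ι)
    {q : ℕ → unitInterval} {h : History} (hl : h.length = T) {p : ℝ} (hp : p ∈ Set.Icc (0 : ℝ) 1)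
    (hpC : ∑ t ∈ Finset.range T, |(q t : ℝ) - p| = C)
    (hmean : ∀ m ∈ Finset.Icc 2 (epoch (T - 1)), |prevMean m h - p| ≤ radius C ι m)
    (hnoise : sumRounds (fun h' y => lead F start T C ι p h' / 4 * (outcome y.2 - q h'.length) -
      (lead F start T C ι p h' / 4) ^ 2 / 2) h ≤ ι) :
    ∑ m ∈ Finset.Icc 2 (epoch (T - 1)), epochPcal F T C ι m h ≤
      20 * (ι ^ 3 + (1 + C) ^ (1 / 3 : ℝ) * ι ^ 2) := by
  obtain ⟨hlog, hM, hQ, hι1⟩ := log_one_add_le hT hι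
  have hC : 0 ≤ C := hpC ▸ Finset.sum_nonneg fun _ _ => abs_nonneg _
  set c := (1 + C) ^ (1 / 3 : ℝ) with hc
  have hc1 : 1 ≤ c := Real.one_le_rpow (by linarith) (by norm_num)
  have hc3 : c ^ 3 = 1 + C := by
    rw [hc, ← Real.rpow_natCast, ← Real.rpow_mul (by linarith)]; norm_num
  have hK1 : (1 : ℝ) ≤ outerCount C ι := by exact_mod_cast outerCount_pos (by linarith) hC
  have hKc : c / ι ≤ outerCount C ι := Nat.le_ceil _
  set D := ∑ m ∈ Finset.Icc 2 (epoch (T - 1)),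
    ((points T C ι m h).card : ℝ) * (2 * Real.log (1 + T)) with hD
  have hDle : D ≤ 12 * (c * ι ^ 2) + 8 * ι ^ 3 := by
    rw [hD, ← Finset.sum_mul]
    have := sum_points_card_le hT hι hC h
    have hl0 : 0 ≤ Real.log (1 + T) := Real.log_nonneg (by linarith [Nat.cast_nonneg (α := ℝ) T])
    calc _ ≤ (ι * (6 * c + 4 * ι)) * (2 * ι) := by gcongr
      _ = _ := by ring
  have hD0 : 0 ≤ D := Finset.sum_nonneg fun m _ => mul_nonneg (Nat.cast_nonneg _)
    (mul_nonneg zero_le_two (Real.log_nonneg (by linarith [Nat.cast_nonneg (α := ℝ) T])))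
  have hV := total_spread_le (T := T) (C := C) (ι := ι) hstart hp hnoise
  rw [hl, ← hD, hpC] at hV
  set V := ∑ m ∈ Finset.Icc 2 (epoch (T - 1)),
    epochSum m (fun h' _ => spread F start T C ι p h') h with hVdef
  have hsum := Finset.sum_le_sum fun m hm => epochPcal_le hstat hstart hι1 hC hl.le
    (Finset.mem_Icc.1 hm).1 (hmean m hm)
  rw [Finset.sum_add_distrib, Finset.sum_add_distrib, ← Finset.sum_div, hl, ← hD, ← hVdef,
    Finset.sum_const, nsmul_eq_mul] at hsum
  have h1 : ((Finset.Icc 2 (epoch (T - 1))).card : ℝ) * (c * ι) ≤ c * ι ^ 2 := by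
    have : ((Finset.Icc 2 (epoch (T - 1))).card : ℝ) ≤ ι := by
      refine le_trans ?_ hM
      rw [Nat.card_Icc]
      exact_mod_cast (show epoch (T - 1) + 1 - 2 ≤ epoch (T - 1) by omega)
    calc _ ≤ ι * (c * ι) := by gcongr
      _ = _ := by ring
  have hKpos : (0 : ℝ) < 4 * outerCount C ι ^ 2 := by positivity
  have hK2 : (1 : ℝ) ≤ outerCount C ι ^ 2 := one_le_pow₀ hK1
  -- `V ≤ 2D + 8ι + 4C` is divided by `4K²`. The first two terms only need `K ≥ 1`; for the last, `C
  -- ≤ c³` and `c ≤ Kι` give `C ≤ c ι² K²`.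
  have h2 : V / (4 * outerCount C ι ^ 2) ≤ D / 2 + 2 * ι + c * ι ^ 2 := by
    rw [div_le_iff₀ hKpos]
    have h3 : C ≤ c * ι ^ 2 * outerCount C ι ^ 2 := by
      have h4 : c ≤ outerCount C ι * ι := by rwa [div_le_iff₀ (by linarith)] at hKc
      have h5 : c ^ 2 ≤ (outerCount C ι * ι) ^ 2 := pow_le_pow_left₀ (by linarith) h4 2
      nlinarith [mul_le_mul_of_nonneg_left h5 (show 0 ≤ c by linarith)]
    nlinarith [mul_le_mul_of_nonneg_left hK2 hD0, mul_le_mul_of_nonneg_left hK2 (show 0 ≤ ι by linarith)]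
  have h4 : ι ≤ ι ^ 3 := le_self_pow₀ hι1 (by norm_num)
  nlinarith

/-! ### From epochs to the whole horizon -/

/-- Cauchy–Schwarz, used to treat a point that occurs in several epochs separately in each of them.
The hypothesis `|f| ≤ g` matters where `g` vanishes: there `f² / g` reads `0`, so `f` has to vanish
as well. -/
theorem sq_sum_div_le {α : Type*} (s : Finset α) (f g : α → ℝ) (hg : ∀ i ∈ s, 0 ≤ g i)
    (hfg : ∀ i ∈ s, |f i| ≤ g i) : (∑ i ∈ s, f i) ^ 2 / ∑ i ∈ s, g i ≤ ∑ i ∈ s, f i ^ 2 / g i := by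
  rcases (Finset.sum_nonneg hg).eq_or_lt with h0 | hpos
  · rw [← h0, div_zero]
    exact Finset.sum_nonneg fun i hi => div_nonneg (sq_nonneg _) (hg i hi)
  · rw [div_le_iff₀ hpos, mul_comm]
    refine Finset.sum_sq_le_sum_mul_sum_of_sq_le_mul s hg
      (fun i hi => div_nonneg (sq_nonneg _) (hg i hi)) fun i hi => ?_
    rcases (hg i hi).eq_or_lt with h1 | h1
    · have := hfg i hi
      rw [← h1] at this ⊢
      rw [abs_nonpos_iff.1 this]; simp
    · exact (mul_div_cancel₀ _ h1.ne').ge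

theorem sq_div_le_of_abs_le {a b : ℝ} (h : |a| ≤ b) : a ^ 2 / b ≤ b := by
  have hb : 0 ≤ b := (abs_nonneg a).trans h
  refine div_le_of_le_mul₀ hb hb ?_
  rw [← sq_abs]
  nlinarith [abs_nonneg a]

theorem abs_outcome_sub_le {p : ℝ} (hp : p ∈ Set.Icc (0 : ℝ) 1) (b : Bool) : |outcome b - p| ≤ 1 := by
  have := outcome_mem b
  rw [abs_le]; constructor <;> linarith [this.1, this.2, hp.1, hp.2]

theorem weight_nonneg (F : Forecaster) (m : ℕ) (h : History) (p : ℝ) : 0 ≤ weight F m h p :=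
  epochSum_weight_nonneg m p h

theorem abs_bias_le {p : ℝ} (hp : p ∈ Set.Icc (0 : ℝ) 1) (m : ℕ) (h : History) :
    |bias F m h p| ≤ weight F m h p := by
  refine (abs_epochSum_le _ _ _).trans (epochSum_mono fun h' x _ _ => ?_)
  rw [abs_mul, abs_of_nonneg ENNReal.toReal_nonneg]
  exact mul_le_of_le_one_right ENNReal.toReal_nonneg (abs_outcome_sub_le hp x.2)

theorem hasSum_sumRounds {f : History → ℝ → ℝ} : ∀ {h : History},
    (∀ h' x, (x :: h') <:+ h → Summable (f h')) →
    HasSum (fun p => sumRounds (fun h' _ => f h' p) h) (sumRounds (fun h' _ => ∑' p, f h' p) h)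
  | [], _ => hasSum_zero
  | x :: h, H => (hasSum_sumRounds fun h' y hs => H h' y (hs.trans (List.suffix_cons x h))).add
      (H h x List.suffix_rfl).hasSum

theorem hasSum_toReal (μ : PMF ℝ) : HasSum (fun p => (μ p).toReal) 1 := by
  have := ENNReal.hasSum_toReal (f := μ) (by rw [PMF.tsum_coe]; exact ENNReal.one_ne_top)
  rwa [← ENNReal.tsum_toReal_eq fun p => μ.apply_ne_top p, PMF.tsum_coe, ENNReal.toReal_one] at this

theorem toReal_eq_zero_of_notMem {μ : PMF ℝ} {p : ℝ} (h : p ∉ μ.support) : (μ p).toReal = 0 := by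
  rw [PMF.mem_support_iff, not_not] at h
  rw [h, ENNReal.toReal_zero]

theorem weighted_sq_eq (h : History) (p : ℝ) :
    sumRounds (fun h' _ => (F h' p).toReal * (rhoBar F h p - p) ^ 2) h =
      sumRounds (fun h' x => (F h' p).toReal * (outcome x.2 - p)) h ^ 2 /
        sumRounds (fun h' _ => (F h' p).toReal) h := by
  set W := sumRounds (fun h' _ => (F h' p).toReal) h with hW
  set Y := sumRounds (fun h' x => (F h' p).toReal * outcome x.2) h with hY
  have e1 : sumRounds (fun h' _ => (F h' p).toReal * (rhoBar F h p - p) ^ 2) h =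
      (Y / W - p) ^ 2 * W := by
    rw [hW, ← sumRounds_mul]
    exact sumRounds_congr fun h' x _ => mul_comm _ _
  have e2 : sumRounds (fun h' x => (F h' p).toReal * (outcome x.2 - p)) h = Y - p * W := by
    rw [hY, hW, ← sumRounds_mul, ← sumRounds_sub]
    exact sumRounds_congr fun h' x _ => by ring
  rw [e1, e2]
  rcases eq_or_ne W 0 with h0 | h0
  · simp [h0]
  · field_simp

/-- The sum over rounds is exchanged with the infinite sum over points, and each point is split over
the epochs. In epoch 1 the error of a point is at most its weight; these weights add up to at most
the two rounds of the epoch, which is the summand `2`. -/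
theorem pcal2_le (hstat : Stationary F start T C ι) {h : History} (hl : h.length ≤ T)
    (hsupp : ∀ h' x, (x :: h') <:+ h → (F h').support ⊆ Set.Icc (0 : ℝ) 1) :
    pcal2 F h ≤ 2 + ∑ m ∈ Finset.Icc 2 (epoch (h.length - 1)), epochPcal F T C ι m h := by
  have hzero : ∀ p, p ∉ Set.Icc (0 : ℝ) 1 → ∀ h' x, (x :: h') <:+ h → (F h' p).toReal = 0 :=
    fun p hp h' x hs => toReal_eq_zero_of_notMem fun hm => hp (hsupp h' x hs hm)
  have hW0 : ∀ p, 0 ≤ sumRounds (fun h' _ => (F h' p).toReal) h := fun p =>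
    sumRounds_nonneg fun _ _ _ => ENNReal.toReal_nonneg
  have hrho : ∀ p, rhoBar F h p ∈ Set.Icc (0 : ℝ) 1 := by
    intro p
    have h1 : 0 ≤ sumRounds (fun h' x => (F h' p).toReal * outcome x.2) h :=
      sumRounds_nonneg fun _ x _ => mul_nonneg ENNReal.toReal_nonneg (outcome_mem x.2).1
    refine ⟨div_nonneg h1 (hW0 p), div_le_one_of_le₀ (sumRounds_mono fun _ x _ => ?_) (hW0 p)⟩
    exact mul_le_of_le_one_right ENNReal.toReal_nonneg (outcome_mem x.2).2
  have hsummable : ∀ h' x, (x :: h') <:+ h →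
      Summable fun p => (F h' p).toReal * (rhoBar F h p - p) ^ 2 := by
    intro h' x hs
    refine Summable.of_nonneg_of_le (fun p => mul_nonneg ENNReal.toReal_nonneg (sq_nonneg _))
      (fun p => ?_) (hasSum_toReal (F h')).summable
    by_cases hp : p ∈ Set.Icc (0 : ℝ) 1
    · refine mul_le_of_le_one_right ENNReal.toReal_nonneg ?_
      have := hrho p
      rw [sq_le_one_iff_abs_le_one, abs_le]
      constructor <;> linarith [this.1, this.2, hp.1, hp.2]
    · rw [hzero p hp h' x hs, zero_mul]
  have hLHS := hasSum_sumRounds hsummable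
  have hone : HasSum (fun p => weight F 1 h p) (epochSum 1 (fun _ _ => 1) h) := by
    have h1 := hasSum_sumRounds (f := fun h' p => if epoch h'.length = 1 then (F h' p).toReal else 0)
      (h := h) fun h' x _ => by
        split_ifs
        · exact (hasSum_toReal (F h')).summable
        · exact summable_zero
    rw [show sumRounds (fun h' _ => ∑' p, if epoch h'.length = 1 then (F h' p).toReal else 0) h =
      epochSum 1 (fun _ _ => 1) h from sumRounds_congr fun h' x _ => by
        split_ifs
        · exact (hasSum_toReal (F h')).tsum_eq
        · exact tsum_zero] at h1
    exact h1
  have hmulti : HasSum (fun p => ∑ m ∈ Finset.Icc 2 (epoch (h.length - 1)),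
      bias F m h p ^ 2 / weight F m h p)
      (∑ m ∈ Finset.Icc 2 (epoch (h.length - 1)), epochPcal F T C ι m h) := by
    refine hasSum_sum fun m hm => hasSum_sum_of_ne_finset_zero fun p hp => ?_
    have h2 := (Finset.mem_Icc.1 hm).1
    have : weight F m h p = 0 := by
      have : weight F m h p = epochSum m (fun _ _ => 0) h := epochSum_congr fun h' x hs he => by
        refine toReal_eq_zero_of_notMem fun hmem => hp ?_
        have hl' := hs.length_le
        rw [List.length_cons] at hl'
        have := (hstat h' (by omega) (he ▸ h2)).1 hmem
        rw [← points_of_suffix h2 he hs, ← he]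
        exact this
      rw [this]; unfold epochSum; simp
    rw [this, div_zero]
  have hle := hasSum_le (fun p => ?_) hLHS (hone.add hmulti)
  · have h1 := epochSum_one_le (m := 1) le_rfl h
    unfold pcal2
    linarith
  · rw [weighted_sq_eq]
    by_cases hp : p ∈ Set.Icc (0 : ℝ) 1
    · have h1 := sq_sum_div_le (insert 1 (Finset.Icc 2 (epoch (h.length - 1))))
        (fun m => bias F m h p) (fun m => weight F m h p) (fun m _ => weight_nonneg F m h p)
        fun m _ => abs_bias_le hp m h
      rw [Finset.sum_insert (by simp), Finset.sum_insert (by simp), Finset.sum_insert (by simp)] at h1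
      have h2 := sq_div_le_of_abs_le (abs_bias_le (F := F) hp 1 h)
      rw [sumRounds_eq_epochSum, sumRounds_eq_epochSum]
      refine h1.trans ?_
      linarith
    · have : sumRounds (fun h' _ => (F h' p).toReal) h = 0 :=
        (sumRounds_congr (g := fun _ _ => 0) fun h' x hs => hzero p hp h' x hs).trans (sumRounds_zero h)
      rw [this, div_zero]
      exact add_nonneg (weight_nonneg F 1 h p) (Finset.sum_nonneg fun m _ =>
        div_nonneg (sq_nonneg _) (weight_nonneg F m h p))

end

/-! ### The calibration error -/

/-- The number of predictions `p` in epoch `m`. -/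
noncomputable def count (m : ℕ) (h : History) (p : ℝ) : ℝ :=
  epochSum m (fun _ x => if x.1 = p then 1 else 0) h

/-- The realised bias `∑ (y_t - p)` over the rounds of epoch `m` with prediction `p`. -/
noncomputable def visitBias (m : ℕ) (h : History) (p : ℝ) : ℝ :=
  epochSum m (fun _ x => if x.1 = p then outcome x.2 - p else 0) h

theorem count_nonneg (m : ℕ) (h : History) (p : ℝ) : 0 ≤ count m h p :=
  epochSum_nonneg fun _ _ _ _ => by split_ifs <;> norm_num

theorem abs_visitBias_le {p : ℝ} (hp : p ∈ Set.Icc (0 : ℝ) 1) (m : ℕ) (h : History) :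
    |visitBias m h p| ≤ count m h p := by
  refine (abs_epochSum_le _ _ _).trans (epochSum_mono fun h' x _ _ => ?_)
  split_ifs
  · exact abs_outcome_sub_le hp x.2
  · simp

section
variable {F : Forecaster} {start : ℕ → ℝ → ℝ} {T : ℕ} {C ι : ℝ}

/-- The counterpart of `pcal2_le` for visits. Realised predictions lie in the support, so in epoch
`m` a point outside the partition has no visit and its term is `0`. -/
theorem cal2_le (hstat : Stationary F start T C ι) {h : History} (hl : h.length ≤ T)
    (hsupp : ∀ h' x, (x :: h') <:+ h → (F h').support ⊆ Set.Icc (0 : ℝ) 1)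
    (hmem : ∀ h' x, (x :: h') <:+ h → x.1 ∈ (F h').support) :
    cal2 h ≤ 2 + ∑ m ∈ Finset.Icc 2 (epoch (h.length - 1)),
      ∑ p ∈ points T C ι m h, visitBias m h p ^ 2 / count m h p := by
  set s := (h.map Prod.fst).toFinset with hs
  set M := Finset.Icc 2 (epoch (h.length - 1))
  have hterm : ∀ p ∈ s, visits h p *
      |1 / visits h p * sumRounds (fun _ x => if x.1 = p then outcome x.2 - x.1 else 0) h| ^ 2 ≤
      count 1 h p + ∑ m ∈ M, visitBias m h p ^ 2 / count m h p := by
    intro p hp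
    have hp01 : p ∈ Set.Icc (0 : ℝ) 1 := by
      rw [hs, List.mem_toFinset, List.mem_map] at hp
      obtain ⟨x, hx, rfl⟩ := hp
      obtain ⟨l, r, rfl⟩ := List.append_of_mem hx
      have hsuf : (x :: r) <:+ l ++ x :: r := List.suffix_append _ _
      exact hsupp r x hsuf (hmem r x hsuf)
    have e1 : sumRounds (fun _ x => if x.1 = p then outcome x.2 - x.1 else 0) h =
        sumRounds (fun _ x => if x.1 = p then outcome x.2 - p else 0) h :=
      sumRounds_congr fun h' x _ => by split_ifs with hx <;> simp [hx]
    set n := visits h p with hn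
    set S := sumRounds (fun _ x => if x.1 = p then outcome x.2 - p else 0) h with hS
    have e2 : n * |1 / n * S| ^ 2 = S ^ 2 / n := by
      rw [sq_abs]
      rcases eq_or_ne n 0 with h0 | h0
      · simp [h0]
      · field_simp
    rw [e1, e2, hn, visits, hS, sumRounds_eq_epochSum, sumRounds_eq_epochSum]
    have h1 := sq_sum_div_le (insert 1 M)
        (fun m => visitBias m h p) (fun m => count m h p) (fun m _ => count_nonneg m h p)
        fun m _ => abs_visitBias_le hp01 m h
    rw [Finset.sum_insert (by simp [M]), Finset.sum_insert (by simp [M]), Finset.sum_insert (by simp [M])] at h1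
    have h2 := sq_div_le_of_abs_le (abs_visitBias_le hp01 1 h)
    refine h1.trans ?_
    linarith
  refine (Finset.sum_le_sum hterm).trans ?_
  rw [Finset.sum_add_distrib, Finset.sum_comm]
  refine add_le_add ?_ (Finset.sum_le_sum fun m hm => ?_)
  · unfold count
    rw [← epochSum_finset_sum]
    have h1 := epochSum_one_le (m := 1) le_rfl h
    rw [pow_one] at h1
    refine le_trans (epochSum_mono fun h' x _ _ => ?_) h1
    rw [Finset.sum_ite_eq]
    split_ifs <;> norm_num
  · have h2 : 2 ≤ m := (Finset.mem_Icc.1 hm).1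
    have hnn : ∀ p, 0 ≤ visitBias m h p ^ 2 / count m h p := fun p =>
      div_nonneg (sq_nonneg _) (count_nonneg m h p)
    calc _ ≤ ∑ p ∈ s ∪ points T C ι m h, visitBias m h p ^ 2 / count m h p :=
          Finset.sum_le_sum_of_subset_of_nonneg Finset.subset_union_left fun p _ _ => hnn p
      _ = _ := by
          refine (Finset.sum_subset Finset.subset_union_right fun p _ hp => ?_).symm
          have : count m h p = epochSum m (fun _ _ => 0) h := epochSum_congr fun h' x hs he => by
            refine if_neg fun hx => hp ?_
            have hl' := hs.length_le
            rw [List.length_cons] at hl'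
            have := (hstat h' (by omega) (he ▸ h2)).1 (hmem h' x hs)
            rw [← points_of_suffix h2 he hs, ← he, ← hx]
            exact this
          rw [this]; unfold epochSum; simp

/-- In epoch `m` the visits of `p` are close to the weights that the forecaster put on `p`. -/
def VisitsClose (F : Forecaster) (T : ℕ) (x : ℝ) (m : ℕ) (p : ℝ) (h : History) : Prop :=
  (∀ j ∈ Finset.Icc 1 T, |visitBias m h p - bias F m h p| ≤ weight F m h p / j + x * j) ∧
    weight F m h p / 2 - 2 * x ≤ count m h p ∧ count m h p ≤ 3 / 2 * weight F m h p + 2 * x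

/-- If `W < 8x`, the quotient is at most the count, which is below `14x`. Otherwise the count is at
least `W/4`, and `j = ⌈√(W/x)⌉` balances `W/j` with `x j`, so the biases differ by at most `3
√(xW)`. The weight `W` is random, which is why `VisitsClose` asks for all `j` up to `T` at once. -/
theorem visitBias_sq_div_le {x : ℝ} {m : ℕ} {p : ℝ} {h : History} (hx : 1 ≤ x)
    (hp : p ∈ Set.Icc (0 : ℝ) 1) (hl : h.length ≤ T) (hv : VisitsClose F T x m p h) :
    visitBias m h p ^ 2 / count m h p ≤ 8 * (bias F m h p ^ 2 / weight F m h p) + 72 * x := by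
  obtain ⟨hj, hlo, hhi⟩ := hv
  have hV := abs_visitBias_le hp m h
  have hWT : weight F m h p ≤ T :=
    (epochSum_weight_le (F := F) (m := m) p h).trans (by exact_mod_cast hl)
  set W := weight F m h p
  set n := count m h p
  set S' := visitBias m h p
  set S := bias F m h p
  have hW0 : 0 ≤ W := weight_nonneg F m h p
  rcases lt_or_ge W (8 * x) with hW | hW
  · have h1 := sq_div_le_of_abs_le hV
    have h2 : 0 ≤ S ^ 2 / W := by positivity
    linarith
  · have hWpos : 0 < W := by linarith
    have hn : W / 4 ≤ n := by linarith
    set r := Real.sqrt (W / x) with hr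
    have hr1 : 0 < r := Real.sqrt_pos.2 (by positivity)
    have hr2 : r ^ 2 = W / x := Real.sq_sqrt (by positivity)
    have hxr : x * r ^ 2 = W := by rw [hr2]; field_simp
    set j := ⌈r⌉₊ with hjdef
    have hj1 : 1 ≤ j := Nat.ceil_pos.2 hr1
    have hjT : j ≤ T := by
      refine Nat.ceil_le.2 ?_
      have hT1 : (1 : ℝ) ≤ T := by linarith
      refine Real.sqrt_le_iff.2 ⟨by linarith, ?_⟩
      calc W / x ≤ W / 1 := by gcongr
        _ ≤ (T : ℝ) ^ 2 := by nlinarith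
    have hjr : r ≤ j := Nat.le_ceil r
    have hjr' : (j : ℝ) ≤ r + 1 := (Nat.ceil_lt_add_one hr1.le).le
    have h1 := hj j (Finset.mem_Icc.2 ⟨hj1, hjT⟩)
    have hr1' : 1 ≤ r := Real.one_le_sqrt.2 (by rw [le_div_iff₀ (by linarith)]; linarith)
    have h2 : W / j ≤ x * r := by
      rw [div_le_iff₀ (by exact_mod_cast hj1), ← hxr]
      have := mul_le_mul_of_nonneg_left hjr (show 0 ≤ x * r by positivity)
      linarith
    have h3 : |S' - S| ≤ 3 * (x * r) := by
      have : x * j ≤ x * (r + r) := by gcongr; linarith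
      linarith
    have h4 : (S' - S) ^ 2 ≤ 9 * x * W := by
      have := pow_le_pow_left₀ (abs_nonneg _) h3 2
      rw [sq_abs] at this
      calc _ ≤ _ := this
        _ = 9 * x * (x * r ^ 2) := by ring
        _ = _ := by rw [hxr]
    have h5 : S' ^ 2 ≤ 2 * S ^ 2 + 18 * x * W := by nlinarith [sq_nonneg (S' - 2 * S)]
    calc S' ^ 2 / n ≤ (2 * S ^ 2 + 18 * x * W) / (W / 4) := by gcongr
      _ = _ := by field_simp; ring

theorem cal2_le_of_visitsClose (hstat : Stationary F start T C ι)
    (hT : 2 ≤ T) (hι : 10 * Real.log T ≤ ι) (hC : 0 ≤ C) {h : History} (hl : h.length = T)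
    (hsupp : ∀ h' x, (x :: h') <:+ h → (F h').support ⊆ Set.Icc (0 : ℝ) 1)
    (hmem : ∀ h' x, (x :: h') <:+ h → x.1 ∈ (F h').support) {x : ℝ} (hx : 1 ≤ x) (hxι : x ≤ ι)
    (hv : ∀ m ∈ Finset.Icc 2 (epoch (T - 1)), ∀ p ∈ points T C ι m h, VisitsClose F T x m p h)
    (hpcal : ∑ m ∈ Finset.Icc 2 (epoch (T - 1)), epochPcal F T C ι m h ≤
      20 * (ι ^ 3 + (1 + C) ^ (1 / 3 : ℝ) * ι ^ 2)) :
    cal2 h ≤ 2 + 600 * (ι ^ 3 + (1 + C) ^ (1 / 3 : ℝ) * ι ^ 2) := by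
  obtain ⟨-, -, -, hι1⟩ := log_one_add_le hT hι
  have h1 := cal2_le hstat hl.le hsupp hmem
  rw [hl] at h1
  have h2 : ∀ m ∈ Finset.Icc 2 (epoch (T - 1)),
      ∑ p ∈ points T C ι m h, visitBias m h p ^ 2 / count m h p ≤
      8 * epochPcal F T C ι m h + 72 * x * (points T C ι m h).card := by
    intro m hm
    obtain ⟨hm2, hmM⟩ := Finset.mem_Icc.1 hm
    have hmT : 2 ^ m ≤ T + 1 := (Nat.pow_le_pow_right (by norm_num) hmM).trans
      (two_pow_epoch_le (by omega))
    obtain ⟨z, n, hn, -, hz⟩ := exists_chain (T := T) (by omega) hι1 hC (by omega) hmT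
      (prevMean_mem (m := m) (by omega) h)
    calc _ ≤ ∑ p ∈ points T C ι m h, (8 * (bias F m h p ^ 2 / weight F m h p) + 72 * x) :=
          Finset.sum_le_sum fun p hp => visitBias_sq_div_le hx (hz.endpoints_mem_Icc hn hp) hl.le
            (hv m hm p hp)
      _ = _ := by
          rw [Finset.sum_add_distrib, ← Finset.mul_sum, Finset.sum_const, nsmul_eq_mul, epochPcal]
          ring
  have h3 := Finset.sum_le_sum h2
  rw [Finset.sum_add_distrib, ← Finset.mul_sum, ← Finset.mul_sum] at h3
  have h4 := sum_points_card_le hT hι hC h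
  have hc0 : 0 ≤ (1 + C) ^ (1 / 3 : ℝ) := by positivity
  have h5 : 72 * x * ∑ m ∈ Finset.Icc 2 (epoch (T - 1)), ((points T C ι m h).card : ℝ) ≤
      72 * ι * (ι * (6 * (1 + C) ^ (1 / 3 : ℝ) + 4 * ι)) := by gcongr
  have h6 : 0 ≤ (1 + C) ^ (1 / 3 : ℝ) * ι ^ 2 := by positivity
  have h7 : 0 ≤ ι ^ 3 := by positivity
  nlinarith

end

/-! ### Union bounds -/

/-- The event `G` fails with probability at most `N * exp (-x)`. -/
def FailsRarely (F : Forecaster) (q : ℕ → unitInterval) (n : ℕ) (x : ℝ) (N : ℕ)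
    (G : History → Prop) : Prop :=
  (law F q n).toOuterMeasure {h | ¬ G h} ≤ N * ENNReal.ofReal (Real.exp (-x))

section
variable {F : Forecaster} {q : ℕ → unitInterval} {n : ℕ} {x : ℝ}

theorem FailsRarely.mono {N : ℕ} {G G' : History → Prop} (h : FailsRarely F q n x N G)
    (H : ∀ h, G h → G' h) : FailsRarely F q n x N G' :=
  (MeasureTheory.measure_mono (show {h | ¬ G' h} ⊆ {h | ¬ G h} from
    fun _ hn hg => hn (H _ hg))).trans h

theorem FailsRarely.mono_right {N N' : ℕ} {G : History → Prop} (h : FailsRarely F q n x N G)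
    (hN : N ≤ N') : FailsRarely F q n x N' G :=
  h.trans (by gcongr)

theorem FailsRarely.and {N N' : ℕ} {G G' : History → Prop} (h : FailsRarely F q n x N G)
    (h' : FailsRarely F q n x N' G') : FailsRarely F q n x (N + N') fun h => G h ∧ G' h := by
  unfold FailsRarely
  rw [show {h | ¬ (G h ∧ G' h)} = {h | ¬ G h} ∪ {h | ¬ G' h} by ext; simp [imp_iff_not_or]]
  refine (MeasureTheory.measure_union_le _ _).trans ?_
  push_cast
  rw [add_mul]
  exact add_le_add h h'

theorem FailsRarely.forall {α : Type*} {s : Finset α} {N : ℕ} {G : α → History → Prop}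
    (h : ∀ i ∈ s, FailsRarely F q n x N (G i)) :
    FailsRarely F q n x (s.card * N) fun h => ∀ i ∈ s, G i h := by
  unfold FailsRarely
  rw [show {h | ¬ ∀ i ∈ s, G i h} = ⋃ i ∈ s, {h | ¬ G i h} by ext; simp]
  refine (MeasureTheory.measure_biUnion_finset_le _ _).trans ?_
  refine (Finset.sum_le_card_nsmul _ _ _ h).trans ?_
  rw [nsmul_eq_mul]
  push_cast
  rw [mul_assoc]

theorem failsRarely_tail {φ : History → ℝ × Bool → ℝ}
    (H : ∀ h, roundExp F q h (fun x => ENNReal.ofReal (Real.exp (φ h x))) ≤ 1) :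
    FailsRarely F q n x 1 fun h => sumRounds φ h ≤ x := by
  unfold FailsRarely
  simp only [not_le, Nat.cast_one, one_mul]
  exact law_tail_le H n x

theorem FailsRarely.le_measure {N : ℕ} {G P : History → Prop} {δ : ℝ} (h : FailsRarely F q n x N G)
    (hN : N * Real.exp (-x) ≤ δ) (hP : ∀ h ∈ (law F q n).support, G h → P h) :
    ENNReal.ofReal (1 - δ) ≤ (law F q n).toOuterMeasure {h | P h} := by
  have h0 : 0 ≤ δ := le_trans (by positivity) hN
  have h1 : (law F q n).toOuterMeasure {h | ¬ P h} ≤ ENNReal.ofReal δ := by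
    refine le_trans ?_ (h.trans ?_)
    · rw [PMF.toOuterMeasure_apply, PMF.toOuterMeasure_apply]
      refine ENNReal.tsum_le_tsum fun a => ?_
      by_cases ha : a ∈ (law F q n).support
      · by_cases hPa : P a
        · rw [Set.indicator_of_notMem (show a ∉ {h | ¬ P h} from fun hn => hn hPa)]; exact zero_le
        · rw [Set.indicator_of_mem (show a ∈ {h | ¬ P h} from hPa),
            Set.indicator_of_mem (show a ∈ {h | ¬ G h} from fun hg => hPa (hP a ha hg))]
      · rw [PMF.mem_support_iff, not_not] at ha
        simp [Set.indicator, ha]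
    · rw [← ENNReal.ofReal_natCast, ← ENNReal.ofReal_mul (Nat.cast_nonneg N)]
      exact ENNReal.ofReal_le_ofReal hN
  have h2 : 1 ≤ (law F q n).toOuterMeasure {h | P h} + (law F q n).toOuterMeasure {h | ¬ P h} := by
    rw [← ((law F q n).toOuterMeasure_apply_eq_one_iff Set.univ).2 (Set.subset_univ _)]
    refine le_trans (MeasureTheory.measure_mono (show Set.univ ⊆ {h | P h} ∪ {h | ¬ P h} from fun a _ => ?_)) (MeasureTheory.measure_union_le _ _)
    exact em (P a)
  rw [ENNReal.ofReal_sub _ h0, ENNReal.ofReal_one]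
  exact tsub_le_iff_right.2 (h2.trans (add_le_add_right h1 _))

/-- Use the multiplier `r = √(ι / 2^m)` on epoch `m`, with either sign: the bound `r S - r² 2^m / 2
≤ ι / 2` says `r S ≤ ι = r² 2^m`, that is `S ≤ √(ι 2^m)`. -/
theorem failsRarely_mean {ι : ℝ} (hι : 0 < ι) {m : ℕ} (hm : 1 ≤ m) :
    FailsRarely F q n (ι / 2) 2 fun h =>
      |epochSum m (fun h' y => outcome y.2 - q h'.length) h| ≤ Real.sqrt (ι * 2 ^ m) := by
  set r := Real.sqrt (ι / 2 ^ m) with hr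
  have hr0 : 0 < r := Real.sqrt_pos.2 (by positivity)
  have hr2 : r ^ 2 = ι / 2 ^ m := Real.sq_sqrt (by positivity)
  have hrs : r ^ 2 * 2 ^ m = ι := by rw [hr2]; field_simp
  have hsq : Real.sqrt (ι * 2 ^ m) = r * 2 ^ m := by
    rw [show ι * 2 ^ m = (r * 2 ^ m) ^ 2 by rw [← hrs]; ring]
    exact Real.sqrt_sq (by positivity)
  have key : ∀ ε : ℝ, ε ^ 2 = 1 → FailsRarely F q n (ι / 2) 1 fun h =>
      ε * epochSum m (fun h' y => outcome y.2 - q h'.length) h ≤ Real.sqrt (ι * 2 ^ m) := by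
    intro ε hε
    refine (failsRarely_tail (x := ι / 2) (n := n) (roundExp_outcome_le F q fun h =>
      if epoch h.length = m then ε * r else 0)).mono fun h hh => ?_
    have e1 : sumRounds (fun h' y => (if epoch h'.length = m then ε * r else 0) *
        (outcome y.2 - q h'.length) - (if epoch h'.length = m then ε * r else 0) ^ 2 / 2) h =
        ε * r * epochSum m (fun h' y => outcome y.2 - q h'.length) h -
          r ^ 2 / 2 * epochSum m (fun _ _ => 1) h := by
      rw [← epochSum_mul, ← epochSum_mul, ← epochSum_sub]
      refine sumRounds_congr fun h' y _ => ?_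
      split_ifs
      · rw [mul_pow, hε]; ring
      · ring
    rw [e1] at hh
    have h1 := mul_le_mul_of_nonneg_left (epochSum_one_le hm h) (show 0 ≤ r ^ 2 / 2 by positivity)
    have h2 : r * (ε * epochSum m (fun h' y => outcome y.2 - q h'.length) h) ≤ r * (r * 2 ^ m) := by
      nlinarith
    rw [hsq]
    exact le_of_mul_le_mul_left h2 hr0
  refine ((key 1 (by norm_num)).and (key (-1) (by norm_num))).mono fun h hh => abs_le.2 ⟨?_, ?_⟩ <;>
    linarith [hh.1, hh.2]

/-- The multipliers, restricted to epoch `m`, are `±(y - p)/j` for the biases and `±1/2` for the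
counts; their compensators sum to at most `W/j²` and to `W/4`. This makes two events for each `j`
and two more. -/
theorem failsRarely_visits {m T : ℕ} {p : ℝ} (hp : p ∈ Set.Icc (0 : ℝ) 1) :
    FailsRarely F q n x (2 * T + 2) (VisitsClose F T x m p) := by
  have key : ∀ (ε : ℝ) (j : ℕ), |ε| = 1 → 1 ≤ j → FailsRarely F q n x 1 fun h =>
      ε * (visitBias m h p - bias F m h p) ≤ weight F m h p / j + x * j := by
    intro ε j hε hj
    have hj' : (1 : ℝ) ≤ j := by exact_mod_cast hj
    have hj0 : (0 : ℝ) < j := by linarith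
    have hε2 : ε ^ 2 = 1 := by rw [← sq_abs, hε, one_pow]
    refine (failsRarely_tail (x := x) (n := n) (roundExp_visit_le F q p
      (fun h y => if epoch h.length = m then ε / j * (outcome y - p) else 0) fun h y => ?_)).mono
      fun h hh => ?_
    · split_ifs
      · rw [abs_mul, abs_div, hε, abs_of_pos hj0]
        exact mul_le_one₀ ((div_le_one hj0).2 hj') (abs_nonneg _) (abs_outcome_sub_le hp y)
      · simp
    · have e1 : ε / j * (visitBias m h p - bias F m h p) - 1 / j ^ 2 * weight F m h p ≤ x := by
        refine le_trans ?_ hh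
        rw [visitBias, bias, weight, ← epochSum_sub, ← epochSum_mul, ← epochSum_mul, ← epochSum_sub]
        refine sumRounds_mono fun h' y _ => ?_
        by_cases h1 : epoch h'.length = m
        · simp only [if_pos h1]
          have h3 : (outcome y.2 - p) ^ 2 ≤ 1 := by
            rw [sq_le_one_iff_abs_le_one]; exact abs_outcome_sub_le hp y.2
          have h4 : (ε / j * (outcome y.2 - p)) ^ 2 * (F h' p).toReal ≤ 1 / j ^ 2 * (F h' p).toReal := by
            refine mul_le_mul_of_nonneg_right ?_ ENNReal.toReal_nonneg
            rw [mul_pow, div_pow, hε2]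
            exact mul_le_of_le_one_right (by positivity) h3
          by_cases h2 : y.1 = p
          · simp only [if_pos h2]; linarith
          · simp only [if_neg h2]; linarith
        · simp only [if_neg h1]; simp
      have h2 := mul_le_mul_of_nonneg_left e1 hj0.le
      rw [show (j : ℝ) * (ε / j * (visitBias m h p - bias F m h p) - 1 / j ^ 2 * weight F m h p) =
        ε * (visitBias m h p - bias F m h p) - weight F m h p / j by field_simp] at h2
      linarith
  have hcount : ∀ ε : ℝ, |ε| = 1 → FailsRarely F q n x 1 fun h =>
      ε * (count m h p - weight F m h p) ≤ weight F m h p / 2 + 2 * x := by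
    intro ε hε
    have hε2 : ε ^ 2 = 1 := by rw [← sq_abs, hε, one_pow]
    refine (failsRarely_tail (x := x) (n := n) (roundExp_visit_le F q p
      (fun h y => if epoch h.length = m then ε / 2 else 0) fun h y => ?_)).mono
      fun h hh => ?_
    · split_ifs
      · rw [abs_div, hε]; norm_num
      · simp
    · have e1 : sumRounds (fun h' y => (if epoch h'.length = m then ε / 2 else 0) *
          ((if y.1 = p then 1 else 0) - (F h' p).toReal) -
          (if epoch h'.length = m then ε / 2 else 0) ^ 2 * (F h' p).toReal) h =
          ε / 2 * (count m h p - weight F m h p) - 1 / 4 * weight F m h p := by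
        rw [count, weight, ← epochSum_sub, ← epochSum_mul, ← epochSum_mul, ← epochSum_sub]
        refine sumRounds_congr fun h' y _ => ?_
        by_cases h1 : epoch h'.length = m
        · simp only [if_pos h1]
          rw [div_pow, hε2]; ring
        · simp only [if_neg h1]; ring
      rw [e1] at hh
      linarith
  have h1 : FailsRarely F q n x ((Finset.Icc 1 T).card * 2) fun h => ∀ j ∈ Finset.Icc 1 T,
      |visitBias m h p - bias F m h p| ≤ weight F m h p / j + x * j :=
    FailsRarely.forall fun j hj =>
      ((key 1 j (by norm_num) (Finset.mem_Icc.1 hj).1).and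
        (key (-1) j (by norm_num) (Finset.mem_Icc.1 hj).1)).mono fun h hh => abs_le.2
          ⟨by linarith [hh.2], by linarith [hh.1]⟩
  refine ((h1.and ((hcount 1 (by norm_num)).and (hcount (-1) (by norm_num)))).mono
    (G' := VisitsClose F T x m p) fun h hh => ⟨hh.1, by linarith [hh.2.2], by linarith [hh.2.1]⟩).mono_right ?_
  rw [Nat.card_Icc]; omega

end

/-! ### The bounds with high probability -/

theorem exists_deviation_eq (q : ℕ → unitInterval) (T : ℕ) :
    ∃ p : unitInterval, ∑ t ∈ Finset.range T, |(q t : ℝ) - p| = deviation q T := by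
  have hcont : Continuous fun p : unitInterval => ∑ t ∈ Finset.range T, |(q t : ℝ) - p| := by
    fun_prop
  obtain ⟨p, -, hp⟩ := isCompact_univ.exists_isMinOn Set.univ_nonempty hcont.continuousOn
  refine ⟨p, le_antisymm (le_ciInf fun p' => hp (Set.mem_univ p')) (ciInf_le ⟨0, ?_⟩ p)⟩
  rintro _ ⟨p', rfl⟩
  exact Finset.sum_nonneg fun _ _ => abs_nonneg _

theorem deviation_nonneg (q : ℕ → unitInterval) (T : ℕ) : 0 ≤ deviation q T := by
  obtain ⟨p, hp⟩ := exists_deviation_eq q T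
  exact hp ▸ Finset.sum_nonneg fun _ _ => abs_nonneg _

theorem deviation_le (q : ℕ → unitInterval) (T : ℕ) : deviation q T ≤ T := by
  obtain ⟨p, hp⟩ := exists_deviation_eq q T
  rw [← hp]
  refine (Finset.sum_le_card_nsmul _ _ 1 fun t _ => ?_).trans (by simp)
  rw [abs_le]
  constructor <;> linarith [(q t).2.1, (q t).2.2, p.2.1, p.2.2]

theorem exists_epochSum_outcome_eq (m : ℕ) (h : History) :
    ∃ k : ℕ, epochSum m (fun _ x => outcome x.2) h = k := by
  induction h with
  | nil => exact ⟨0, by simp⟩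
  | cons x h ih =>
    obtain ⟨k, hk⟩ := ih
    rw [epochSum_cons, hk]
    split_ifs
    · rcases x with ⟨_, _ | _⟩
      · exact ⟨k, by simp [outcome]⟩
      · exact ⟨k + 1, by simp [outcome]⟩
    · exact ⟨k, by simp⟩

/-- The partition depends on the random previous mean, so the union bound has to cover every
partition that may arise. The mean has only `2^(m-1) + 1` possible values. -/
theorem exists_prevMean_eq {m : ℕ} (hm : 1 ≤ m) (h : History) :
    ∃ k ∈ Finset.range (2 ^ (m - 1) + 1), prevMean m h = (k : ℝ) / 2 ^ (m - 1) := by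
  obtain ⟨k, hk⟩ := exists_epochSum_outcome_eq (m - 1) h
  have h1 := (prevMean_mem hm h).2
  rw [prevMean_eq, hk, div_le_one (by positivity)] at h1
  refine ⟨k, Finset.mem_range.2 (Nat.lt_succ_of_le ?_), by rw [prevMean_eq, hk]⟩
  exact_mod_cast h1

/-- The previous epoch is complete and has `s = 2^(m-1)` rounds. The noise contributes `√(ι/s)`, the
distance of the `q_t` from `p` at most `C/s`: the two summands of the radius. -/
theorem abs_prevMean_sub_le {q : ℕ → unitInterval} {m T : ℕ} {h : History} {ι p : ℝ}
    (hm : 2 ≤ m) (hmh : m ≤ epoch h.length) (hl : h.length = T)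
    (hmean : |epochSum (m - 1) (fun h' y => outcome y.2 - q h'.length) h| ≤
      Real.sqrt (ι * 2 ^ (m - 1))) :
    |prevMean m h - p| ≤ radius (∑ t ∈ Finset.range T, |(q t : ℝ) - p|) ι m := by
  set s : ℝ := 2 ^ (m - 1) with hs
  have hs0 : 0 < s := by positivity
  have hone := epochSum_one_eq (m := m - 1) (by omega) (h := h) (by omega)
  have hdev : |epochSum (m - 1) (fun h' _ => (q h'.length : ℝ) - p) h| ≤
      ∑ t ∈ Finset.range T, |(q t : ℝ) - p| := by
    refine (abs_epochSum_le _ _ _).trans ?_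
    rw [← hl, ← sumRounds_length (fun t => |(q t : ℝ) - p|)]
    exact sumRounds_mono fun h' y _ => by
      split_ifs
      · exact le_rfl
      · exact abs_nonneg _
  have e1 : prevMean m h - p = (epochSum (m - 1) (fun h' y => outcome y.2 - q h'.length) h +
      epochSum (m - 1) (fun h' _ => (q h'.length : ℝ) - p) h) / s := by
    rw [eq_div_iff hs0.ne', sub_mul, prevMean_eq, div_mul_cancel₀ _ hs0.ne', hs, ← hone,
      ← epochSum_mul, ← epochSum_sub, ← epochSum_add]
    exact epochSum_congr fun _ _ _ _ => by ring
  have e2 : Real.sqrt (ι * s) / s = Real.sqrt (ι / s) := by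
    rw [div_eq_iff hs0.ne']
    nth_rewrite 3 [← Real.sqrt_sq hs0.le]
    rw [← Real.sqrt_mul' _ (by positivity)]
    congr 1
    field_simp
  rw [e1, abs_div, abs_of_pos hs0, radius, ← hs, ← e2, ← add_div]
  gcongr
  exact (abs_add_le _ _).trans (add_le_add hmean hdev)

/-- A crude polynomial bound is enough here, since it is only used in the union bound, where its
logarithm counts. -/
theorem endpoints_card_le {T : ℕ} {C ι : ℝ} {m : ℕ} {y : ℝ} (hT : 2 ≤ T) (hι : 1 ≤ ι) (hC : 0 ≤ C)
    (hCT : C ≤ T) (hm : 1 ≤ m) (hmT : 2 ^ m ≤ T + 1) (hy : y ∈ Set.Icc (0 : ℝ) 1) :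
    (endpoints (partition T C ι m y)).card ≤ 10 * T ^ 2 := by
  obtain ⟨z, n, hn, hle, hz⟩ := exists_chain (T := T) (by omega) hι hC hm hmT hy
  have hT' : (2 : ℝ) ≤ T := by exact_mod_cast hT
  have h1 : ((endpoints (partition T C ι m y)).card : ℝ) ≤ n + 1 := by
    exact_mod_cast hz.card_endpoints_le hn
  have h2 : (n : ℝ) ≤ innerCount C ι m y + 2 * (((bandMax T : ℝ) + 1) * outerCount C ι) := by
    exact_mod_cast hle
  have h3 := innerCount_le hι hC hm hy
  have h4 := outerCount_le (ι := ι) (by linarith) hC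
  have hc : (1 + C) ^ (1 / 3 : ℝ) ≤ 1 + T := by
    calc (1 + C) ^ (1 / 3 : ℝ) ≤ (1 + C) ^ (1 : ℝ) :=
          Real.rpow_le_rpow_of_exponent_le (by linarith) (by norm_num)
      _ ≤ 1 + T := by rw [Real.rpow_one]; linarith
  have hQ : (bandMax T : ℝ) ≤ T := by
    have : bandMax T ≤ T := by
      refine Nat.ceil_le.2 ?_
      rw [Real.logb_le_iff_le_rpow one_lt_two (by linarith), Real.rpow_natCast]
      exact_mod_cast (Nat.lt_two_pow_self (n := T)).le
    exact_mod_cast this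
  have h5 : (1 + C) ^ (1 / 3 : ℝ) / ι ≤ 1 + T := (div_le_self (by positivity) hι).trans hc
  have h6 : ((bandMax T : ℝ) + 1) * outerCount C ι ≤ (T + 1) * (T + 2) := by
    gcongr
    linarith
  have : ((endpoints (partition T C ι m y)).card : ℝ) ≤ 10 * (T : ℝ) ^ 2 := by nlinarith
  exact_mod_cast this

theorem union_count_le {M T : ℕ} (hT : 2 ≤ T) (hM : M ≤ T) :
    M * 2 + (1 + M * ((T + 1) * (10 * T ^ 2 * (2 * T + 2)))) ≤ T ^ 12 := by
  have h1 : (T + 1) * (10 * T ^ 2 * (2 * T + 2)) ≤ (2 * T) * (10 * T ^ 2 * (4 * T)) := by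
    gcongr <;> omega
  have h2 : 1 ≤ T ^ 5 := Nat.one_le_pow _ _ (by omega)
  have h3 : T ≤ T ^ 5 := Nat.le_self_pow (by norm_num) T
  have h4 : 2 ^ 7 * T ^ 5 ≤ T ^ 7 * T ^ 5 := by gcongr
  calc _ ≤ T * 2 + (1 + T * ((2 * T) * (10 * T ^ 2 * (4 * T)))) := by gcongr
    _ = 2 * T + 1 + 80 * T ^ 5 := by ring
    _ ≤ 2 ^ 7 * T ^ 5 := by omega
    _ ≤ _ := by rw [← pow_add] at h4; exact h4

theorem RunsAlgorithm.support_subset {F : Forecaster} {T : ℕ} {C ι : ℝ} (hF : RunsAlgorithm T C ι F)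
    (hι : 1 ≤ ι) (hC : 0 ≤ C) {h : History} (hl : h.length < T) :
    (F h).support ⊆ Set.Icc (0 : ℝ) 1 := by
  obtain ⟨start, -, hrun⟩ := hF
  obtain ⟨h1, h2⟩ := hrun h hl
  rcases (epoch_pos h.length).eq_or_lt with he | he
  · exact h1 he.symm
  · obtain ⟨z, n, hn, -, hz⟩ := exists_chain (T := T) (C := C) (ι := ι) (by omega) hι hC
      (epoch_pos h.length) (two_pow_epoch_le hl) (prevMean_mem (epoch_pos h.length) h)
    exact fun p hp => hz.endpoints_mem_Icc hn ((h2 he).1 hp)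

theorem calibration_bounds {T : ℕ} {δ ι : ℝ} {q : ℕ → unitInterval} (hT : 2 ≤ T) (hδ0 : 0 < δ)
    (hδ1 : δ < 1) (hι : 100 * Real.log ((T : ℝ) / δ) ≤ ι) {F : Forecaster}
    (hF : RunsAlgorithm T (deviation q T) ι F) :
    ENNReal.ofReal (1 - δ) ≤ (law F q T).toOuterMeasure
      {h | pcal2 F h ≤ 2 + 600 * (ι ^ 3 + (1 + deviation q T) ^ (1 / 3 : ℝ) * ι ^ 2) ∧
        cal2 h ≤ 2 + 600 * (ι ^ 3 + (1 + deviation q T) ^ (1 / 3 : ℝ) * ι ^ 2)} := by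
  have hT' : (2 : ℝ) ≤ T := by exact_mod_cast hT
  have hTδ : (T : ℝ) ≤ T / δ := by rw [le_div_iff₀ hδ0]; nlinarith
  have hlogT : Real.log T ≤ Real.log ((T : ℝ) / δ) := Real.log_le_log (by linarith) hTδ
  have hlogT0 : 0 < Real.log T := Real.log_pos (by linarith)
  have hιT : 10 * Real.log T ≤ ι := by linarith
  obtain ⟨hlog, hMι, hQ, hι1⟩ := log_one_add_le hT hιT
  have hι2 : 2 ≤ ι := by
    have := Real.log_two_gt_d9
    have := Real.log_le_log (by norm_num) hT'
    linarith
  have hC := deviation_nonneg q T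
  have hCT := deviation_le q T
  obtain ⟨p, hp⟩ := exists_deviation_eq q T
  set C := deviation q T with hCdef
  obtain ⟨start, hstart, hrun⟩ := id hF
  have hstat : Stationary F start T C ι := fun h hl he => (hrun h hl).2 he
  set M := epoch (T - 1) with hM
  have hmT : ∀ m ∈ Finset.Icc 2 M, 2 ^ m ≤ T + 1 := fun m hm =>
    (Nat.pow_le_pow_right (by norm_num) (Finset.mem_Icc.1 hm).2).trans (two_pow_epoch_le (by omega))
  -- Three families of events, all at level `ι / 2`: the outcomes of each preceding epoch are close
  -- to their means; the noise in the total spread is small; and for every epoch, every possible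
  -- previous mean and every end point of the resulting partition, the visits are close to the
  -- weights.
  have hgood := (FailsRarely.forall (s := Finset.Icc 2 M) fun m hm =>
    failsRarely_mean (F := F) (q := q) (n := T) (ι := ι) (by linarith) (m := m - 1)
      (by have := (Finset.mem_Icc.1 hm).1; omega)).and
    ((failsRarely_tail (F := F) (q := q) (n := T) (x := ι / 2) (roundExp_outcome_le F q fun h =>
      lead F start T C ι p h / 4)).and
    (FailsRarely.forall (s := Finset.Icc 2 M) fun m hm =>
      FailsRarely.mono_right (N' := (T + 1) * (10 * T ^ 2 * (2 * T + 2)))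
      (FailsRarely.forall (s := Finset.range (2 ^ (m - 1) + 1)) fun k hk =>
      FailsRarely.mono_right (N' := 10 * T ^ 2 * (2 * T + 2))
      (FailsRarely.forall (s := endpoints (partition T C ι m ((k : ℝ) / 2 ^ (m - 1)))) fun w hw =>
        failsRarely_visits (F := F) (q := q) (n := T) (x := ι / 2) (m := m) (T := T) (p := w) ?_) ?_) ?_))
  rotate_left
  · obtain ⟨z, n, hn, -, hz⟩ := exists_chain (T := T) (C := C) (ι := ι) (m := m)
      (y := (k : ℝ) / 2 ^ (m - 1)) (by omega) hι1 hC
      (by have := (Finset.mem_Icc.1 hm).1; omega) (hmT m hm) ⟨by positivity, by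
        rw [div_le_one (by positivity)]
        exact_mod_cast Nat.lt_succ_iff.1 (Finset.mem_range.1 hk)⟩
    exact hz.endpoints_mem_Icc hn hw
  · refine Nat.mul_le_mul_right _ (endpoints_card_le hT hι1 hC hCT
      (by have := (Finset.mem_Icc.1 hm).1; omega) (hmT m hm) ⟨by positivity, ?_⟩)
    rw [div_le_one (by positivity)]
    exact_mod_cast Nat.lt_succ_iff.1 (Finset.mem_range.1 hk)
  · rw [Finset.card_range]
    refine Nat.mul_le_mul_right _ ?_
    have h1 := hmT m hm
    have h2 : 2 ^ m = 2 ^ (m - 1) * 2 := by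
      rw [← pow_succ]; congr 1; have := (Finset.mem_Icc.1 hm).1; omega
    omega
  refine hgood.le_measure ?_ fun h hh hG => ?_
  · have hcard : (Finset.Icc 2 M).card ≤ T := by
      have : M < T + 1 := by
        have := Nat.log_lt_self 2 (x := T - 1 + 2) (by omega)
        unfold M epoch; omega
      rw [Nat.card_Icc]; omega
    have h1 := union_count_le hT hcard
    -- At most `T ^ 12` events are involved, and `ι / 2 ≥ 50 log (T / δ)` leaves ample room.
    have h2 : Real.exp (-(ι / 2)) ≤ (δ / T) ^ 12 := by
      rw [show (δ / T) ^ 12 = Real.exp (-(12 * Real.log ((T : ℝ) / δ))) by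
        rw [← mul_neg, ← Real.log_inv, inv_div, mul_comm, ← Nat.cast_ofNat (R := ℝ) (n := 12), Real.exp_mul,
          Real.exp_log (by positivity), Real.rpow_natCast]]
      exact Real.exp_le_exp.2 (by linarith)
    calc _ ≤ ((T ^ 12 : ℕ) : ℝ) * (δ / T) ^ 12 := by gcongr
      _ = δ ^ 12 := by push_cast; rw [← mul_pow]; congr 1; field_simp
      _ ≤ δ := pow_le_of_le_one hδ0.le hδ1.le (by norm_num)
  obtain ⟨hG1, hG2, hG3⟩ := hG
  obtain ⟨hl, hmem⟩ := mem_support_law hh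
  have hsuf : ∀ h' x, (x :: h') <:+ h → h'.length < T := fun h' x hs => by
    have := hs.length_le
    rw [List.length_cons] at this
    omega
  have hsupp : ∀ h' x, (x :: h') <:+ h → (F h').support ⊆ Set.Icc (0 : ℝ) 1 := fun h' x hs =>
    hF.support_subset hι1 hC (hsuf h' x hs)
  have hmean : ∀ m ∈ Finset.Icc 2 M, |prevMean m h - p| ≤ radius C ι m := by
    intro m hm
    rw [← hp]
    refine abs_prevMean_sub_le (Finset.mem_Icc.1 hm).1 ?_ hl (hG1 m hm)
    rw [hl]
    exact (Finset.mem_Icc.1 hm).2.trans (epoch_mono (by omega))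
  have hpcal := sum_epochPcal_le hstat hstart hT hιT hl p.2 hp hmean (hG2.trans (by linarith))
  have hpos : 0 ≤ ι ^ 3 + (1 + C) ^ (1 / 3 : ℝ) * ι ^ 2 := by positivity
  constructor
  · have := pcal2_le hstat hl.le hsupp
    rw [hl] at this
    linarith
  · refine cal2_le_of_visitsClose hstat hT hιT hC hl hsupp hmem (x := ι / 2) (by linarith)
      (by linarith) (fun m hm w hw => ?_) hpcal
    obtain ⟨k, hk, hk'⟩ := exists_prevMean_eq (m := m) (by have := (Finset.mem_Icc.1 hm).1; omega) h
    refine hG3 m hm k hk w ?_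
    rw [← hk']
    exact hw

theorem rpow_third_one_add_le {C : ℝ} (hC : 0 ≤ C) :
    (1 + C) ^ (1 / 3 : ℝ) ≤ 1 + C ^ (1 / 3 : ℝ) := by
  have := Real.rpow_add_le_add_rpow (p := 1 / 3) zero_le_one hC (by norm_num) (by norm_num)
  rwa [Real.one_rpow] at this

/-- Passing from `(1 + C)^{1/3}` to `1 + C^{1/3}` costs an extra `ι²`, which is absorbed by `ι³`, as
is the constant `2`. -/
theorem bound_le {C ι B : ℝ} (hC : 0 ≤ C) (hι : 1 ≤ ι)
    (hB : B ≤ 2 + 600 * (ι ^ 3 + (1 + C) ^ (1 / 3 : ℝ) * ι ^ 2)) :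
    B ≤ 2000 * (ι ^ 3 + C ^ (1 / 3 : ℝ) * ι ^ 2) := by
  have h1 := rpow_third_one_add_le hC
  have h2 : 0 ≤ C ^ (1 / 3 : ℝ) := by positivity
  have h3 : (1 + C) ^ (1 / 3 : ℝ) * ι ^ 2 ≤ (1 + C ^ (1 / 3 : ℝ)) * ι ^ 2 := by gcongr
  have h4 : ι ^ 2 ≤ ι ^ 3 := pow_le_pow_right₀ hι (by norm_num)
  have h5 : 1 ≤ ι ^ 3 := one_le_pow₀ hι
  have h6 : 0 ≤ C ^ (1 / 3 : ℝ) * ι ^ 2 := by positivity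
  linarith

/-! ### Conjugate gradients and stationary distributions -/

/-- One step of the conjugate gradient method for the symmetric operator `A` on
`(approximation, residual, direction)`. -/
noncomputable def cgStep {n : Type*} [Fintype n] (A : (n → ℝ) →ₗ[ℝ] (n → ℝ))
    (s : (n → ℝ) × (n → ℝ) × (n → ℝ)) : (n → ℝ) × (n → ℝ) × (n → ℝ) :=
  let α := s.2.1 ⬝ᵥ s.2.1 / (s.2.2 ⬝ᵥ A s.2.2)
  let r := s.2.1 - α • A s.2.2
  (s.1 + α • s.2.2, r, r + (r ⬝ᵥ r / (s.2.1 ⬝ᵥ s.2.1)) • s.2.2)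

/-- The conjugate gradient iteration for `A x = 0` started at `x`. -/
noncomputable def cg {n : Type*} [Fintype n] (A : (n → ℝ) →ₗ[ℝ] (n → ℝ)) (x : n → ℝ) (k : ℕ) :
    (n → ℝ) × (n → ℝ) × (n → ℝ) :=
  (cgStep A)^[k] (x, -A x, -A x)

section
variable {n : Type*} [Fintype n] {A : (n → ℝ) →ₗ[ℝ] (n → ℝ)} {x : n → ℝ}

theorem cg_succ (k : ℕ) : cg A x (k + 1) = cgStep A (cg A x k) := by
  rw [cg, Function.iterate_succ_apply']; rfl

theorem cg_residual (k : ℕ) : (cg A x k).2.1 = -A (cg A x k).1 := by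
  induction k with
  | zero => rfl
  | succ k ih => rw [cg_succ, cgStep]; simp only [ih, map_add, map_smul]; abel

theorem cg_direction (k : ℕ) : ∃ w, (cg A x k).2.2 = A w := by
  induction k with
  | zero => exact ⟨-x, by rw [map_neg]; rfl⟩
  | succ k ih =>
    obtain ⟨w, hw⟩ := ih
    have h1 : (cg A x (k + 1)).2.2 = (cg A x (k + 1)).2.1 +
      ((cg A x (k + 1)).2.1 ⬝ᵥ (cg A x (k + 1)).2.1 / ((cg A x k).2.1 ⬝ᵥ (cg A x k).2.1)) •
        (cg A x k).2.2 := by rw [cg_succ]; rfl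
    rw [h1, cg_residual (k + 1), hw, ← map_smul, ← map_neg, ← map_add]
    exact ⟨_, rfl⟩

/-- The classical conjugacy relations, here for an operator that may be singular. The method does
not break down before the residual vanishes: a direction lies in the range of `A`, so zero energy
puts it into kernel and range at once. By symmetry it is then orthogonal to itself, contradicting
its scalar product with the residual. -/
theorem cg_orthogonal (hsymm : ∀ v w, A v ⬝ᵥ w = v ⬝ᵥ A w) (hker : ∀ v, v ⬝ᵥ A v = 0 → A v = 0)
    (k : ℕ) (hr : ∀ j ≤ k, (cg A x j).2.1 ≠ 0) :
    (∀ i < k, (cg A x k).2.1 ⬝ᵥ (cg A x i).2.1 = 0) ∧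
    (∀ i < k, (cg A x k).2.1 ⬝ᵥ (cg A x i).2.2 = 0) ∧
    (∀ i < k, (cg A x k).2.2 ⬝ᵥ A (cg A x i).2.2 = 0) ∧
    (cg A x k).2.1 ⬝ᵥ (cg A x k).2.2 = (cg A x k).2.1 ⬝ᵥ (cg A x k).2.1 ∧
    (∀ i ≤ k, (cg A x i).2.2 ⬝ᵥ A (cg A x i).2.2 ≠ 0) := by
  have hself : ∀ j ≤ k, (cg A x j).2.1 ⬝ᵥ (cg A x j).2.1 ≠ 0 := fun j hj h0 =>
    hr j hj (dotProduct_self_eq_zero.1 h0)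
  have hne : ∀ j ≤ k, (cg A x j).2.1 ⬝ᵥ (cg A x j).2.2 = (cg A x j).2.1 ⬝ᵥ (cg A x j).2.1 →
      (cg A x j).2.2 ⬝ᵥ A (cg A x j).2.2 ≠ 0 := by
    intro j hj h1 h0
    obtain ⟨w, hw⟩ := cg_direction (A := A) (x := x) j
    have h2 : (cg A x j).2.2 ⬝ᵥ (cg A x j).2.2 = 0 := by
      conv_lhs => lhs; rw [hw]
      rw [hsymm, hker _ h0, dotProduct_zero]
    rw [dotProduct_self_eq_zero.1 h2, dotProduct_zero] at h1
    exact hself j hj h1.symm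
  induction k with
  | zero =>
    have h0 : (cg A x 0).2.1 ⬝ᵥ (cg A x 0).2.2 = (cg A x 0).2.1 ⬝ᵥ (cg A x 0).2.1 := rfl
    refine ⟨fun i hi => absurd hi (Nat.not_lt_zero i), fun i hi => absurd hi (Nat.not_lt_zero i),
      fun i hi => absurd hi (Nat.not_lt_zero i), h0, fun i hi => ?_⟩
    rw [Nat.le_zero.1 hi]
    exact hne 0 le_rfl h0
  | succ k ih =>
    obtain ⟨h1, h2, h3, h4, h5⟩ := ih (fun j hj => hr j (by omega)) (fun j hj => hself j (by omega))
      fun j hj => hne j (by omega)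
    have hrec : ∀ i, (cg A x (i + 1)).2.1 = (cg A x i).2.1 -
        ((cg A x i).2.1 ⬝ᵥ (cg A x i).2.1 / ((cg A x i).2.2 ⬝ᵥ A (cg A x i).2.2)) • A (cg A x i).2.2 :=
      fun i => by rw [cg_succ]; rfl
    have hdir : ∀ i, (cg A x (i + 1)).2.2 = (cg A x (i + 1)).2.1 +
        ((cg A x (i + 1)).2.1 ⬝ᵥ (cg A x (i + 1)).2.1 / ((cg A x i).2.1 ⬝ᵥ (cg A x i).2.1)) •
          (cg A x i).2.2 := fun i => by rw [cg_succ]; rfl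
    have g2 : ∀ i < k + 1, (cg A x (k + 1)).2.1 ⬝ᵥ (cg A x i).2.2 = 0 := by
      intro i hi
      rw [hrec, sub_dotProduct, smul_dotProduct, hsymm, smul_eq_mul]
      rcases Nat.lt_succ_iff_lt_or_eq.1 hi with hik | rfl
      · rw [h2 i hik, h3 i hik, mul_zero, sub_zero]
      · rw [h4, div_mul_cancel₀ _ (h5 i le_rfl), sub_self]
    have g1 : ∀ i < k + 1, (cg A x (k + 1)).2.1 ⬝ᵥ (cg A x i).2.1 = 0 := by
      intro i hi
      rcases i with _ | i
      · exact g2 0 hi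
      · have h6 : (cg A x (i + 1)).2.1 = (cg A x (i + 1)).2.2 -
            ((cg A x (i + 1)).2.1 ⬝ᵥ (cg A x (i + 1)).2.1 / ((cg A x i).2.1 ⬝ᵥ (cg A x i).2.1)) •
              (cg A x i).2.2 := by rw [hdir]; abel
        rw [h6, dotProduct_sub, dotProduct_smul, g2 _ hi, g2 i (by omega), smul_zero, sub_zero]
    have g4 : (cg A x (k + 1)).2.1 ⬝ᵥ (cg A x (k + 1)).2.2 =
        (cg A x (k + 1)).2.1 ⬝ᵥ (cg A x (k + 1)).2.1 := by
      rw [hdir, dotProduct_add, dotProduct_smul, g2 k (by omega), smul_zero, add_zero]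
    have g3 : ∀ i < k + 1, (cg A x (k + 1)).2.2 ⬝ᵥ A (cg A x i).2.2 = 0 := by
      intro i hi
      have h6 : (cg A x (k + 1)).2.1 ⬝ᵥ (cg A x (i + 1)).2.1 = (cg A x (k + 1)).2.1 ⬝ᵥ (cg A x i).2.1 -
          ((cg A x i).2.1 ⬝ᵥ (cg A x i).2.1 / ((cg A x i).2.2 ⬝ᵥ A (cg A x i).2.2)) *
            ((cg A x (k + 1)).2.1 ⬝ᵥ A (cg A x i).2.2) := by
        rw [hrec i, dotProduct_sub, dotProduct_smul, smul_eq_mul]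
      have h7 := hself i (by omega)
      have h8 := h5 i (by omega)
      rw [g1 i hi, zero_sub] at h6
      rw [hdir, add_dotProduct, smul_dotProduct, smul_eq_mul]
      rcases Nat.lt_succ_iff_lt_or_eq.1 hi with hik | rfl
      · rw [g1 (i + 1) (by omega), eq_comm, neg_eq_zero] at h6
        rw [(mul_eq_zero.1 h6).resolve_left (div_ne_zero h7 h8), h3 i hik, mul_zero, add_zero]
      · rw [h6]
        field_simp
        ring
    refine ⟨g1, g2, g3, g4, fun i hi => ?_⟩
    rcases Nat.le_succ_iff.1 hi with hik | rfl
    · exact h5 i hik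
    · exact hne _ le_rfl g4

/-- Otherwise there would be `card n + 1` nonzero pairwise orthogonal residuals. Once a residual is
`0` the later ones are too, as all quotients then have numerator `0`; a fixed number of iterations
is therefore safe. -/
theorem cg_residual_eq_zero (hsymm : ∀ v w, A v ⬝ᵥ w = v ⬝ᵥ A w)
    (hker : ∀ v, v ⬝ᵥ A v = 0 → A v = 0) : (cg A x (Fintype.card n)).2.1 = 0 := by
  have hmono : ∀ j k, j ≤ k → (cg A x j).2.1 = 0 → (cg A x k).2.1 = 0 := by
    intro j k hjk h0
    induction k, hjk using Nat.le_induction with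
    | base => exact h0
    | succ k _ ih => rw [cg_succ, cgStep]; simp [ih]
  by_contra hne
  have hr : ∀ j ≤ Fintype.card n, (cg A x j).2.1 ≠ 0 := fun j hj h0 => hne (hmono j _ hj h0)
  have horth : ∀ i j, i ≤ Fintype.card n → j ≤ Fintype.card n → i ≠ j →
      (cg A x i).2.1 ⬝ᵥ (cg A x j).2.1 = 0 := by
    intro i j hi hj hij
    rcases lt_or_gt_of_ne hij with hlt | hlt
    · rw [dotProduct_comm]
      exact (cg_orthogonal hsymm hker j fun l hl => hr l (hl.trans hj)).1 i hlt
    · exact (cg_orthogonal hsymm hker i fun l hl => hr l (hl.trans hi)).1 j hlt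
  have hli : LinearIndependent ℝ fun i : Fin (Fintype.card n + 1) => (cg A x i).2.1 := by
    rw [Fintype.linearIndependent_iff]
    intro g hg i
    have h1 := congrArg (· ⬝ᵥ (cg A x i).2.1) hg
    simp only [sum_dotProduct, smul_dotProduct, zero_dotProduct] at h1
    rw [Finset.sum_eq_single i] at h1
    · refine (smul_eq_zero.1 h1).resolve_right fun h0 => ?_
      exact hr i (Nat.lt_succ_iff.1 i.2) (dotProduct_self_eq_zero.1 h0)
    · intro j _ hji
      rw [horth j i (Nat.lt_succ_iff.1 j.2) (Nat.lt_succ_iff.1 i.2) (fun h => hji (Fin.ext h)), smul_zero]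
    · intro hi; exact absurd (Finset.mem_univ i) hi
  have := hli.fintype_card_le_finrank
  rw [Fintype.card_fin, Module.finrank_fintype_fun_eq_card] at this
  omega

/-- All directions lie in the range of `A`, which is orthogonal to its kernel, so the iterates keep
the kernel component of the starting vector. This prevents the limit from being `0`. -/
theorem dotProduct_cg (hsymm : ∀ v w, A v ⬝ᵥ w = v ⬝ᵥ A w) {π : n → ℝ} (hπ : A π = 0) (k : ℕ) :
    π ⬝ᵥ (cg A x k).1 = π ⬝ᵥ x := by
  induction k with
  | zero => rfl
  | succ k ih =>
    obtain ⟨w, hw⟩ := cg_direction (A := A) (x := x) k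
    rw [cg_succ, cgStep]
    simp only
    have h1 : π ⬝ᵥ (cg A x k).2.2 = 0 := by rw [hw, ← hsymm, hπ, zero_dotProduct]
    rw [dotProduct_add, dotProduct_smul, ih, h1, smul_zero, add_zero]

/-- The triangle inequality gives `≤` in each coordinate, and the sums over all coordinates agree
because the rows sum to `1`. So signs can be dropped from any fixed vector. -/
theorem abs_vecMul_eq {Q : Matrix n n ℝ} (h0 : ∀ i j, 0 ≤ Q i j) (h1 : ∀ i, ∑ j, Q i j = 1)
    {x : n → ℝ} (hx : ∀ j, x j = ∑ i, x i * Q i j) (j : n) : |x j| = ∑ i, |x i| * Q i j := by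
  have hle : ∀ j ∈ Finset.univ, |x j| ≤ ∑ i, |x i| * Q i j := fun j _ => by
    conv_lhs => rw [hx j]
    refine (Finset.abs_sum_le_sum_abs _ _).trans (le_of_eq (Finset.sum_congr rfl fun i _ => ?_))
    rw [abs_mul, abs_of_nonneg (h0 i j)]
  refine (Finset.sum_eq_sum_iff_of_le hle).1 ?_ j (Finset.mem_univ j)
  rw [Finset.sum_comm]
  exact Finset.sum_congr rfl fun i _ => by rw [← Finset.mul_sum, h1, mul_one]

variable [DecidableEq n]

/-- The operator `v ↦ M (Mᵀ v)` with `M = 1 - Q`. -/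
noncomputable def gramOp (Q : Matrix n n ℝ) : (n → ℝ) →ₗ[ℝ] (n → ℝ) :=
  (Matrix.mulVecLin (1 - Q)).comp (Matrix.mulVecLin (1 - Q).transpose)

theorem gramOp_apply (Q : Matrix n n ℝ) (v : n → ℝ) :
    gramOp Q v = Matrix.mulVec (1 - Q) (Matrix.vecMul v (1 - Q)) := by
  rw [gramOp, LinearMap.comp_apply, Matrix.mulVecLin_apply, Matrix.mulVecLin_apply,
    Matrix.mulVec_transpose]

theorem dotProduct_gramOp (Q : Matrix n n ℝ) (v w : n → ℝ) :
    v ⬝ᵥ gramOp Q w = Matrix.vecMul v (1 - Q) ⬝ᵥ Matrix.vecMul w (1 - Q) := by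
  rw [gramOp_apply, Matrix.dotProduct_mulVec]

/-- Conjugate gradients, started at the constant vector, find a nonzero left fixed vector of a
row-stochastic matrix. -/
theorem cg_stationary {Q : Matrix n n ℝ} (h0 : ∀ i j, 0 ≤ Q i j) (h1 : ∀ i, ∑ j, Q i j = 1)
    [Nonempty n] {x : n → ℝ} (hx : x = (cg (gramOp Q) 1 (Fintype.card n)).1) :
    0 < ∑ i, |x i| ∧ ∀ j, |x j| / ∑ i, |x i| = ∑ s, |x s| / (∑ i, |x i|) * Q s j := by
  have hsymm : ∀ v w, gramOp Q v ⬝ᵥ w = v ⬝ᵥ gramOp Q w := fun v w => by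
    rw [dotProduct_comm, dotProduct_gramOp, dotProduct_gramOp, dotProduct_comm]
  have hker' : ∀ v, v ⬝ᵥ gramOp Q v = 0 → Matrix.vecMul v (1 - Q) = 0 := fun v hv => by
    rw [dotProduct_gramOp] at hv; exact dotProduct_self_eq_zero.1 hv
  have hker : ∀ v, v ⬝ᵥ gramOp Q v = 0 → gramOp Q v = 0 := fun v hv => by
    rw [gramOp_apply, hker' v hv, Matrix.mulVec_zero]
  have hfix : ∀ v, Matrix.vecMul v (1 - Q) = 0 → ∀ j, v j = ∑ i, v i * Q i j := fun v hv j => by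
    have := congrFun hv j
    rw [Matrix.vecMul_sub, Matrix.vecMul_one, Pi.sub_apply, Pi.zero_apply, sub_eq_zero] at this
    exact this
  have hres := cg_residual_eq_zero (x := 1) hsymm hker
  rw [cg_residual, ← hx, neg_eq_zero] at hres
  have hxfix := hfix x (hker' x (by rw [hres, dotProduct_zero]))
  -- The matrix `1 - Q` kills the constant vector and so has a nonzero left kernel vector `v`. Then
  -- `|v|` is in the kernel of the Gram operator as well, and `|v| ⬝ᵥ x = |v| ⬝ᵥ 1 > 0`.
  have hxne : x ≠ 0 := by
    have hsing : (1 - Q).det = 0 := by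
      refine Matrix.exists_mulVec_eq_zero_iff.1 ⟨1, one_ne_zero, ?_⟩
      ext i
      rw [Matrix.sub_mulVec, Matrix.one_mulVec]
      show (1 : ℝ) - ∑ j, Q i j * 1 = 0
      simp [h1]
    obtain ⟨v, hv0, hv⟩ := Matrix.exists_vecMul_eq_zero_iff.2 hsing
    have hpi : Matrix.vecMul (fun j => |v j|) (1 - Q) = 0 := by
      ext j
      rw [Matrix.vecMul_sub, Matrix.vecMul_one, Pi.sub_apply, Pi.zero_apply, sub_eq_zero]
      exact abs_vecMul_eq h0 h1 (hfix v hv) j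
    have hA : gramOp Q (fun j => |v j|) = 0 := by rw [gramOp_apply, hpi, Matrix.mulVec_zero]
    have hdot := dotProduct_cg (x := 1) hsymm hA (Fintype.card n)
    rw [← hx] at hdot
    intro hx0
    rw [hx0, dotProduct_zero, dotProduct_one] at hdot
    have hz := (Finset.sum_eq_zero_iff_of_nonneg fun j _ => abs_nonneg (v j)).1 hdot.symm
    exact hv0 (funext fun j => abs_eq_zero.1 (hz j (Finset.mem_univ j)))
  have hpos : 0 < ∑ i, |x i| := by
    obtain ⟨i, hi⟩ := Function.ne_iff.1 hxne
    exact Finset.sum_pos' (fun i _ => abs_nonneg _) ⟨i, Finset.mem_univ i, abs_pos.2 hi⟩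
  refine ⟨hpos, fun j => ?_⟩
  rw [abs_vecMul_eq h0 h1 hxfix j, Finset.sum_div]
  exact Finset.sum_congr rfl fun i _ => by ring

end

/-! ### Reasoning about programs -/

@[simp] theorem Store.setNat_real (σ : Store) (a i v : ℕ) : (σ.setNat a i v).real = σ.real := rfl

@[simp] theorem Store.setReal_nat (σ : Store) (a i : ℕ) (v : ℝ) : (σ.setReal a i v).nat = σ.nat := rfl

@[simp] theorem Store.setNat_nat_self (σ : Store) (a i v : ℕ) :
    (σ.setNat a i v).nat a = Function.update (σ.nat a) i v := by simp [Store.setNat]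

@[simp] theorem Store.setReal_real_self (σ : Store) (a i : ℕ) (v : ℝ) :
    (σ.setReal a i v).real a = Function.update (σ.real a) i v := by simp [Store.setReal]

@[simp] theorem Store.setNat_nat_ne (σ : Store) {a b : ℕ} (h : b ≠ a) (i v : ℕ) :
    (σ.setNat a i v).nat b = σ.nat b := by simp [Store.setNat, h]

@[simp] theorem Store.setReal_real_ne (σ : Store) {a b : ℕ} (h : b ≠ a) (i : ℕ) (v : ℝ) :
    (σ.setReal a i v).real b = σ.real b := by simp [Store.setReal, h]

namespace Prog

/-- Whether the program has an assignment to the integer array `a`. -/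
def writesNat (a : ℕ) : Prog → Bool
  | skip => false
  | setNat b _ _ => a == b
  | setReal _ _ _ => false
  | setCeil b _ _ => a == b
  | seq s t => s.writesNat a || t.writesNat a
  | ite _ s t => s.writesNat a || t.writesNat a
  | loop _ s => s.writesNat a

/-- Whether the program has an assignment to the real array `a`. -/
def writesReal (a : ℕ) : Prog → Bool
  | skip => false
  | setNat _ _ _ => false
  | setReal b _ _ => a == b
  | setCeil _ _ _ => false
  | seq s t => s.writesReal a || t.writesReal a
  | ite _ s t => s.writesReal a || t.writesReal a
  | loop _ s => s.writesReal a

/-- Nesting depth of the loops, with roundings counted as loops. -/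
def depth : Prog → ℕ
  | skip => 0
  | setNat _ _ _ => 0
  | setReal _ _ _ => 0
  | setCeil _ _ _ => 1
  | seq s t => max s.depth t.depth
  | ite _ s t => max s.depth t.depth
  | loop _ s => s.depth + 1

/-- If every loop is executed at most `B` times and no rounded number exceeds `B`, then the number
of steps is at most `weight * (B + 1) ^ depth`. -/
def weight : Prog → ℕ
  | skip => 0
  | setNat _ i e => i.cost + e.cost + 1
  | setReal _ i e => i.cost + e.cost + 1
  | setCeil _ i e => i.cost + e.cost + 2
  | seq s t => s.weight + t.weight
  | ite b s t => b.cost + 1 + (s.weight + t.weight)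
  | loop e s => e.cost + 2 + s.weight

end Prog

/-- The stores agree on the arrays to which the program has no assignment. -/
structure Frame (p : Prog) (σ τ : Store) : Prop where
  nat : ∀ a, p.writesNat a = false → τ.nat a = σ.nat a
  real : ∀ a, p.writesReal a = false → τ.real a = σ.real a

theorem Frame.refl (p : Prog) (σ : Store) : Frame p σ σ := ⟨fun _ _ => rfl, fun _ _ => rfl⟩

theorem Frame.trans {p : Prog} {σ τ υ : Store} (h : Frame p σ τ) (h' : Frame p τ υ) : Frame p σ υ :=
  ⟨fun a ha => (h'.nat a ha).trans (h.nat a ha), fun a ha => (h'.real a ha).trans (h.real a ha)⟩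

theorem Frame.mono {p p' : Prog} {σ τ : Store} (h : Frame p σ τ)
    (hn : ∀ a, p'.writesNat a = false → p.writesNat a = false)
    (hr : ∀ a, p'.writesReal a = false → p.writesReal a = false) : Frame p' σ τ :=
  ⟨fun a ha => h.nat a (hn a ha), fun a ha => h.real a (hr a ha)⟩

/-- Arrays without an assignment in the program keep their contents. Absence of an assignment is a
computation on the syntax, so correctness proofs can carry such facts along with `rfl`. -/
theorem frame_run (p : Prog) : ∀ σ, Frame p σ (p.run σ).1 := by
  induction p with
  | skip => exact fun σ => Frame.refl _ σ
  | setNat b i e =>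
    exact fun σ => ⟨fun a ha => Store.setNat_nat_ne _ (by simpa [Prog.writesNat] using ha) _ _,
      fun a _ => rfl⟩
  | setReal b i e =>
    exact fun σ => ⟨fun a _ => rfl,
      fun a ha => Store.setReal_real_ne _ (by simpa [Prog.writesReal] using ha) _ _⟩
  | setCeil b i e =>
    exact fun σ => ⟨fun a ha => Store.setNat_nat_ne _ (by simpa [Prog.writesNat] using ha) _ _,
      fun a _ => rfl⟩
  | seq s t ihs iht =>
    intro σ
    refine ((ihs σ).mono ?_ ?_).trans ((iht (s.run σ).1).mono ?_ ?_) <;>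
      simp +contextual [Prog.writesNat, Prog.writesReal]
  | ite b s t ihs iht =>
    intro σ
    simp only [Prog.run]
    split_ifs
    · exact (ihs σ).mono (by simp +contextual [Prog.writesNat]) (by simp +contextual [Prog.writesReal])
    · exact (iht σ).mono (by simp +contextual [Prog.writesNat]) (by simp +contextual [Prog.writesReal])
  | loop e s ihs =>
    intro σ
    simp only [Prog.run]
    have : ∀ k (p : Store × ℕ), Frame s p.1
        ((fun p : Store × ℕ => ((s.run p.1).1, p.2 + (s.run p.1).2 + 1))^[k] p).1 := by
      intro k
      induction k with
      | zero => exact fun p => Frame.refl _ _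
      | succ k ih =>
        intro p
        rw [Function.iterate_succ_apply']
        exact (ih p).trans (ihs _)
    have h := this (e.eval σ) (σ, e.cost + 1)
    exact ⟨h.nat, h.real⟩

/-- The program ends in a store that satisfies `Q`, and its number of steps obeys the bound for
loops of length at most `B`. -/
def Ok (B : ℕ) (p : Prog) (σ : Store) (Q : Store → Prop) : Prop :=
  Q (p.run σ).1 ∧ (p.run σ).2 ≤ p.weight * (B + 1) ^ p.depth

section
variable {B : ℕ} {σ : Store} {Q : Store → Prop}

theorem Ok.mono {p : Prog} {Q' : Store → Prop} (h : Ok B p σ Q)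
    (H : ∀ τ, Frame p σ τ → Q τ → Q' τ) : Ok B p σ Q' :=
  ⟨H _ (frame_run p σ) h.1, h.2⟩

theorem Ok.skip (h : Q σ) : Ok B .skip σ Q := ⟨h, by simp [Prog.run]⟩

theorem Ok.setNat {a : ℕ} {i e : NExp} (h : Q (σ.setNat a (i.eval σ) (e.eval σ))) :
    Ok B (.setNat a i e) σ Q := ⟨h, by simp [Prog.run, Prog.weight, Prog.depth]⟩

theorem Ok.setReal {a : ℕ} {i : NExp} {e : RExp} (h : Q (σ.setReal a (i.eval σ) (e.eval σ))) :
    Ok B (.setReal a i e) σ Q := ⟨h, by simp [Prog.run, Prog.weight, Prog.depth]⟩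

theorem Ok.setCeil {a : ℕ} {i : NExp} {e : RExp} (hB : ⌈e.eval σ⌉₊ ≤ B)
    (h : Q (σ.setNat a (i.eval σ) ⌈e.eval σ⌉₊)) : Ok B (.setCeil a i e) σ Q := by
  refine ⟨h, ?_⟩
  simp only [Prog.run, Prog.weight, Prog.depth, pow_one]
  nlinarith [Nat.zero_le (i.cost + e.cost)]

theorem Ok.seq {s t : Prog} {R : Store → Prop} (hs : Ok B s σ R)
    (ht : ∀ τ, Frame s σ τ → R τ → Ok B t τ Q) : Ok B (.seq s t) σ Q := by
  have h2 := ht _ (frame_run s σ) hs.1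
  refine ⟨h2.1, ?_⟩
  simp only [Prog.run, Prog.weight, Prog.depth, add_mul]
  refine Nat.add_le_add (hs.2.trans ?_) (h2.2.trans ?_)
  · exact Nat.mul_le_mul_left _ (Nat.pow_le_pow_right (by omega) (le_max_left _ _))
  · exact Nat.mul_le_mul_left _ (Nat.pow_le_pow_right (by omega) (le_max_right _ _))

theorem Ok.ite {b : Test} {s t : Prog} (hs : b.Holds σ → Ok B s σ Q) (ht : ¬ b.Holds σ → Ok B t σ Q) :
    Ok B (.ite b s t) σ Q := by
  have h1 : 1 ≤ (B + 1) ^ max s.depth t.depth := Nat.one_le_pow _ _ (by omega)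
  have h2 : b.cost + 1 ≤ (b.cost + 1) * (B + 1) ^ max s.depth t.depth := Nat.le_mul_of_pos_right _ h1
  by_cases hb : b.Holds σ
  · obtain ⟨hq, hc⟩ := hs hb
    refine ⟨by simpa [Prog.run, hb] using hq, ?_⟩
    simp only [Prog.run, if_pos hb, Prog.weight, Prog.depth]
    have h3 := hc.trans (Nat.mul_le_mul_left s.weight
      (Nat.pow_le_pow_right (n := B + 1) (by omega) (le_max_left s.depth t.depth)))
    nlinarith [Nat.zero_le (t.weight * (B + 1) ^ max s.depth t.depth)]
  · obtain ⟨hq, hc⟩ := ht hb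
    refine ⟨by simpa [Prog.run, hb] using hq, ?_⟩
    simp only [Prog.run, if_neg hb, Prog.weight, Prog.depth]
    have h3 := hc.trans (Nat.mul_le_mul_left t.weight
      (Nat.pow_le_pow_right (n := B + 1) (by omega) (le_max_right s.depth t.depth)))
    nlinarith [Nat.zero_le (s.weight * (B + 1) ^ max s.depth t.depth)]

/-- `I k` is the invariant after `k` passes. Charging `B + 1` for at most `B` passes leaves room for
evaluating the bound and for the unit cost of each pass. -/
theorem Ok.loop {e : NExp} {s : Prog} {n : ℕ} (I : ℕ → Store → Prop) (hn : e.eval σ = n) (hB : n ≤ B)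
    (h0 : I 0 σ) (hs : ∀ k < n, ∀ τ, Frame s σ τ → I k τ → Ok B s τ (I (k + 1)))
    (hQ : ∀ τ, Frame s σ τ → I n τ → Q τ) : Ok B (.loop e s) σ Q := by
  subst hn
  set g := fun p : Store × ℕ => ((s.run p.1).1, p.2 + (s.run p.1).2 + 1) with hg
  have key : ∀ k ≤ e.eval σ, Frame s σ (g^[k] (σ, e.cost + 1)).1 ∧ I k (g^[k] (σ, e.cost + 1)).1 ∧
      (g^[k] (σ, e.cost + 1)).2 ≤ e.cost + 1 + k * (s.weight * (B + 1) ^ s.depth + 1) := by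
    intro k
    induction k with
    | zero => exact fun _ => ⟨Frame.refl _ _, h0, by simp⟩
    | succ k ih =>
      intro hk
      obtain ⟨h1, h2, h3⟩ := ih (by omega)
      have h4 := hs k (by omega) _ h1 h2
      rw [Function.iterate_succ_apply']
      refine ⟨h1.trans (frame_run s _), h4.1, ?_⟩
      have h5 := h4.2
      simp only [hg] at h3 h5 ⊢
      rw [add_mul, one_mul]
      omega
  obtain ⟨h1, h2, h3⟩ := key _ le_rfl
  refine ⟨hQ _ h1 h2, h3.trans ?_⟩
  simp only [Prog.weight, Prog.depth]
  have hX : 1 ≤ (B + 1) ^ s.depth := Nat.one_le_pow _ _ (by omega)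
  rw [pow_succ]
  set X := (B + 1) ^ s.depth
  calc e.cost + 1 + e.eval σ * (s.weight * X + 1)
      ≤ (e.cost + 1) * (X * (B + 1)) + (B + 1) * (s.weight * X + X) := by
        gcongr
        · exact Nat.le_mul_of_pos_right _ (by positivity)
        · omega
    _ = _ := by ring

/-- `for c < e do s`, with the integer array `c` as counter. -/
def Prog.for (c : ℕ) (e : NExp) (s : Prog) : Prog :=
  .seq (.setNat c (.const 0) (.const 0))
    (.loop e (.seq s (.setNat c (.const 0) (.add (.get c (.const 0)) (.const 1)))))

/-- The body must not write the counter, and it has to establish the invariant for the store in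
which the counter has already been advanced. -/
theorem Ok.for {c : ℕ} {e : NExp} {s : Prog} {n : ℕ} (I : ℕ → Store → Prop)
    (hc : s.writesNat c = false) (hn : e.eval (σ.setNat c 0 0) = n) (hB : n ≤ B)
    (h0 : I 0 (σ.setNat c 0 0))
    (hs : ∀ k < n, ∀ τ, Frame (.for c e s) σ τ → τ.nat c 0 = k → I k τ →
      Ok B s τ fun υ => I (k + 1) (υ.setNat c 0 (k + 1)))
    (hQ : ∀ τ, Frame (.for c e s) σ τ → I n τ → Q τ) : Ok B (.for c e s) σ Q := by
  have hfr : ∀ τ, Frame (.seq s (.setNat c (.const 0) (.add (.get c (.const 0)) (.const 1))))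
      (σ.setNat c 0 0) τ → Frame (.for c e s) σ τ := by
    intro τ hτ
    refine ((frame_run (.setNat c (.const 0) (.const 0)) σ).mono ?_ ?_).trans (hτ.mono ?_ ?_) <;>
      simp +contextual [Prog.for, Prog.writesNat, Prog.writesReal]
  refine Ok.seq (R := fun τ => τ = σ.setNat c 0 0) (Ok.setNat rfl) fun τ _ hτ => ?_
  subst hτ
  refine Ok.loop (fun k τ => τ.nat c 0 = k ∧ I k τ) hn hB ⟨by simp, h0⟩
    (fun k hk τ hτ hI => ?_) fun τ hτ hI => hQ τ (hfr τ hτ) hI.2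
  refine Ok.seq (hs k hk τ (hfr τ hτ) hI.1 hI.2) fun υ hυ hI' => Ok.setNat ?_
  have h1 : υ.nat c 0 = k := by rw [hυ.nat c hc]; exact hI.1
  simp only [NExp.eval, h1]
  exact ⟨by simp, hI'⟩

/-- The sequence that agrees with `f` before `k` and with `g` from `k` on. -/
def splice (k : ℕ) (f g : ℕ → ℝ) (i : ℕ) : ℝ := if i < k then f i else g i

@[simp] theorem splice_zero (f g : ℕ → ℝ) : splice 0 f g = g := rfl

@[simp] theorem splice_self (k : ℕ) (f g : ℕ → ℝ) : splice k f g k = g k := if_neg (lt_irrefl k)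

theorem splice_of_lt {k i : ℕ} (h : i < k) (f g : ℕ → ℝ) : splice k f g i = f i := if_pos h

theorem update_splice (k : ℕ) (f g : ℕ → ℝ) :
    Function.update (splice k f g) k (f k) = splice (k + 1) f g := by
  ext i
  rcases lt_trichotomy i k with h | rfl | h
  · rw [Function.update_of_ne h.ne, splice_of_lt h, splice_of_lt (by omega)]
  · rw [Function.update_self, splice_of_lt (by omega)]
  · rw [Function.update_of_ne h.ne', splice, splice, if_neg (by omega), if_neg (by omega)]

/-- A loop that sets the entries of one real array. -/
theorem Ok.forSet {c a : ℕ} {e : NExp} {ex : RExp} {n : ℕ} (f : ℕ → ℝ)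
    (hn : e.eval (σ.setNat c 0 0) = n) (hB : n ≤ B)
    (hf : ∀ k < n, ∀ τ, Frame (.for c e (.setReal a (.get c (.const 0)) ex)) σ τ → τ.nat c 0 = k →
      τ.real a = splice k f (σ.real a) → ex.eval τ = f k)
    (hQ : ∀ τ, Frame (.for c e (.setReal a (.get c (.const 0)) ex)) σ τ →
      τ.real a = splice n f (σ.real a) → Q τ) :
    Ok B (.for c e (.setReal a (.get c (.const 0)) ex)) σ Q := by
  refine Ok.for (fun k τ => τ.real a = splice k f (σ.real a)) rfl hn hB (by simp)
    (fun k hk τ hτ hc hI => Ok.setReal ?_) hQ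
  simp only [NExp.eval, hc, Store.setNat_real, Store.setReal_real_self]
  rw [hf k hk τ hτ hc hI, hI, update_splice]

/-- A loop that adds up numbers in entry `0` of one real array. -/
theorem Ok.forSum {c a : ℕ} {e : NExp} {ex : RExp} {n : ℕ} (f : ℕ → ℝ)
    (hn : e.eval (σ.setNat c 0 0) = n) (hB : n ≤ B) (h0 : σ.real a 0 = 0)
    (hf : ∀ k < n, ∀ τ, Frame (.for c e (.setReal a (.const 0) (.add (.get a (.const 0)) ex))) σ τ →
      τ.nat c 0 = k → ex.eval τ = f k)
    (hQ : ∀ τ, Frame (.for c e (.setReal a (.const 0) (.add (.get a (.const 0)) ex))) σ τ →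
      τ.real a 0 = ∑ i ∈ Finset.range n, f i → Q τ) :
    Ok B (.for c e (.setReal a (.const 0) (.add (.get a (.const 0)) ex))) σ Q := by
  refine Ok.for (fun k τ => τ.real a 0 = ∑ i ∈ Finset.range k, f i) rfl hn hB (by simpa using h0)
    (fun k hk τ hτ hc hI => Ok.setReal ?_) hQ
  simp only [NExp.eval, RExp.eval, Store.setNat_real, Store.setReal_real_self, Function.update_self]
  rw [hf k hk τ hτ hc, hI, Finset.sum_range_succ]

end

/-! ### Expressions for the absolute value and for clipping -/

/-- Expressions of the machine contain no case distinction; the square root of a square supplies the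
absolute value, and from it the maximum and minimum needed for clipping. -/
theorem abs_eq_rpow (x : ℝ) : (x * x) ^ (1 / 2 : ℝ) = |x| := by
  rw [← Real.sqrt_eq_rpow, Real.sqrt_mul_self_eq_abs]

/-- `|e|`, computed as the square root of `e * e`. -/
def RExp.abs (e : RExp) : RExp := .pow (.mul e e) (.div (.ofNat (.const 1)) (.ofNat (.const 2)))

theorem RExp.eval_abs (e : RExp) (σ : Store) : e.abs.eval σ = |e.eval σ| := by
  simp only [RExp.abs, RExp.eval, NExp.eval, Nat.cast_one, Nat.cast_ofNat, abs_eq_rpow]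

/-- `Clip_{[0,1]}` of an expression. -/
def RExp.clip (e : RExp) : RExp :=
  let f : RExp := .div (.add e e.abs) (.ofNat (.const 2))
  .div (.sub (.add f (.ofNat (.const 1))) (RExp.abs (.sub f (.ofNat (.const 1))))) (.ofNat (.const 2))

theorem RExp.eval_clip (e : RExp) (σ : Store) : e.clip.eval σ = Calib.clip (e.eval σ) := by
  have h1 : ∀ x : ℝ, (x + |x|) / 2 = max x 0 := fun x => by
    rcases le_total 0 x with h | h
    · rw [abs_of_nonneg h, max_eq_left h]; ring
    · rw [abs_of_nonpos h, max_eq_right h]; ring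
  have h2 : ∀ x : ℝ, (x + 1 - |x - 1|) / 2 = min x 1 := fun x => by
    rcases le_total 1 x with h | h
    · rw [abs_of_nonneg (by linarith), min_eq_right h]; ring
    · rw [abs_of_nonpos (by linarith), min_eq_left h]; ring
  simp only [RExp.clip, RExp.eval, RExp.eval_abs, NExp.eval, Nat.cast_one, Nat.cast_ofNat, h1, h2]
  rfl

/-! ### The program: observing an outcome and starting an epoch

Integer arrays: `0` horizon, `1` newest outcome, `2` number of points, `3` rounds played, `4` first
round of the next epoch, `5` epoch, `7` and `8` loop counters, `9` index of the interval that
contains the action of a point, `10` largest band index, `11` and `13` numbers of intervals of a band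
and of the inner region, `12` number of intervals to be appended.
Real arrays: `0` parameters `C` and `ι`, `1` points, `2` probabilities, `3` actions, `4` accumulated
weights, `5` sum of the outcomes of the epoch, `6` radius, `7` and `8` end points of the interval to
be cut, `9` relative position of the action in its interval, `10` approximate fixed vector, `11` residual,
`12` direction, `13` and `14` its images, `15` to `17` scalar products, `18` and `19` end points of
the inner region, `20` average outcome. -/

/-- Entry `0` of an integer array. -/
abbrev NExp.cell (a : ℕ) : NExp := .get a (.const 0)

/-- Entry `0` of a real array. -/
abbrev RExp.cell (a : ℕ) : RExp := .get a (.const 0)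

/-- A numeral. -/
abbrev RExp.num (c : ℕ) : RExp := .ofNat (.const c)

/-- Adds the probabilities to the accumulated weights. -/
def observeWeights : Prog :=
  .for 7 (.cell 2) (.setReal 4 (.cell 7) (.add (.get 4 (.cell 7)) (.get 2 (.cell 7))))

/-- Gradient descent step of all instances. -/
def observeActions : Prog :=
  .for 7 (.cell 2) (.setReal 3 (.cell 7) (.clip (.sub (.get 3 (.cell 7))
    (.mul (.div (.num 1) (.mul (.num 2) (.get 4 (.cell 7))))
      (.mul (.mul (.num 2) (.get 2 (.cell 7))) (.sub (.get 3 (.cell 7)) (.ofNat (.cell 1))))))))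

/-- Updates the state with the newest outcome. -/
def observe : Prog :=
  .seq observeWeights (.seq observeActions
    (.setReal 5 (.const 0) (.add (.cell 5) (.ofNat (.cell 1)))))

section
variable {B : ℕ} {σ : Store} {Q : Store → Prop}

/-- Weights are updated before actions, so the step size includes the current round. Division by
zero follows the same convention as in `ogd`, so both agree also while an instance has no weight. -/
theorem observe_ok (hB : σ.nat 2 0 ≤ B) :
    Ok B observe σ fun τ => τ.real 5 0 = σ.real 5 0 + σ.nat 1 0 ∧
      ∀ i < σ.nat 2 0, τ.real 4 i = σ.real 4 i + σ.real 2 i ∧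
        τ.real 3 i = clip (σ.real 3 i - 1 / (2 * (σ.real 4 i + σ.real 2 i)) *
          (2 * σ.real 2 i * (σ.real 3 i - σ.nat 1 0))) := by
  refine Ok.seq (R := fun τ => ∀ i < σ.nat 2 0, τ.real 4 i = σ.real 4 i + σ.real 2 i)
    (Ok.forSet (fun i => σ.real 4 i + σ.real 2 i) (by simp [NExp.eval]) hB
      (fun k hk τ hτ hc hI => by
        simp only [RExp.eval, NExp.eval, hc, hI, splice_self, hτ.real 2 rfl])
      fun τ hτ hI i hi => by rw [hI, splice_of_lt hi]) fun τ hτ h4 => ?_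
  have e2 : τ.nat 2 = σ.nat 2 := hτ.nat 2 rfl
  have e1 : τ.nat 1 = σ.nat 1 := hτ.nat 1 rfl
  have e3 : τ.real 3 = σ.real 3 := hτ.real 3 rfl
  have e4 : τ.real 2 = σ.real 2 := hτ.real 2 rfl
  have e5 : τ.real 5 = σ.real 5 := hτ.real 5 rfl
  refine Ok.seq (R := fun υ => υ.real 5 = σ.real 5 ∧ υ.nat 1 = σ.nat 1 ∧ ∀ i < σ.nat 2 0,
      υ.real 4 i = σ.real 4 i + σ.real 2 i ∧
      υ.real 3 i = clip (σ.real 3 i - 1 / (2 * (σ.real 4 i + σ.real 2 i)) *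
          (2 * σ.real 2 i * (σ.real 3 i - σ.nat 1 0))))
    (Ok.forSet (fun i => clip (σ.real 3 i - 1 / (2 * (σ.real 4 i + σ.real 2 i)) *
          (2 * σ.real 2 i * (σ.real 3 i - σ.nat 1 0)))) (n := σ.nat 2 0) (by simp [NExp.eval, e2]) hB
      (fun k hk υ hυ hc hI => by
        simp only [RExp.eval_clip, RExp.eval, NExp.eval, hc, hI, splice_self, hυ.real 2 rfl,
          hυ.real 4 rfl, hυ.nat 1 rfl, h4 k hk, e1, e3, e4, Nat.cast_one, Nat.cast_ofNat])
      fun υ hυ hI => ⟨(hυ.real 5 rfl).trans e5, (hυ.nat 1 rfl).trans e1, fun i hi =>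
        ⟨by rw [hυ.real 4 rfl, h4 i hi], by rw [hI, splice_of_lt hi]⟩⟩) fun υ _ hυ => ?_
  obtain ⟨h5, h1, h6⟩ := hυ
  refine Ok.setReal ⟨by simp [RExp.eval, NExp.eval, h5, h1], fun i hi => ?_⟩
  simpa using h6 i hi

/-- `2 ^ (m - 1)` for the current epoch `m`. -/
def RExp.prevLength : RExp := .pow (.num 2) (.ofNat (.sub (.cell 5) (.const 1)))

/-- Computes the parameters of a new epoch. -/
def setParameters : Prog :=
  .seq (.setNat 5 (.const 0) (.add (.cell 5) (.const 1))) <|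
  .seq (.setNat 4 (.const 0) (.add (.add (.cell 4) (.cell 4)) (.const 2))) <|
  .seq (.setReal 20 (.const 0) (.div (.cell 5) .prevLength)) <|
  .seq (.setReal 5 (.const 0) (.num 0)) <|
  .seq (.setReal 6 (.const 0) (.add
    (.pow (.div (.get 0 (.const 1)) .prevLength) (.div (.num 1) (.num 2)))
    (.div (.cell 0) .prevLength))) <|
  .seq (.setReal 18 (.const 0) (.clip (.sub (.cell 20) (.mul (.num 2) (.cell 6))))) <|
  .seq (.setReal 19 (.const 0) (.clip (.add (.cell 20) (.mul (.num 2) (.cell 6))))) <|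
  .seq (.setCeil 10 (.const 0) (.div (.log (.ofNat (.cell 0))) (.log (.num 2)))) <|
  .seq (.setCeil 11 (.const 0) (.div (.pow (.add (.num 1) (.cell 0)) (.div (.num 1) (.num 3)))
    (.get 0 (.const 1)))) <|
  .setCeil 13 (.const 0) (.pow (.div (.mul (.pow (.num 2) (.ofNat (.cell 5)))
    (.pow (.sub (.cell 19) (.cell 18)) (.num 2))) (.get 0 (.const 1))) (.div (.num 1) (.num 3)))

/-- Cell `4` holds `2^(m+1) - 2`, the first round of the next epoch; doubling and adding `2`
advances it by one epoch. The bounds by `B` are needed because rounding up is charged its result. -/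
theorem setParameters_ok {T m : ℕ} {C ι y : ℝ} (hT : σ.nat 0 0 = T) (hC : σ.real 0 0 = C)
    (hι : σ.real 0 1 = ι) (hm : σ.nat 5 0 + 1 = m) (hy : σ.real 5 0 / 2 ^ (m - 1) = y)
    (hQ : bandMax T ≤ B) (hK : outerCount C ι ≤ B) (hN : innerCount C ι m y ≤ B) :
    Ok B setParameters σ fun τ => τ.nat 5 0 = m ∧ τ.nat 4 0 = 2 * σ.nat 4 0 + 2 ∧
      τ.real 5 0 = 0 ∧ τ.real 6 0 = radius C ι m ∧ τ.real 18 0 = innerL C ι m y ∧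
      τ.real 19 0 = innerR C ι m y ∧ τ.nat 10 0 = bandMax T ∧ τ.nat 11 0 = outerCount C ι ∧
      τ.nat 13 0 = innerCount C ι m y := by
  have hL : ∀ τ : Store, τ.nat 5 0 = m → RExp.prevLength.eval τ = 2 ^ (m - 1) := fun τ h => by
    simp only [RExp.prevLength, RExp.eval, NExp.eval, h, Nat.cast_ofNat, Real.rpow_natCast]
  refine Ok.seq (R := fun τ => τ.nat 5 0 = m) (Ok.setNat (by simp [NExp.eval, hm])) fun τ hτ h5 => ?_
  have e0 := hτ.nat 0 rfl; have e0' := hτ.real 0 rfl; have e1 := hτ.nat 4 rfl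
  have e2 := hτ.real 5 rfl
  clear hτ
  refine Ok.seq (R := fun υ => υ.nat 4 0 = 2 * σ.nat 4 0 + 2) (Ok.setNat (by
    simp [NExp.eval, e1]; ring)) fun τ' hτ h4 => ?_
  rw [← hτ.nat 0 rfl] at e0; rw [← hτ.real 0 rfl] at e0'; rw [← hτ.nat 5 rfl] at h5
  rw [← hτ.real 5 rfl] at e2
  clear hτ
  refine Ok.seq (R := fun υ => υ.real 20 0 = y) (Ok.setReal (by
    simp [RExp.eval, hL _ h5, NExp.eval, e2, hy])) fun τ'' hτ h20 => ?_
  rw [← hτ.nat 0 rfl] at e0; rw [← hτ.real 0 rfl] at e0'; rw [← hτ.nat 5 rfl] at h5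
  rw [← hτ.nat 4 rfl] at h4
  clear hτ
  refine Ok.seq (R := fun υ => υ.real 5 0 = 0) (Ok.setReal (by simp [RExp.eval, NExp.eval]))
    fun τ3 hτ hr5 => ?_
  rw [← hτ.nat 0 rfl] at e0; rw [← hτ.real 0 rfl] at e0'; rw [← hτ.nat 5 rfl] at h5
  rw [← hτ.nat 4 rfl] at h4; rw [← hτ.real 20 rfl] at h20
  clear hτ
  refine Ok.seq (R := fun υ => υ.real 6 0 = radius C ι m) (Ok.setReal (by
    simp only [RExp.eval, hL _ h5, NExp.eval, Store.setReal_real_self, Function.update_self, e0',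
      hC, hι, Nat.cast_one, Nat.cast_ofNat, ← Real.sqrt_eq_rpow, radius])) fun τ4 hτ h6 => ?_
  rw [← hτ.nat 0 rfl] at e0; rw [← hτ.real 0 rfl] at e0'; rw [← hτ.nat 5 rfl] at h5
  rw [← hτ.nat 4 rfl] at h4; rw [← hτ.real 20 rfl] at h20; rw [← hτ.real 5 rfl] at hr5
  clear hτ
  refine Ok.seq (R := fun υ => υ.real 18 0 = innerL C ι m y) (Ok.setReal (by
    simp only [RExp.eval_clip, RExp.eval, NExp.eval, Store.setReal_real_self, Function.update_self,
      h20, h6, Nat.cast_ofNat, innerL])) fun τ5 hτ h18 => ?_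
  rw [← hτ.nat 0 rfl] at e0; rw [← hτ.real 0 rfl] at e0'; rw [← hτ.nat 5 rfl] at h5
  rw [← hτ.nat 4 rfl] at h4; rw [← hτ.real 20 rfl] at h20; rw [← hτ.real 5 rfl] at hr5
  rw [← hτ.real 6 rfl] at h6
  clear hτ
  refine Ok.seq (R := fun υ => υ.real 19 0 = innerR C ι m y) (Ok.setReal (by
    simp only [RExp.eval_clip, RExp.eval, NExp.eval, Store.setReal_real_self, Function.update_self,
      h20, h6, Nat.cast_ofNat, innerR])) fun τ6 hτ h19 => ?_
  rw [← hτ.nat 0 rfl] at e0; rw [← hτ.real 0 rfl] at e0'; rw [← hτ.nat 5 rfl] at h5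
  rw [← hτ.nat 4 rfl] at h4; rw [← hτ.real 18 rfl] at h18; rw [← hτ.real 5 rfl] at hr5
  rw [← hτ.real 6 rfl] at h6
  clear hτ
  have hv : ⌈(RExp.div (.log (.ofNat (.cell 0))) (.log (.num 2))).eval τ6⌉₊ = bandMax T := by
    simp only [RExp.eval, NExp.eval, e0, hT, Nat.cast_ofNat, bandMax, Real.logb]
  refine Ok.seq (R := fun υ => υ.nat 10 0 = bandMax T) (Ok.setCeil (hv ▸ hQ) (by
    rw [hv]; simp [NExp.eval])) fun τ7 hτ h10 => ?_
  rw [← hτ.real 0 rfl] at e0'; rw [← hτ.nat 5 rfl] at h5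
  rw [← hτ.nat 4 rfl] at h4; rw [← hτ.real 18 rfl] at h18; rw [← hτ.real 5 rfl] at hr5
  rw [← hτ.real 6 rfl] at h6; rw [← hτ.real 19 rfl] at h19
  clear hτ hv
  have hv : ⌈(RExp.div (.pow (.add (.num 1) (.cell 0)) (.div (.num 1) (.num 3)))
    (.get 0 (.const 1))).eval τ7⌉₊ = outerCount C ι := by
    simp only [RExp.eval, NExp.eval, e0', hC, hι, Nat.cast_one, Nat.cast_ofNat, outerCount]
  refine Ok.seq (R := fun υ => υ.nat 11 0 = outerCount C ι) (Ok.setCeil (hv ▸ hK) (by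
    rw [hv]; simp [NExp.eval])) fun τ8 hτ h11 => ?_
  rw [← hτ.real 0 rfl] at e0'; rw [← hτ.nat 5 rfl] at h5
  rw [← hτ.nat 4 rfl] at h4; rw [← hτ.real 18 rfl] at h18; rw [← hτ.real 5 rfl] at hr5
  rw [← hτ.real 6 rfl] at h6; rw [← hτ.real 19 rfl] at h19; rw [← hτ.nat 10 rfl] at h10
  clear hτ hv
  have hv : ⌈(RExp.pow (.div (.mul (.pow (.num 2) (.ofNat (.cell 5)))
    (.pow (.sub (.cell 19) (.cell 18)) (.num 2))) (.get 0 (.const 1))) (.div (.num 1) (.num 3))).eval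
      τ8⌉₊ = innerCount C ι m y := by
    simp only [RExp.eval, NExp.eval, e0', hι, h5, h18, h19, Real.rpow_natCast, Real.rpow_two, Nat.cast_one,
      Nat.cast_ofNat, innerCount]
  refine Ok.setCeil (hv ▸ hN) ?_
  rw [hv]
  simp [NExp.eval, h5, h4, hr5, h6, h18, h19, h10, h11]

/-- Cuts the interval given by its end points and appends the new points to the list. -/
def addBlock : Prog :=
  .ite (.realLe (.cell 8) (.cell 7)) .skip <|
    .for 8 (.cell 12) <|
      .seq (.setReal 1 (.cell 2) (.add (.cell 7) (.mul
        (.div (.ofNat (.add (.cell 8) (.const 1))) (.ofNat (.cell 12))) (.sub (.cell 8) (.cell 7)))))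
        (.setNat 2 (.const 0) (.add (.cell 2) (.const 1)))

/-- The left end of the block is already the last point of the list, so only the right ends of its
cells are appended, and the earlier entries stay untouched. -/
theorem addBlock_ok {P : Finset (ℝ × ℝ)} {n N : ℕ} {l u : ℝ} (hn : σ.nat 2 0 = n + 1)
    (hch : Chain P (σ.real 1) n l) (hl : σ.real 7 0 = l) (hu : σ.real 8 0 = u) (hlu : l ≤ u)
    (hN : σ.nat 12 0 = N) (hN0 : 0 < N) (hNB : N ≤ B) :
    Ok B addBlock σ fun τ => ∃ n', τ.nat 2 0 = n' + 1 ∧ n' ≤ n + N ∧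
      Chain (P ∪ unifPart l u N) (τ.real 1) n' u := by
  refine Ok.ite (fun hb => Ok.skip ?_) fun hb => ?_
  · simp only [Test.Holds, RExp.eval, NExp.eval, hl, hu] at hb
    exact ⟨n, hn, by omega, hch.append_empty N (le_antisymm hlu hb)⟩
  · simp only [Test.Holds, RExp.eval, NExp.eval, hl, hu, not_le] at hb
    refine Ok.for (n := N) (fun k τ => τ.nat 2 0 = n + k + 1 ∧ (∀ i ≤ n, τ.real 1 i = σ.real 1 i) ∧
      ∀ j < k, τ.real 1 (n + (j + 1)) = l + ((j : ℝ) + 1) / N * (u - l)) rfl (by simp [NExp.eval, hN]) hNB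
      (by simpa using hn) (fun k hk τ hτ hc hI => ?_) fun τ hτ hI => ?_
    · obtain ⟨h1, h2, h3⟩ := hI
      refine Ok.seq (R := fun υ => υ.nat 2 0 = n + k + 1 ∧ (∀ i ≤ n, υ.real 1 i = σ.real 1 i) ∧
        ∀ j < k + 1, υ.real 1 (n + (j + 1)) = l + ((j : ℝ) + 1) / N * (u - l)) (Ok.setReal ?_)
        fun υ hυ hR => Ok.setNat ?_
      · simp only [NExp.eval, RExp.eval, h1, hc, hτ.nat 12 rfl, hN, hτ.real 7 rfl, hτ.real 8 rfl, hl, hu,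
          Store.setReal_nat, Store.setReal_real_self]
        refine ⟨trivial, fun i hi => ?_, fun j hj => ?_⟩
        · rw [Function.update_of_ne (by omega), h2 i hi]
        · rcases Nat.lt_succ_iff_lt_or_eq.1 hj with hj | rfl
          · rw [Function.update_of_ne (by omega), h3 j hj]
          · rw [show n + (j + 1) = n + j + 1 by omega, Function.update_self]
            push_cast; rfl
      · obtain ⟨h4, h5, h6⟩ := hR
        refine ⟨by simp [NExp.eval, h4]; omega, ?_, ?_⟩
        · simpa using h5
        · simpa using h6
    · exact ⟨n + N, by rw [hI.1], le_rfl, hch.append hb hN0 hI.2.1 hI.2.2⟩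

/-- End point of a left band. -/
def RExp.leftBreak (k : NExp) : RExp :=
  .clip (.sub (.cell 18) (.mul
    (.sub (.pow (.num 2) (.ofNat (.sub (.add (.cell 10) (.const 1)) k))) (.num 1)) (.cell 6)))

/-- End point of a right band. -/
def RExp.rightBreak (k : NExp) : RExp :=
  .clip (.add (.cell 19) (.mul (.sub (.pow (.num 2) (.ofNat k)) (.num 1)) (.cell 6)))

/-- Appends the points of all left bands. -/
def buildLeft : Prog :=
  .for 7 (.add (.cell 10) (.const 1)) <|
    .seq (.setReal 7 (.const 0) (.leftBreak (.cell 7))) <|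
    .seq (.setReal 8 (.const 0) (.leftBreak (.add (.cell 7) (.const 1)))) addBlock

/-- Appends the points of all right bands. -/
def buildRight : Prog :=
  .for 7 (.add (.cell 10) (.const 1)) <|
    .seq (.setReal 7 (.const 0) (.rightBreak (.cell 7))) <|
    .seq (.setReal 8 (.const 0) (.rightBreak (.add (.cell 7) (.const 1)))) addBlock

/-- Appends the points of the inner region. -/
def buildInner : Prog :=
  .seq (.setNat 12 (.const 0) (.cell 13)) <|
  .seq (.setReal 7 (.const 0) (.cell 18)) <|
  .seq (.setReal 8 (.const 0) (.cell 19)) addBlock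

section
variable {T m : ℕ} {C ι y : ℝ}

theorem buildLeft_ok (hι : 0 < ι) (hC : 0 ≤ C) (h6 : σ.real 6 0 = radius C ι m)
    (h18 : σ.real 18 0 = innerL C ι m y) (h10 : σ.nat 10 0 = bandMax T)
    (h12 : σ.nat 12 0 = outerCount C ι) (hQ : bandMax T + 1 ≤ B) (hK : outerCount C ι ≤ B)
    (h2 : σ.nat 2 0 = 1) (hch : Chain ∅ (σ.real 1) 0 (leftBreak T C ι m y 0)) :
    Ok B buildLeft σ fun τ => ∃ n, τ.nat 2 0 = n + 1 ∧ n ≤ (bandMax T + 1) * outerCount C ι ∧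
      Chain (leftPart T C ι m y (bandMax T + 1)) (τ.real 1) n (leftBreak T C ι m y (bandMax T + 1)) := by
  have hE : ∀ (τ : Store) (k : NExp), τ.real 6 0 = radius C ι m → τ.real 18 0 = innerL C ι m y →
      τ.nat 10 0 = bandMax T → (RExp.leftBreak k).eval τ = leftBreak T C ι m y (k.eval τ) := by
    intro τ k e6 e18 e10
    simp only [RExp.leftBreak, RExp.eval_clip, RExp.eval, NExp.eval, e6, e18, e10, Nat.cast_one,
      Nat.cast_ofNat, Real.rpow_natCast, leftBreak]
  refine Ok.for (n := bandMax T + 1) (fun k τ => ∃ n, τ.nat 2 0 = n + 1 ∧ n ≤ k * outerCount C ι ∧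
    Chain (leftPart T C ι m y k) (τ.real 1) n (leftBreak T C ι m y k)) rfl (by simp [NExp.eval, h10]) hQ
    ⟨0, by simpa using h2, by simp, by simpa [leftPart] using hch⟩ (fun k hk τ hτ hc hI => ?_)
    fun τ hτ hI => hI
  obtain ⟨n, e2, hn, hI⟩ := hI
  have e6 : τ.real 6 0 = radius C ι m := by rw [hτ.real 6 rfl, h6]
  have e18 : τ.real 18 0 = innerL C ι m y := by rw [hτ.real 18 rfl, h18]
  have e10 : τ.nat 10 0 = bandMax T := by rw [hτ.nat 10 rfl, h10]
  have e12 : τ.nat 12 0 = outerCount C ι := by rw [hτ.nat 12 rfl, h12]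
  refine Ok.seq (R := fun υ => υ.real 7 0 = leftBreak T C ι m y k) (Ok.setReal (by
    simp [hE τ _ e6 e18 e10, NExp.eval, hc])) fun υ hυ h7 => ?_
  refine Ok.seq (R := fun υ => υ.real 8 0 = leftBreak T C ι m y (k + 1)) (Ok.setReal (by
    rw [hE υ _ (by rw [hυ.real 6 rfl, e6]) (by rw [hυ.real 18 rfl, e18]) (by rw [hυ.nat 10 rfl, e10])]
    simp [NExp.eval, hυ.nat 7 rfl, hc])) fun υ' hυ' h8 => ?_
  refine (addBlock_ok (n := n) (by rw [hυ'.nat 2 rfl, hυ.nat 2 rfl, e2])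
    (by rw [hυ'.real 1 rfl, hυ.real 1 rfl]; exact hI) (by rw [hυ'.real 7 rfl, h7]) h8
    (leftBreak_le hι hC k) (by rw [hυ'.nat 12 rfl, hυ.nat 12 rfl, e12]) (outerCount_pos hι hC) hK).mono
    fun τ' _ hQ' => ?_
  obtain ⟨n', g1, g2, g3⟩ := hQ'
  refine ⟨n', by simpa using g1, by have := Nat.add_one_mul k (outerCount C ι); omega, ?_⟩
  rw [leftPart_succ (by omega)]
  exact g3

theorem buildRight_ok (hι : 0 < ι) (hC : 0 ≤ C) (h6 : σ.real 6 0 = radius C ι m)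
    (h19 : σ.real 19 0 = innerR C ι m y) (h10 : σ.nat 10 0 = bandMax T)
    (h12 : σ.nat 12 0 = outerCount C ι) (hQ : bandMax T + 1 ≤ B) (hK : outerCount C ι ≤ B) {n₀ : ℕ}
    (h2 : σ.nat 2 0 = n₀ + 1) (hch : Chain (midPart T C ι m y 0) (σ.real 1) n₀ (rightBreak C ι m y 0)) :
    Ok B buildRight σ fun τ => ∃ n, τ.nat 2 0 = n + 1 ∧ n ≤ n₀ + (bandMax T + 1) * outerCount C ι ∧
      Chain (midPart T C ι m y (bandMax T + 1)) (τ.real 1) n (rightBreak C ι m y (bandMax T + 1)) := by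
  have hE : ∀ (τ : Store) (k : NExp), τ.real 6 0 = radius C ι m → τ.real 19 0 = innerR C ι m y →
      (RExp.rightBreak k).eval τ = rightBreak C ι m y (k.eval τ) := by
    intro τ k e6 e19
    simp only [RExp.rightBreak, RExp.eval_clip, RExp.eval, NExp.eval, e6, e19, Nat.cast_one,
      Nat.cast_ofNat, Real.rpow_natCast, rightBreak]
  refine Ok.for (n := bandMax T + 1) (fun k τ => ∃ n, τ.nat 2 0 = n + 1 ∧ n ≤ n₀ + k * outerCount C ι ∧
    Chain (midPart T C ι m y k) (τ.real 1) n (rightBreak C ι m y k)) rfl (by simp [NExp.eval, h10]) hQ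
    ⟨n₀, by simpa using h2, by simp, by simpa using hch⟩ (fun k hk τ hτ hc hI => ?_)
    fun τ hτ hI => hI
  obtain ⟨n, e2, hn, hI⟩ := hI
  have e6 : τ.real 6 0 = radius C ι m := by rw [hτ.real 6 rfl, h6]
  have e19 : τ.real 19 0 = innerR C ι m y := by rw [hτ.real 19 rfl, h19]
  have e12 : τ.nat 12 0 = outerCount C ι := by rw [hτ.nat 12 rfl, h12]
  refine Ok.seq (R := fun υ => υ.real 7 0 = rightBreak C ι m y k) (Ok.setReal (by
    simp [hE τ _ e6 e19, NExp.eval, hc])) fun υ hυ h7 => ?_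
  refine Ok.seq (R := fun υ => υ.real 8 0 = rightBreak C ι m y (k + 1)) (Ok.setReal (by
    rw [hE υ _ (by rw [hυ.real 6 rfl, e6]) (by rw [hυ.real 19 rfl, e19])]
    simp [NExp.eval, hυ.nat 7 rfl, hc])) fun υ' hυ' h8 => ?_
  refine (addBlock_ok (n := n) (by rw [hυ'.nat 2 rfl, hυ.nat 2 rfl, e2])
    (by rw [hυ'.real 1 rfl, hυ.real 1 rfl]; exact hI) (by rw [hυ'.real 7 rfl, h7]) h8
    (rightBreak_le hι hC k) (by rw [hυ'.nat 12 rfl, hυ.nat 12 rfl, e12]) (outerCount_pos hι hC) hK).mono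
    fun τ' _ hQ' => ?_
  obtain ⟨n', g1, g2, g3⟩ := hQ'
  refine ⟨n', by simpa using g1, by have := Nat.add_one_mul k (outerCount C ι); omega, ?_⟩
  rw [midPart_succ]
  exact g3

theorem buildInner_ok (hι : 0 < ι) (hC : 0 ≤ C) (hy : y ∈ Set.Icc (0 : ℝ) 1)
    (h18 : σ.real 18 0 = innerL C ι m y) (h19 : σ.real 19 0 = innerR C ι m y)
    (h13 : σ.nat 13 0 = innerCount C ι m y) (hN : innerCount C ι m y ≤ B) {n : ℕ}
    (h2 : σ.nat 2 0 = n + 1)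
    (hch : Chain (leftPart T C ι m y (bandMax T + 1)) (σ.real 1) n (innerL C ι m y)) :
    Ok B buildInner σ fun τ => ∃ n', τ.nat 2 0 = n' + 1 ∧ n' ≤ n + innerCount C ι m y ∧
      Chain (midPart T C ι m y 0) (τ.real 1) n' (innerR C ι m y) := by
  refine Ok.seq (R := fun υ => υ.nat 12 0 = innerCount C ι m y) (Ok.setNat (by
    simp [NExp.eval, h13])) fun τ hτ h12 => ?_
  refine Ok.seq (R := fun υ => υ.real 7 0 = innerL C ι m y) (Ok.setReal (by
    simp [RExp.eval, NExp.eval, hτ.real 18 rfl, h18])) fun τ1 hτ1 h7 => ?_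
  refine Ok.seq (R := fun υ => υ.real 8 0 = innerR C ι m y) (Ok.setReal (by
    simp [RExp.eval, NExp.eval, hτ1.real 19 rfl, hτ.real 19 rfl, h19])) fun τ2 hτ2 h8 => ?_
  refine (addBlock_ok (n := n) (by rw [hτ2.nat 2 rfl, hτ1.nat 2 rfl, hτ.nat 2 rfl, h2])
    (by rw [hτ2.real 1 rfl, hτ1.real 1 rfl, hτ.real 1 rfl]; exact hch) (by rw [hτ2.real 7 rfl, h7]) h8
    (innerL_lt_innerR hι hC hy).le (by rw [hτ2.nat 12 rfl, hτ1.nat 12 rfl, h12])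
    (innerCount_pos hι hC hy) hN).mono fun τ' _ hQ' => ?_
  obtain ⟨n', g1, g2, g3⟩ := hQ'
  refine ⟨n', g1, g2, ?_⟩
  rw [midPart, Finset.range_zero, Finset.biUnion_empty, Finset.union_empty]
  exact g3

/-- Lists the end points of the partition of the epoch. -/
def buildPoints : Prog :=
  .seq (.setReal 1 (.const 0) (.num 0)) <|
  .seq (.setNat 2 (.const 0) (.const 1)) <|
  .seq (.setNat 12 (.const 0) (.cell 11)) <|
  .seq buildLeft <|
  .seq buildInner <|
  .seq (.setNat 12 (.const 0) (.cell 11)) buildRight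

theorem buildPoints_ok (hT : 1 ≤ T) (hι : 1 ≤ ι) (hC : 0 ≤ C) (hm : 1 ≤ m) (hmT : 2 ^ m ≤ T + 1)
    (hy : y ∈ Set.Icc (0 : ℝ) 1) (h6 : σ.real 6 0 = radius C ι m)
    (h18 : σ.real 18 0 = innerL C ι m y) (h19 : σ.real 19 0 = innerR C ι m y)
    (h10 : σ.nat 10 0 = bandMax T) (h11 : σ.nat 11 0 = outerCount C ι)
    (h13 : σ.nat 13 0 = innerCount C ι m y)
    (hQ : bandMax T + 1 ≤ B) (hK : outerCount C ι ≤ B) (hN : innerCount C ι m y ≤ B) :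
    Ok B buildPoints σ fun τ => ∃ n, 0 < n ∧ τ.nat 2 0 = n + 1 ∧
      n ≤ innerCount C ι m y + 2 * ((bandMax T + 1) * outerCount C ι) ∧
      Chain (partition T C ι m y) (τ.real 1) n 1 := by
  have hι0 : 0 < ι := by linarith
  refine Ok.seq (R := fun υ => υ.real 1 0 = 0) (Ok.setReal (by simp [RExp.eval, NExp.eval]))
    fun τ1 hτ1 g1 => ?_
  refine Ok.seq (R := fun υ => υ.nat 2 0 = 1) (Ok.setNat (by simp [NExp.eval]))
    fun τ2 hτ2 g2 => ?_
  refine Ok.seq (R := fun υ => υ.nat 12 0 = outerCount C ι) (Ok.setNat (by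
    simp [NExp.eval, hτ2.nat 11 rfl, hτ1.nat 11 rfl, h11])) fun τ3 hτ3 g3 => ?_
  have e6 : τ3.real 6 = σ.real 6 := by rw [hτ3.real 6 rfl, hτ2.real 6 rfl, hτ1.real 6 rfl]
  have e18 : τ3.real 18 = σ.real 18 := by rw [hτ3.real 18 rfl, hτ2.real 18 rfl, hτ1.real 18 rfl]
  have e19 : τ3.real 19 = σ.real 19 := by rw [hτ3.real 19 rfl, hτ2.real 19 rfl, hτ1.real 19 rfl]
  have e10 : τ3.nat 10 = σ.nat 10 := by rw [hτ3.nat 10 rfl, hτ2.nat 10 rfl, hτ1.nat 10 rfl]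
  have e11 : τ3.nat 11 = σ.nat 11 := by rw [hτ3.nat 11 rfl, hτ2.nat 11 rfl, hτ1.nat 11 rfl]
  have e13 : τ3.nat 13 = σ.nat 13 := by rw [hτ3.nat 13 rfl, hτ2.nat 13 rfl, hτ1.nat 13 rfl]
  refine Ok.seq (buildLeft_ok (T := T) (y := y) hι0 hC (by rw [e6, h6]) (by rw [e18, h18])
    (by rw [e10, h10]) g3 hQ hK (by rw [hτ3.nat 2 rfl, g2]) ?_) fun τ4 hτ4 hQ4 => ?_
  · rw [leftBreak_zero hT hι hC hm hmT]
    have : τ3.real 1 0 = 0 := by rw [hτ3.real 1 rfl, hτ2.real 1 rfl, g1]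
    exact ⟨fun i hi => absurd hi (Nat.not_lt_zero i), rfl, this, this⟩
  obtain ⟨n1, k2, k3, k4⟩ := hQ4
  rw [leftBreak_last] at k4
  refine Ok.seq (buildInner_ok hι0 hC hy (by rw [hτ4.real 18 rfl, e18, h18])
    (by rw [hτ4.real 19 rfl, e19, h19]) (by rw [hτ4.nat 13 rfl, e13, h13]) hN k2 k4) fun τ5 hτ5 hQ5 => ?_
  obtain ⟨n2, l2, l3, l4⟩ := hQ5
  refine Ok.seq (R := fun υ => υ.nat 12 0 = outerCount C ι) (Ok.setNat (by
    simp [NExp.eval, hτ5.nat 11 rfl, hτ4.nat 11 rfl, e11, h11])) fun τ6 hτ6 g6 => ?_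
  refine (buildRight_ok (T := T) (y := y) (n₀ := n2) hι0 hC
    (by rw [hτ6.real 6 rfl, hτ5.real 6 rfl, hτ4.real 6 rfl, e6, h6])
    (by rw [hτ6.real 19 rfl, hτ5.real 19 rfl, hτ4.real 19 rfl, e19, h19])
    (by rw [hτ6.nat 10 rfl, hτ5.nat 10 rfl, hτ4.nat 10 rfl, e10, h10]) g6 hQ hK
    (by rw [hτ6.nat 2 rfl, l2])
    (by rw [rightBreak_zero, hτ6.real 1 rfl]; exact l4)).mono fun τ7 _ hQ7 => ?_
  obtain ⟨n, p2, p3, p4⟩ := hQ7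
  rw [rightBreak_last hT hι hC hm hmT, midPart_bandMax] at p4
  refine ⟨n, Nat.pos_of_ne_zero fun h0 => ?_, p2, by omega, p4⟩
  subst h0
  exact zero_ne_one (p4.zero.symm.trans p4.last)

/-- Starts a new epoch. -/
def newEpoch : Prog :=
  .seq setParameters <| .seq buildPoints <|
  .seq (.for 7 (.cell 2) (.setReal 3 (.cell 7) (.num 0)))
    (.for 7 (.cell 2) (.setReal 4 (.cell 7) (.num 0)))

theorem newEpoch_ok (hT : 1 ≤ T) (hι : 1 ≤ ι) (hC : 0 ≤ C) (hmT : 2 ^ m ≤ T + 1)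
    (hy : y ∈ Set.Icc (0 : ℝ) 1) (eT : σ.nat 0 0 = T) (eC : σ.real 0 0 = C)
    (eι : σ.real 0 1 = ι) (em : σ.nat 5 0 + 1 = m) (ey : σ.real 5 0 / 2 ^ (m - 1) = y)
    (hB : innerCount C ι m y + 2 * ((bandMax T + 1) * outerCount C ι) + 1 ≤ B) :
    Ok B newEpoch σ fun τ => τ.nat 5 0 = m ∧ τ.nat 4 0 = 2 * σ.nat 4 0 + 2 ∧ τ.real 5 0 = 0 ∧
      ∃ n, 0 < n ∧ τ.nat 2 0 = n + 1 ∧ n + 1 ≤ B ∧ Chain (partition T C ι m y) (τ.real 1) n 1 ∧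
      ∀ i ≤ n, τ.real 3 i = 0 ∧ τ.real 4 i = 0 := by
  have hι0 : 0 < ι := by linarith
  have hK0 := outerCount_pos hι0 hC
  have hQ1 : bandMax T + 1 ≤ (bandMax T + 1) * outerCount C ι := Nat.le_mul_of_pos_right _ hK0
  have hK1 : outerCount C ι ≤ (bandMax T + 1) * outerCount C ι := Nat.le_mul_of_pos_left _ (by omega)
  have hQ : bandMax T + 1 ≤ B := by omega
  have hK : outerCount C ι ≤ B := by omega
  have hN : innerCount C ι m y ≤ B := by omega
  refine Ok.seq (setParameters_ok eT eC eι em ey (by omega) hK hN) fun τ1 hτ1 h1 => ?_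
  obtain ⟨a1, a2, a3, a4, a5, a6, a7, a8, a9⟩ := h1
  refine Ok.seq (buildPoints_ok hT hι hC (by omega) hmT hy a4 a5 a6 a7 a8 a9 hQ hK hN)
    fun τ2 hτ2 h2 => ?_
  obtain ⟨n, b0, b1, b2, b3⟩ := h2
  refine Ok.seq (Ok.forSet (n := n + 1) (fun _ => 0) (by simp [NExp.eval, b1]) (by omega)
    (fun _ _ _ _ _ _ => by simp [RExp.eval, NExp.eval]) fun τ hτ hI => hI) fun τ3 hτ3 h3 => ?_
  refine Ok.forSet (n := n + 1) (fun _ => 0) (by simp [NExp.eval, hτ3.nat 2 rfl, b1]) (by omega)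
    (fun _ _ _ _ _ _ => by simp [RExp.eval, NExp.eval]) fun τ4 hτ4 h4 => ?_
  refine ⟨by rw [hτ4.nat 5 rfl, hτ3.nat 5 rfl, hτ2.nat 5 rfl, a1],
    by rw [hτ4.nat 4 rfl, hτ3.nat 4 rfl, hτ2.nat 4 rfl, a2],
    by rw [hτ4.real 5 rfl, hτ3.real 5 rfl, hτ2.real 5 rfl, a3], n, b0,
    by rw [hτ4.nat 2 rfl, hτ3.nat 2 rfl, b1], by omega,
    by rw [hτ4.real 1 rfl, hτ3.real 1 rfl]; exact b3, fun i hi => ⟨?_, ?_⟩⟩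
  · rw [hτ4.real 3 rfl, h3, splice_of_lt (by omega)]
  · rw [h4, splice_of_lt (by omega)]

end

end

/-! ### The program: stationary distributions -/

/-- Matrix whose row `i` has the entries `1 - al i` and `al i` in the columns `idx i` and
`idx i + 1`. -/
noncomputable def trans (idx : ℕ → ℕ) (al : ℕ → ℝ) (i j : ℕ) : ℝ :=
  if j = idx i then 1 - al i else if j = idx i + 1 then al i else 0

/-- The leading square block of `trans`. -/
noncomputable def transMatrix (n : ℕ) (idx : ℕ → ℕ) (al : ℕ → ℝ) : Matrix (Fin (n + 1)) (Fin (n + 1)) ℝ :=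
  Matrix.of fun i j => trans idx al i j

/-- The first entries of a sequence, as a vector. -/
def vec (n : ℕ) (f : ℕ → ℝ) : Fin (n + 1) → ℝ := fun i => f i

section
variable {n : ℕ} {idx : ℕ → ℕ} {al : ℕ → ℝ}

theorem vec_eq {f g : ℕ → ℝ} (h : ∀ i ≤ n, f i = g i) : vec n f = vec n g :=
  funext fun i => h i (Nat.lt_succ_iff.1 i.2)

theorem vec_dotProduct (f g : ℕ → ℝ) : vec n f ⬝ᵥ vec n g = ∑ i ∈ Finset.range (n + 1), f i * g i :=
  (Finset.sum_range fun i => f i * g i).symm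

theorem sum_trans_mul {i : ℕ} (hi : idx i < n) (w : ℕ → ℝ) :
    ∑ j ∈ Finset.range (n + 1), trans idx al i j * w j =
      (1 - al i) * w (idx i) + al i * w (idx i + 1) := by
  have h : ∀ j, trans idx al i j * w j = (if j = idx i then (1 - al i) * w (idx i) else 0) +
      if j = idx i + 1 then al i * w (idx i + 1) else 0 := by
    intro j
    unfold trans
    by_cases h1 : j = idx i
    · rw [if_pos h1, if_pos h1, if_neg (by omega), h1, add_zero]
    · by_cases h2 : j = idx i + 1
      · rw [if_neg h1, if_neg h1, if_pos h2, if_pos h2, h2, zero_add]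
      · rw [if_neg h1, if_neg h1, if_neg h2, if_neg h2, zero_mul, add_zero]
  simp only [h, Finset.sum_add_distrib]
  rw [Finset.sum_ite_eq', Finset.sum_ite_eq', if_pos (Finset.mem_range.2 (by omega)),
    if_pos (Finset.mem_range.2 (by omega))]

/-- Here `q` is the vector `p (1 - Q)`. Each row of `Q` has two nonzero entries, so the Gram
operator takes linear time and the matrix is never stored. -/
theorem gramOp_transMatrix (hidx : ∀ i ≤ n, idx i < n) {p q : ℕ → ℝ}
    (hq : ∀ j ≤ n, q j = p j - ∑ s ∈ Finset.range (n + 1), p s * trans idx al s j) :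
    gramOp (transMatrix n idx al) (vec n p) =
      vec n fun i => q i - (1 - al i) * q (idx i) - al i * q (idx i + 1) := by
  have h1 : Matrix.vecMul (vec n p) (1 - transMatrix n idx al) = vec n q := by
    ext j
    rw [Matrix.vecMul_sub, Matrix.vecMul_one, Pi.sub_apply]
    show p j - ∑ s : Fin (n + 1), p s * trans idx al s j = q j
    rw [hq j (Nat.lt_succ_iff.1 j.2), Finset.sum_range fun s => p s * trans idx al s j]
  rw [gramOp_apply, h1]
  ext i
  rw [Matrix.sub_mulVec, Matrix.one_mulVec, Pi.sub_apply]
  show q i - ∑ j : Fin (n + 1), trans idx al i j * q j = _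
  rw [← Finset.sum_range fun j => trans idx al i j * q j,
    sum_trans_mul (hidx i (Nat.lt_succ_iff.1 i.2))]
  simp only [vec]
  ring

end

/-- Finds the interval that contains the action of each point. -/
def locate : Prog :=
  .for 7 (.cell 2) <|
    .seq (.setNat 9 (.cell 7) (.const 0)) <|
      .for 8 (.sub (.cell 2) (.const 1)) <|
        .ite (.realLe (.get 1 (.cell 8)) (.get 3 (.cell 7))) (.setNat 9 (.cell 7) (.cell 8)) .skip

/-- Computes the relative positions of the actions in their intervals. -/
def locatePositions : Prog :=
  .for 7 (.cell 2) (.setReal 9 (.cell 7)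
    (.div (.sub (.get 3 (.cell 7)) (.get 1 (.get 9 (.cell 7))))
      (.sub (.get 1 (.add (.get 9 (.cell 7)) (.const 1))) (.get 1 (.get 9 (.cell 7))))))

/-- Applies the Gram operator of the transition matrix to the direction. -/
def applyGram : Prog :=
  .seq (.for 7 (.cell 2) (.setReal 13 (.cell 7) (.get 12 (.cell 7)))) <|
  .seq (.for 7 (.cell 2) (.seq
    (.setReal 13 (.get 9 (.cell 7)) (.sub (.get 13 (.get 9 (.cell 7)))
      (.mul (.get 12 (.cell 7)) (.sub (.num 1) (.get 9 (.cell 7))))))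
    (.setReal 13 (.add (.get 9 (.cell 7)) (.const 1)) (.sub (.get 13 (.add (.get 9 (.cell 7)) (.const 1)))
      (.mul (.get 12 (.cell 7)) (.get 9 (.cell 7))))))) <|
  .for 7 (.cell 2) (.setReal 14 (.cell 7) (.sub (.sub (.get 13 (.cell 7))
    (.mul (.sub (.num 1) (.get 9 (.cell 7))) (.get 13 (.get 9 (.cell 7)))))
    (.mul (.get 9 (.cell 7)) (.get 13 (.add (.get 9 (.cell 7)) (.const 1))))))

/-- Puts the scalar product of the arrays `a` and `b` into entry `0` of array `c`. -/
def dot (c a b : ℕ) : Prog :=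
  .seq (.setReal c (.const 0) (.num 0)) <|
    .for 7 (.cell 2) (.setReal c (.const 0) (.add (.cell c) (.mul (.get a (.cell 7)) (.get b (.cell 7)))))

/-- Sets array `c` to array `a` plus `e` times array `b`. -/
def axpy (c a : ℕ) (e : RExp) (b : ℕ) : Prog :=
  .for 7 (.cell 2) (.setReal c (.cell 7) (.add (.get a (.cell 7)) (.mul e (.get b (.cell 7)))))

/-- One step of the conjugate gradient method. -/
def cgBody : Prog :=
  .seq applyGram <| .seq (dot 15 11 11) <| .seq (dot 16 12 14) <|
  .seq (axpy 10 10 (.div (.cell 15) (.cell 16)) 12) <|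
  .seq (axpy 11 11 (.sub (.num 0) (.div (.cell 15) (.cell 16))) 14) <|
  .seq (dot 17 11 11) <| axpy 12 11 (.div (.cell 17) (.cell 15)) 12

/-- The start of the conjugate gradient method. -/
def cgInit : Prog :=
  .seq (.for 7 (.cell 2) (.setReal 10 (.cell 7) (.num 1))) <|
  .seq (.for 7 (.cell 2) (.setReal 12 (.cell 7) (.num 1))) <|
  .seq applyGram <|
  .seq (.for 7 (.cell 2) (.setReal 11 (.cell 7) (.sub (.num 0) (.get 14 (.cell 7))))) <|
  .for 7 (.cell 2) (.setReal 12 (.cell 7) (.get 11 (.cell 7)))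

/-- Normalizes the absolute values of the fixed vector. -/
def normalize : Prog :=
  .seq (.setReal 15 (.const 0) (.num 0)) <|
  .seq (.for 7 (.cell 2) (.setReal 15 (.const 0) (.add (.cell 15) (.abs (.get 10 (.cell 7)))))) <|
  .for 7 (.cell 2) (.setReal 2 (.cell 7) (.div (.abs (.get 10 (.cell 7))) (.cell 15)))

/-- Computes a stationary distribution. -/
def stationary : Prog :=
  .seq locate <| .seq locatePositions <| .seq cgInit <| .seq (.loop (.cell 2) cgBody) normalize

section
variable {B n : ℕ} {σ : Store}

/-- The scan keeps the last interval whose left end is not above the action. If its right end were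
not above the action either, it would be the final interval and the action would be `1`, which that
interval owns. Scanning for every point is quadratic, within the budget. -/
theorem locate_ok {P : Finset (ℝ × ℝ)} (hn : 0 < n) (h2 : σ.nat 2 0 = n + 1) (hB : n + 1 ≤ B)
    (hch : Chain P (σ.real 1) n 1) (ha : ∀ i ≤ n, σ.real 3 i ∈ Set.Icc (0 : ℝ) 1) :
    Ok B locate σ fun τ => ∀ i ≤ n, τ.nat 9 i < n ∧
      Owns (σ.real 1 (τ.nat 9 i), σ.real 1 (τ.nat 9 i + 1)) (σ.real 3 i) := by
  refine Ok.for (n := n + 1) (fun k τ => ∀ i < k, τ.nat 9 i < n ∧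
      Owns (σ.real 1 (τ.nat 9 i), σ.real 1 (τ.nat 9 i + 1)) (σ.real 3 i)) rfl
    (by simp [NExp.eval, h2]) hB (fun i hi => absurd hi (Nat.not_lt_zero i))
    (fun k hk τ hτ hc hI => ?_) fun τ hτ hI i hi => hI i (by omega)
  refine Ok.seq (R := fun υ => υ.nat 9 k = 0 ∧ ∀ i < k, υ.nat 9 i = τ.nat 9 i) (Ok.setNat ?_)
    fun υ hυ hR => ?_
  · simp only [NExp.eval, hc, Store.setNat_nat_self, Function.update_self, true_and]
    exact fun i hi => Function.update_of_ne hi.ne _ _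
  have e2 : υ.nat 2 0 = n + 1 := by rw [hυ.nat 2 rfl, hτ.nat 2 rfl, h2]
  have e1 : υ.real 1 = σ.real 1 := by rw [hυ.real 1 rfl, hτ.real 1 rfl]
  have e3 : υ.real 3 = σ.real 3 := by rw [hυ.real 3 rfl, hτ.real 3 rfl]
  have e7 : υ.nat 7 0 = k := by rw [hυ.nat 7 rfl, hc]
  obtain ⟨ha0, ha1⟩ := ha k (by omega)
  refine Ok.for (n := n) (fun j w => (∀ i < k, w.nat 9 i = τ.nat 9 i) ∧ w.nat 9 k < n ∧
      σ.real 1 (w.nat 9 k) ≤ σ.real 3 k ∧ ∀ l < j, σ.real 1 l ≤ σ.real 3 k → l ≤ w.nat 9 k) rfl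
    (by simp [NExp.eval, e2]) (by omega) ?_ (fun j hj w hw hcj hJ => ?_) fun w hw hJ i hi => ?_
  · simp only [ne_eq, show (9 : ℕ) ≠ 8 by omega, not_false_eq_true, Store.setNat_nat_ne, hR.1, hch.zero]
    exact ⟨hR.2, hn, ha0, fun l hl => absurd hl (Nat.not_lt_zero l)⟩
  · have f1 : w.real 1 = σ.real 1 := by rw [hw.real 1 rfl, e1]
    have f3 : w.real 3 = σ.real 3 := by rw [hw.real 3 rfl, e3]
    have f7 : w.nat 7 0 = k := by rw [hw.nat 7 rfl, e7]
    obtain ⟨j1, j2, j3, j4⟩ := hJ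
    refine Ok.ite (fun hb => Ok.setNat ?_) fun hb => Ok.skip ?_
    · simp only [Test.Holds, RExp.eval, NExp.eval, hcj, f1, f3, f7] at hb
      simp only [NExp.eval, hcj, f7, ne_eq, show (9 : ℕ) ≠ 8 by omega, not_false_eq_true,
        Store.setNat_nat_ne, Store.setNat_nat_self, Function.update_self]
      refine ⟨fun i hi => by rw [Function.update_of_ne hi.ne, j1 i hi], hj, hb, fun l hl _ => by omega⟩
    · simp only [Test.Holds, RExp.eval, NExp.eval, hcj, f1, f3, f7] at hb
      simp only [ne_eq, show (9 : ℕ) ≠ 8 by omega, not_false_eq_true, Store.setNat_nat_ne]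
      refine ⟨j1, j2, j3, fun l hl hle => ?_⟩
      rcases Nat.lt_succ_iff_lt_or_eq.1 hl with hl | rfl
      · exact j4 l hl hle
      · exact absurd hle hb
  · obtain ⟨j1, j2, j3, j4⟩ := hJ
    simp only [ne_eq, show (9 : ℕ) ≠ 7 by omega, not_false_eq_true, Store.setNat_nat_ne]
    rcases Nat.lt_succ_iff_lt_or_eq.1 hi with hi | rfl
    · rw [j1 i hi]; exact hI i hi
    · refine ⟨j2, j3, ?_⟩
      by_contra! hne
      obtain ⟨g1, g2⟩ := hne
      rcases Nat.lt_or_ge (w.nat 9 i + 1) n with hlt | hge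
      · have := j4 _ hlt g1; omega
      · have hl : w.nat 9 i + 1 = n := by omega
        simp only [hl, hch.last] at g1 g2
        exact g2 (le_antisymm ha1 g1) rfl

theorem applyGram_ok (h2 : σ.nat 2 0 = n + 1) (hB : n + 1 ≤ B) (hidx : ∀ i ≤ n, σ.nat 9 i < n) :
    Ok B applyGram σ fun τ =>
      vec n (τ.real 14) = gramOp (transMatrix n (σ.nat 9) (σ.real 9)) (vec n (σ.real 12)) := by
  refine Ok.seq (R := fun τ => ∀ i ≤ n, τ.real 13 i = σ.real 12 i)
    (Ok.forSet (n := n + 1) (σ.real 12) (by simp [NExp.eval, h2]) hB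
      (fun k hk τ hτ hc hI => by simp only [RExp.eval, NExp.eval, hc, hτ.real 12 rfl])
      fun τ hτ hI i hi => by rw [hI, splice_of_lt (by omega)]) fun τ hτ h13 => ?_
  have e2 : τ.nat 2 0 = n + 1 := by rw [hτ.nat 2 rfl, h2]
  have e9 : τ.nat 9 = σ.nat 9 := hτ.nat 9 rfl
  have e9r : τ.real 9 = σ.real 9 := hτ.real 9 rfl
  have e12 : τ.real 12 = σ.real 12 := hτ.real 12 rfl
  -- A scatter loop: after `k` passes the contributions of the first `k` rows of the matrix have
  -- been subtracted, by two updates per row.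
  refine Ok.seq (Ok.for (n := n + 1) (Q := fun υ => ∀ j ≤ n, υ.real 13 j = σ.real 12 j -
      ∑ s ∈ Finset.range (n + 1), σ.real 12 s * trans (σ.nat 9) (σ.real 9) s j)
    (fun k υ => ∀ j ≤ n, υ.real 13 j = σ.real 12 j -
      ∑ s ∈ Finset.range k, σ.real 12 s * trans (σ.nat 9) (σ.real 9) s j) rfl
    (by simp [NExp.eval, e2]) hB (fun j hj => by simp [h13 j hj]) (fun k hk υ hυ hc hI => ?_)
    fun υ hυ hI => hI) fun υ hυ hq => ?_
  · have f9 : υ.nat 9 = σ.nat 9 := by rw [hυ.nat 9 rfl, e9]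
    have f9r : υ.real 9 = σ.real 9 := by rw [hυ.real 9 rfl, e9r]
    have f12 : υ.real 12 = σ.real 12 := by rw [hυ.real 12 rfl, e12]
    refine Ok.seq (R := fun w => w.real 13 = Function.update (υ.real 13) (σ.nat 9 k)
      (υ.real 13 (σ.nat 9 k) - σ.real 12 k * (1 - σ.real 9 k))) (Ok.setReal ?_) fun w hw hR => Ok.setReal ?_
    · simp only [RExp.eval, NExp.eval, hc, f9, f9r, f12, Store.setReal_real_self, Nat.cast_one]
    · have g9 : w.nat 9 = σ.nat 9 := by rw [hw.nat 9 rfl, f9]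
      have g9r : w.real 9 = σ.real 9 := by rw [hw.real 9 rfl, f9r]
      have g12 : w.real 12 = σ.real 12 := by rw [hw.real 12 rfl, f12]
      have g7 : w.nat 7 0 = k := by rw [hw.nat 7 rfl, hc]
      intro j hj
      simp only [RExp.eval, NExp.eval, g7, g9, g9r, g12, Store.setNat_real, Store.setReal_real_self, hR]
      rw [Function.update_of_ne (a := σ.nat 9 k + 1) (by omega), Finset.sum_range_succ, trans]
      by_cases h1 : j = σ.nat 9 k
      · rw [if_pos h1, Function.update_of_ne (by omega), h1, Function.update_self, hI _ (by omega)]; ring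
      · rw [if_neg h1]
        by_cases h3 : j = σ.nat 9 k + 1
        · rw [if_pos h3, h3, Function.update_self, hI _ (by omega)]; ring
        · rw [if_neg h3, Function.update_of_ne h3, Function.update_of_ne h1, hI j hj]; ring
  · have f9 : υ.nat 9 = σ.nat 9 := by rw [hυ.nat 9 rfl, e9]
    have f9r : υ.real 9 = σ.real 9 := by rw [hυ.real 9 rfl, e9r]
    refine Ok.forSet (n := n + 1) (fun i => υ.real 13 i - (1 - σ.real 9 i) * υ.real 13 (σ.nat 9 i) -
      σ.real 9 i * υ.real 13 (σ.nat 9 i + 1)) (by simp [NExp.eval, hυ.nat 2 rfl, e2]) hB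
      (fun k hk w hw hc hI => by
        simp only [RExp.eval, NExp.eval, hc, hw.real 13 rfl, hw.nat 9 rfl, hw.real 9 rfl, f9, f9r,
          Nat.cast_one]) fun w hw hI => ?_
    rw [gramOp_transMatrix hidx hq]
    exact vec_eq fun i hi => by rw [hI, splice_of_lt (by omega)]

theorem dot_ok {c a b : ℕ} (hac : c ≠ a) (hbc : c ≠ b) (h2 : σ.nat 2 0 = n + 1) (hB : n + 1 ≤ B) :
    Ok B (dot c a b) σ fun τ => τ.real c 0 = vec n (σ.real a) ⬝ᵥ vec n (σ.real b) := by
  refine Ok.seq (R := fun τ => τ.real c 0 = 0) (Ok.setReal (by simp [NExp.eval, RExp.eval]))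
    fun τ hτ h0 => ?_
  have ea : τ.real a = σ.real a := hτ.real a (by simpa [Prog.writesReal] using hac.symm)
  have eb : τ.real b = σ.real b := hτ.real b (by simpa [Prog.writesReal] using hbc.symm)
  rw [vec_dotProduct]
  refine Ok.forSum (n := n + 1) (fun i => σ.real a i * σ.real b i)
    (by simp [NExp.eval, hτ.nat 2 rfl, h2]) hB h0 (fun k hk υ hυ hc => ?_) fun υ hυ h => h
  rw [RExp.eval, RExp.eval, RExp.eval, hυ.real a (by simpa [Prog.for, Prog.writesReal] using hac.symm),
    hυ.real b (by simpa [Prog.for, Prog.writesReal] using hbc.symm), ea, eb]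
  simp only [NExp.eval, hc]

theorem axpy_ok {c a b : ℕ} {e : RExp} (v : ℝ) (h2 : σ.nat 2 0 = n + 1) (hB : n + 1 ≤ B)
    (hv : ∀ τ, Frame (axpy c a e b) σ τ → e.eval τ = v) :
    Ok B (axpy c a e b) σ fun τ => vec n (τ.real c) = vec n (σ.real a) + v • vec n (σ.real b) := by
  refine Ok.forSet (n := n + 1) (fun i => σ.real a i + v * σ.real b i) (by simp [NExp.eval, h2]) hB
    (fun k hk τ hτ hc hI => ?_) fun τ hτ hI => ?_
  · have key : ∀ d, τ.real d k = σ.real d k := by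
      intro d
      by_cases hd : c = d
      · subst hd; rw [hI, splice_self]
      · rw [hτ.real d (by simpa [Prog.for, Prog.writesReal] using Ne.symm hd)]
    simp only [RExp.eval, NExp.eval, hc, hv τ hτ, key]
  · ext i
    simp only [vec, hI, splice_of_lt i.2, Pi.add_apply, Pi.smul_apply, smul_eq_mul]

theorem cgInit_ok (h2 : σ.nat 2 0 = n + 1) (hB : n + 1 ≤ B) (hidx : ∀ i ≤ n, σ.nat 9 i < n) :
    Ok B cgInit σ fun τ => (vec n (τ.real 10), vec n (τ.real 11), vec n (τ.real 12)) =
      cg (gramOp (transMatrix n (σ.nat 9) (σ.real 9))) 1 0 := by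
  have hone : ∀ f : ℕ → ℝ, (∀ i ≤ n, f i = 1) → vec n f = 1 := fun f hf =>
    funext fun i => hf i (Nat.lt_succ_iff.1 i.2)
  refine Ok.seq (R := fun τ => vec n (τ.real 10) = 1)
    (Ok.forSet (n := n + 1) (fun _ => 1) (by simp [NExp.eval, h2]) hB
      (fun _ _ _ _ _ _ => by simp [RExp.eval, NExp.eval])
      fun τ hτ hI => hone _ fun i hi => by rw [hI, splice_of_lt (by omega)]) fun τ1 h1 q1 => ?_
  refine Ok.seq (R := fun τ => vec n (τ.real 12) = 1)
    (Ok.forSet (n := n + 1) (fun _ => 1) (by simp [NExp.eval, h1.nat 2 rfl, h2]) hB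
      (fun _ _ _ _ _ _ => by simp [RExp.eval, NExp.eval])
      fun τ hτ hI => hone _ fun i hi => by rw [hI, splice_of_lt (by omega)]) fun τ2 h2' q2 => ?_
  have e2 : τ2.nat 2 0 = n + 1 := by rw [h2'.nat 2 rfl, h1.nat 2 rfl, h2]
  have e9 : τ2.nat 9 = σ.nat 9 := by rw [h2'.nat 9 rfl, h1.nat 9 rfl]
  have e9r : τ2.real 9 = σ.real 9 := by rw [h2'.real 9 rfl, h1.real 9 rfl]
  refine Ok.seq (applyGram_ok e2 hB (by rwa [e9])) fun τ3 h3 q3 => ?_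
  rw [e9, e9r, q2] at q3
  refine Ok.seq (R := fun τ => vec n (τ.real 11) = -gramOp (transMatrix n (σ.nat 9) (σ.real 9)) 1)
    (Ok.forSet (n := n + 1) (fun i => 0 - τ3.real 14 i) (by simp [NExp.eval, h3.nat 2 rfl, e2]) hB
      (fun k hk τ hτ hc hI => by simp only [RExp.eval, NExp.eval, hc, hτ.real 14 rfl, Nat.cast_zero])
      fun τ hτ hI => ?_) fun τ4 h4 q4 => ?_
  · rw [← q3]
    ext i
    simp only [vec, hI, splice_of_lt i.2, Pi.neg_apply, zero_sub]
  · refine Ok.forSet (n := n + 1) (τ4.real 11) (by simp [NExp.eval, h4.nat 2 rfl, h3.nat 2 rfl, e2]) hB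
      (fun k hk τ hτ hc hI => by simp only [RExp.eval, NExp.eval, hc, hτ.real 11 rfl]) fun τ hτ hI => ?_
    have e10 : τ.real 10 = τ1.real 10 := by rw [hτ.real 10 rfl, h4.real 10 rfl, h3.real 10 rfl, h2'.real 10 rfl]
    have q5 : vec n (τ.real 12) = vec n (τ4.real 11) :=
      vec_eq fun i hi => by rw [hI, splice_of_lt (by omega)]
    rw [e10, q1, q5, hτ.real 11 rfl, q4]
    rfl

theorem cgBody_ok (h2 : σ.nat 2 0 = n + 1) (hB : n + 1 ≤ B) (hidx : ∀ i ≤ n, σ.nat 9 i < n) :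
    Ok B cgBody σ fun τ => (vec n (τ.real 10), vec n (τ.real 11), vec n (τ.real 12)) =
      cgStep (gramOp (transMatrix n (σ.nat 9) (σ.real 9)))
        (vec n (σ.real 10), vec n (σ.real 11), vec n (σ.real 12)) := by
  set A := gramOp (transMatrix n (σ.nat 9) (σ.real 9))
  refine Ok.seq (applyGram_ok h2 hB hidx) fun τ1 h1 q1 => ?_
  refine Ok.seq (dot_ok (n := n) (by omega) (by omega) (by rw [h1.nat 2 rfl, h2]) hB) fun τ2 h2' q2 => ?_
  have e2 : τ2.nat 2 0 = n + 1 := by rw [h2'.nat 2 rfl, h1.nat 2 rfl, h2]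
  rw [h1.real 11 rfl] at q2
  refine Ok.seq (dot_ok (n := n) (by omega) (by omega) e2 hB) fun τ3 h3 q3 => ?_
  have e2 : τ3.nat 2 0 = n + 1 := by rw [h3.nat 2 rfl, e2]
  rw [h2'.real 12 rfl, h1.real 12 rfl, h2'.real 14 rfl, q1] at q3
  rw [← h3.real 15 rfl] at q2
  refine Ok.seq (axpy_ok (n := n) (τ3.real 15 0 / τ3.real 16 0) e2 hB fun τ hτ => by
    simp only [RExp.eval, NExp.eval, hτ.real 15 rfl, hτ.real 16 rfl]) fun τ4 h4 q4 => ?_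
  have e2 : τ4.nat 2 0 = n + 1 := by rw [h4.nat 2 rfl, e2]
  rw [h3.real 10 rfl, h2'.real 10 rfl, h1.real 10 rfl, h3.real 12 rfl, h2'.real 12 rfl, h1.real 12 rfl] at q4
  refine Ok.seq (axpy_ok (n := n) (0 - τ3.real 15 0 / τ3.real 16 0) e2 hB fun τ hτ => by
    simp only [RExp.eval, NExp.eval, hτ.real 15 rfl, hτ.real 16 rfl, h4.real 15 rfl, h4.real 16 rfl,
      Nat.cast_zero]) fun τ5 h5 q5 => ?_
  have e2 : τ5.nat 2 0 = n + 1 := by rw [h5.nat 2 rfl, e2]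
  rw [h4.real 11 rfl, h3.real 11 rfl, h2'.real 11 rfl, h1.real 11 rfl, h4.real 14 rfl, h3.real 14 rfl,
    h2'.real 14 rfl, q1] at q5
  rw [← h5.real 10 rfl] at q4
  refine Ok.seq (dot_ok (n := n) (by omega) (by omega) e2 hB) fun τ6 h6 q6 => ?_
  have e2 : τ6.nat 2 0 = n + 1 := by rw [h6.nat 2 rfl, e2]
  have e15 : τ6.real 15 = τ3.real 15 := by rw [h6.real 15 rfl, h5.real 15 rfl, h4.real 15 rfl]
  have e12 : τ6.real 12 = σ.real 12 := by
    rw [h6.real 12 rfl, h5.real 12 rfl, h4.real 12 rfl, h3.real 12 rfl, h2'.real 12 rfl, h1.real 12 rfl]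
  rw [← h6.real 10 rfl] at q4
  rw [← h6.real 11 rfl] at q5 q6
  refine (axpy_ok (n := n) (τ6.real 17 0 / τ3.real 15 0) e2 hB fun τ hτ => by
    simp only [RExp.eval, NExp.eval, hτ.real 17 rfl, hτ.real 15 rfl, e15]).mono fun τ7 h7 q7 => ?_
  rw [e12] at q7
  rw [← h7.real 10 rfl] at q4
  rw [← h7.real 11 rfl] at q5 q6 q7
  rw [zero_sub, neg_smul, ← sub_eq_add_neg] at q5
  rw [q7, q6, q5, q4, q2, q3]
  rfl

theorem stationary_ok {P : Finset (ℝ × ℝ)} (hn : 0 < n) (h2 : σ.nat 2 0 = n + 1) (hB : n + 1 ≤ B)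
    (hch : Chain P (σ.real 1) n 1) (ha : ∀ i ≤ n, σ.real 3 i ∈ Set.Icc (0 : ℝ) 1) :
    Ok B stationary σ fun τ => (∀ i, i ≤ n → 0 ≤ τ.real 2 i) ∧
      ∑ i ∈ Finset.range (n + 1), τ.real 2 i = 1 ∧ ∀ j ≤ n, τ.real 2 j =
        ∑ s ∈ Finset.range (n + 1), τ.real 2 s * rounding P (σ.real 3 s) (σ.real 1 j) := by
  refine Ok.seq (locate_ok hn h2 hB hch ha) fun τ1 h1 q1 => ?_
  have e2 : τ1.nat 2 0 = n + 1 := by rw [h1.nat 2 rfl, h2]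
  refine Ok.seq (R := fun τ => ∀ i ≤ n, τ.real 9 i = (σ.real 3 i - σ.real 1 (τ1.nat 9 i)) /
      (σ.real 1 (τ1.nat 9 i + 1) - σ.real 1 (τ1.nat 9 i)))
    (Ok.forSet (n := n + 1) (fun i => (σ.real 3 i - σ.real 1 (τ1.nat 9 i)) /
      (σ.real 1 (τ1.nat 9 i + 1) - σ.real 1 (τ1.nat 9 i))) (by simp [NExp.eval, e2]) hB
      (fun k hk τ hτ hc hI => by
        simp only [RExp.eval, NExp.eval, hc, hτ.real 1 rfl, hτ.real 3 rfl, hτ.nat 9 rfl, h1.real 1 rfl,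
          h1.real 3 rfl])
      fun τ hτ hI i hi => by rw [hI, splice_of_lt (by omega)]) fun τ2 h2' q2 => ?_
  have e2 : τ2.nat 2 0 = n + 1 := by rw [h2'.nat 2 rfl, e2]
  rw [← h2'.nat 9 rfl] at q1 q2
  set idx := τ2.nat 9
  set al := τ2.real 9
  have hidx : ∀ i ≤ n, idx i < n := fun i hi => (q1 i hi).1
  -- The relative position of an action in its interval is the probability of rounding up, so the
  -- sparse matrix is the matrix of the rounding probabilities; distinctness of the points makes
  -- indices and points interchangeable.
  have htr : ∀ i ≤ n, ∀ j ≤ n, trans idx al i j = rounding P (σ.real 3 i) (σ.real 1 j) := by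
    intro i hi j hj
    obtain ⟨g1, g2⟩ := q1 i hi
    have hlt := sub_pos.2 (hch.lt _ g1)
    rw [hch.rounding_eq g1 g2, trans, q2 i hi]
    by_cases hj1 : j = idx i
    · rw [if_pos hj1, if_pos (by rw [hj1])]
      field_simp
      ring
    · rw [if_neg hj1, if_neg fun h => hj1 (hch.inj hj g1.le h)]
      by_cases hj2 : j = idx i + 1
      · rw [if_pos hj2, if_pos (by rw [hj2])]
      · rw [if_neg hj2, if_neg fun h => hj2 (hch.inj hj g1 h)]
  have hal : ∀ i ≤ n, 0 ≤ al i ∧ al i ≤ 1 := by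
    intro i hi
    obtain ⟨g1, g2, g3⟩ := q1 i hi
    have hlt := sub_pos.2 (hch.lt _ g1)
    have g4 : σ.real 3 i ≤ σ.real 1 (idx i + 1) := by
      rcases g3 with g3 | ⟨g3, g5⟩
      · exact g3.le
      · exact (g3.trans g5.symm).le
    simp only at g2
    rw [q2 i hi]
    exact ⟨div_nonneg (by linarith) hlt.le, (div_le_one hlt).2 (by linarith)⟩
  have hQ0 : ∀ i j, 0 ≤ transMatrix n idx al i j := by
    intro i j
    have := hal i (Nat.lt_succ_iff.1 i.2)
    simp only [transMatrix, Matrix.of_apply, trans]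
    split_ifs <;> linarith
  have hQ1 : ∀ i, ∑ j, transMatrix n idx al i j = 1 := by
    intro i
    have := sum_trans_mul (al := al) (hidx i (Nat.lt_succ_iff.1 i.2)) fun _ => 1
    simp only [mul_one, sub_add_cancel] at this
    rw [← this, Finset.sum_range]
    rfl
  refine Ok.seq (cgInit_ok e2 hB hidx) fun τ3 h3 q3 => ?_
  have e2 : τ3.nat 2 0 = n + 1 := by rw [h3.nat 2 rfl, e2]
  refine Ok.seq (Ok.loop (n := n + 1) (Q := fun τ => τ.nat 2 0 = n + 1 ∧
      vec n (τ.real 10) = (cg (gramOp (transMatrix n idx al)) 1 (n + 1)).1)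
    (fun k τ => (vec n (τ.real 10), vec n (τ.real 11), vec n (τ.real 12)) =
      cg (gramOp (transMatrix n idx al)) 1 k) (by simp [NExp.eval, e2]) hB q3
    (fun k hk τ hτ hI => ?_) fun τ hτ hI => ⟨by rw [hτ.nat 2 rfl, e2], by rw [← hI]⟩) fun τ4 h4 q4 => ?_
  · have e9 : τ.nat 9 = idx := by rw [hτ.nat 9 rfl, h3.nat 9 rfl]
    have e9r : τ.real 9 = al := by rw [hτ.real 9 rfl, h3.real 9 rfl]
    refine (cgBody_ok (n := n) (by rw [hτ.nat 2 rfl, e2]) hB (by rwa [e9])).mono fun υ _ hυ => ?_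
    rw [hυ, e9, e9r, hI, cg_succ]
  obtain ⟨e2, q4⟩ := q4
  obtain ⟨hpos, hst⟩ := cg_stationary hQ0 hQ1 (x := vec n (τ4.real 10)) (by rw [q4, Fintype.card_fin])
  have hsum : ∑ i, |vec n (τ4.real 10) i| = ∑ i ∈ Finset.range (n + 1), |τ4.real 10 i| :=
    (Finset.sum_range fun i => |τ4.real 10 i|).symm
  rw [hsum] at hpos hst
  set S := ∑ i ∈ Finset.range (n + 1), |τ4.real 10 i|
  refine Ok.seq (R := fun τ => τ.real 15 0 = 0) (Ok.setReal (by simp [NExp.eval, RExp.eval]))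
    fun τ5 h5 q5 => ?_
  refine Ok.seq (R := fun τ => τ.real 15 0 = S) (Ok.forSum (n := n + 1) (fun i => |τ4.real 10 i|)
    (by simp [NExp.eval, h5.nat 2 rfl, e2]) hB q5 (fun k hk τ hτ hc => by
      simp only [RExp.eval_abs, RExp.eval, NExp.eval, hc, hτ.real 10 rfl, h5.real 10 rfl])
    fun τ hτ h => h) fun τ6 h6 q6 => ?_
  refine Ok.forSet (n := n + 1) (fun i => |τ4.real 10 i| / S)
    (by simp [NExp.eval, h6.nat 2 rfl, h5.nat 2 rfl, e2]) hB (fun k hk τ hτ hc hI => by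
      simp only [RExp.eval_abs, RExp.eval, NExp.eval, hc, hτ.real 10 rfl, h6.real 10 rfl, h5.real 10 rfl,
        hτ.real 15 rfl, q6]) fun τ hτ hI => ?_
  have hP : ∀ i ∈ Finset.range (n + 1), τ.real 2 i = |τ4.real 10 i| / S := fun i hi => by
    rw [hI, splice_of_lt (Finset.mem_range.1 hi)]
  refine ⟨fun i hi => ?_, ?_, fun j hj => ?_⟩
  · rw [hP i (Finset.mem_range.2 (by omega))]; positivity
  · rw [Finset.sum_congr rfl hP, ← Finset.sum_div, div_self hpos.ne']
  · have h := hst ⟨j, by omega⟩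
    rw [hP j (Finset.mem_range.2 (by omega))]
    refine h.trans ?_
    rw [Finset.sum_range]
    refine Finset.sum_congr rfl fun s _ => ?_
    rw [hP s (Finset.mem_range.2 s.2), ← htr s (Nat.lt_succ_iff.1 s.2) j hj]
    rfl

end

/-! ### The forecaster of the program -/

/-- The part of a round that comes after the newest outcome has been observed. -/
def predict : Prog :=
  .seq (.ite (.natLe (.cell 4) (.cell 3)) newEpoch .skip) <|
    .seq stationary (.setNat 3 (.const 0) (.add (.cell 3) (.const 1)))

/-- The program that runs the algorithm. -/
def forecastProg : Prog := .seq observe predict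

theorem depth_forecastProg : forecastProg.depth = 2 := by decide

open Classical in
/-- The distribution that a store lists, if it lists one. -/
noncomputable def Store.pmf (σ : Store) : PMF ℝ :=
  if h : ∃ p : PMF ℝ, σ.Outputs p then h.choose else PMF.pure 0

theorem Store.outputs_pmf {σ : Store} (h0 : ∀ i < σ.outSize, 0 ≤ σ.real 2 i)
    (h1 : ∑ i ∈ Finset.range σ.outSize, σ.real 2 i = 1) : σ.Outputs σ.pmf := by
  have hex : ∃ p : PMF ℝ, σ.Outputs p := by
    have hsum : ∑ i : Fin σ.outSize, ENNReal.ofReal (σ.real 2 i) = 1 := by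
      rw [← ENNReal.ofReal_sum_of_nonneg fun (i : Fin σ.outSize) _ => h0 i i.2, ← Finset.sum_range fun i => σ.real 2 i, h1,
        ENNReal.ofReal_one]
    refine ⟨(PMF.ofFintype _ hsum).map fun i : Fin σ.outSize => σ.real 1 i, h0, fun z => ?_⟩
    rw [PMF.map_apply, tsum_fintype, ENNReal.toReal_sum fun i _ => (by
      split_ifs
      exacts [PMF.apply_ne_top _ _, ENNReal.zero_ne_top]), Finset.sum_range]
    refine Finset.sum_congr rfl fun i _ => ?_
    by_cases hz : z = σ.real 1 i
    · rw [if_pos hz, if_pos hz.symm, PMF.ofFintype_apply, ENNReal.toReal_ofReal (h0 i i.2)]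
    · rw [if_neg hz, if_neg (Ne.symm hz), ENNReal.toReal_zero]
  rw [Store.pmf, dif_pos hex]
  exact hex.choose_spec

/-- The forecaster that predicts with the distributions listed by the program. -/
noncomputable def progForecaster (T : ℕ) (C ι : ℝ) : Forecaster := fun h =>
  (roundRun forecastProg T C ι (h.map Prod.snd)).1.pmf

/-- The state of the program in the round that follows `h`, before a distribution is computed. -/
structure Started (F : Forecaster) (T : ℕ) (C ι : ℝ) (B n : ℕ) (h : History) (σ : Store) : Prop where
  horizon : σ.nat 0 0 = T
  deviation : σ.real 0 0 = C
  parameter : σ.real 0 1 = ι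
  epoch_eq : σ.nat 5 0 = epoch h.length
  next : σ.nat 4 0 + 2 = 2 ^ (epoch h.length + 1)
  sum : σ.real 5 0 = epochSum (epoch h.length) (fun _ x => outcome x.2) h
  pos : 0 < n
  size : σ.nat 2 0 = n + 1
  le : n + 1 ≤ B
  chain : Chain (partition T C ι (epoch h.length) (prevMean (epoch h.length) h)) (σ.real 1) n 1
  action : ∀ i ≤ n, σ.real 3 i = (ogd F (fun _ _ => 0) (σ.real 1 i) h).1
  weight : ∀ i ≤ n, σ.real 4 i = (ogd F (fun _ _ => 0) (σ.real 1 i) h).2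

/-- The state of the program at the end of the round that follows `h`. -/
structure Solved (F : Forecaster) (T : ℕ) (C ι : ℝ) (B n : ℕ) (h : History) (σ : Store) : Prop
    extends Started F T C ι B n h σ where
  rounds : σ.nat 3 0 = h.length + 1
  nonneg : ∀ i ≤ n, 0 ≤ σ.real 2 i
  sum_eq : ∑ i ∈ Finset.range (n + 1), σ.real 2 i = 1
  fixed : ∀ j ≤ n, σ.real 2 j = ∑ s ∈ Finset.range (n + 1), σ.real 2 s *
    rounding (partition T C ι (epoch h.length) (prevMean (epoch h.length) h)) (σ.real 3 s) (σ.real 1 j)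

section
variable {F : Forecaster} {T : ℕ} {C ι : ℝ} {B n : ℕ} {h : History} {σ : Store}

theorem newEpoch_started (hT : 1 ≤ T) (hι : 1 ≤ ι) (hC : 0 ≤ C) (hh : h.length < T)
    (hB : ∀ m y, 1 ≤ m → y ∈ Set.Icc (0 : ℝ) 1 →
      innerCount C ι m y + 2 * ((bandMax T + 1) * outerCount C ι) + 1 ≤ B)
    (eT : σ.nat 0 0 = T) (eC : σ.real 0 0 = C) (eι : σ.real 0 1 = ι)
    (e5 : σ.nat 5 0 + 1 = epoch h.length) (e4 : σ.nat 4 0 + 2 = 2 ^ epoch h.length)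
    (es : σ.real 5 0 = epochSum (epoch h.length - 1) (fun _ x => outcome x.2) h)
    (h0 : epochSum (epoch h.length) (fun _ x => outcome x.2) h = 0)
    (ho : ∀ s, ogd F (fun _ _ => 0) s h = (0, 0)) :
    Ok B newEpoch σ fun τ => ∃ n, Started F T C ι B n h τ := by
  have hm := epoch_pos h.length
  have hy := prevMean_mem hm h
  refine (newEpoch_ok hT hι hC (two_pow_epoch_le hh) hy eT eC eι e5 (by rw [es, prevMean_eq])
    (hB _ _ hm hy)).mono fun τ hτ hQ => ?_
  obtain ⟨g5, g4, gs, n, gn, g2, gB, gch, ga⟩ := hQ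
  exact ⟨n, by rw [hτ.nat 0 rfl, eT], by rw [hτ.real 0 rfl, eC], by rw [hτ.real 0 rfl, eι], g5,
    by rw [g4, pow_succ, ← e4]; ring, by rw [gs, h0], gn, g2, gB, gch,
    fun i hi => by rw [(ga i hi).1, ho], fun i hi => by rw [(ga i hi).2, ho]⟩

theorem predict_ok (e3 : σ.nat 3 0 = h.length)
    (hnew : σ.nat 4 0 ≤ σ.nat 3 0 → Ok B newEpoch σ fun τ => ∃ n, Started F T C ι B n h τ)
    (hold : ¬ σ.nat 4 0 ≤ σ.nat 3 0 → ∃ n, Started F T C ι B n h σ) :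
    Ok B predict σ fun τ => ∃ n, Solved F T C ι B n h τ := by
  refine Ok.seq (Ok.ite hnew fun hb => Ok.skip (hold hb)) fun τ hτ hs => ?_
  obtain ⟨n, hs⟩ := hs
  have hact : ∀ i ≤ n, τ.real 3 i ∈ Set.Icc (0 : ℝ) 1 := fun i hi => by
    rw [hs.action i hi]
    exact ogd_mem (fun _ _ => ⟨le_rfl, zero_le_one⟩) _ _
  refine Ok.seq (stationary_ok hs.pos hs.size hs.le hs.chain hact) fun υ hυ hQ => Ok.setNat ?_
  obtain ⟨q1, q2, q3⟩ := hQ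
  refine ⟨n, ⟨?_, ?_, ?_, ?_, ?_, ?_, hs.pos, ?_, hs.le, ?_, ?_, ?_⟩, ?_, ?_, ?_, ?_⟩
  all_goals simp only [ne_eq, show (0 : ℕ) ≠ 3 by omega, show (2 : ℕ) ≠ 3 by omega,
    show (4 : ℕ) ≠ 3 by omega, show (5 : ℕ) ≠ 3 by omega, not_false_eq_true,
    Store.setNat_nat_ne, Store.setNat_real, Store.setNat_nat_self, NExp.eval, Function.update_self,
    hυ.nat 0 rfl, hυ.nat 2 rfl, hυ.nat 3 rfl, hυ.nat 4 rfl, hυ.nat 5 rfl, hυ.real 0 rfl, hυ.real 1 rfl,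
    hυ.real 3 rfl, hυ.real 4 rfl, hυ.real 5 rfl]
  · exact hs.horizon
  · exact hs.deviation
  · exact hs.parameter
  · exact hs.epoch_eq
  · exact hs.next
  · exact hs.sum
  · exact hs.size
  · exact hs.chain
  · exact hs.action
  · exact hs.weight
  · rw [hτ.nat 3 rfl, e3]
  · exact q1
  · exact q2
  · exact q3

theorem Solved.outputs (hs : Solved F T C ι B n h σ) : σ.Outputs σ.pmf :=
  Store.outputs_pmf (fun i hi => hs.nonneg i (by rw [Store.outSize, hs.size] at hi; omega))
    (by rw [Store.outSize, hs.size]; exact hs.sum_eq)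

/-- The listed points are strictly increasing, so each of them is listed only once. -/
theorem Solved.pmf_toReal (hs : Solved F T C ι B n h σ) {i : ℕ} (hi : i ≤ n) :
    (σ.pmf (σ.real 1 i)).toReal = σ.real 2 i := by
  rw [hs.outputs.2, Store.outSize, hs.size, Finset.sum_eq_single i]
  · rw [if_pos rfl]
  · intro j hj hji
    exact if_neg fun he => hji (hs.chain.inj (Nat.lt_succ_iff.1 (Finset.mem_range.1 hj)) hi he)
  · intro hni; exact absurd (Finset.mem_range.2 (by omega)) hni

theorem Solved.support_subset (hs : Solved F T C ι B n h σ) : σ.pmf.support ⊆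
    (endpoints (partition T C ι (epoch h.length) (prevMean (epoch h.length) h)) : Set ℝ) := by
  intro z hz
  rw [hs.chain.endpoints_eq hs.pos]
  by_contra hne
  refine (PMF.mem_support_iff _ _).1 hz ((ENNReal.toReal_eq_zero_iff _).1 ?_ |>.resolve_right
    (PMF.apply_ne_top _ _))
  rw [hs.outputs.2]
  refine Finset.sum_eq_zero fun i hi => if_neg fun he => hne ?_
  rw [Store.outSize, hs.size] at hi
  exact Finset.mem_coe.2 (Finset.mem_image.2 ⟨i, hi, he⟩)

end

/-! ### Correctness and cost of the program over all rounds -/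

section
variable {T : ℕ} {C ι : ℝ} {B : ℕ}

/-- The forecaster is defined from the output of the program, and `ogd` refers to the forecaster.
This is not circular: the state after `x :: h` involves only distributions up to `h`, which the
induction identifies with the listed probabilities. -/
theorem roundRun_solved (hT : 1 ≤ T) (hι : 1 ≤ ι) (hC : 0 ≤ C)
    (hB : ∀ m y, 1 ≤ m → y ∈ Set.Icc (0 : ℝ) 1 →
      innerCount C ι m y + 2 * ((bandMax T + 1) * outerCount C ι) + 1 ≤ B) :
    ∀ h : History, h.length < T →
      (∃ n, Solved (progForecaster T C ι) T C ι B n h (roundRun forecastProg T C ι (h.map Prod.snd)).1) ∧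
      (roundRun forecastProg T C ι (h.map Prod.snd)).2 ≤ forecastProg.weight * (B + 1) ^ 2
  | [], hh => by
    have key : Ok B forecastProg (initStore T C ι) fun τ =>
        ∃ n, Solved (progForecaster T C ι) T C ι B n [] τ := by
      -- Before the first round no point is listed and the outcome cell is `0`, so observing has no
      -- effect that matters. Round number and first round of the next epoch are both `0`, which
      -- triggers epoch 1.
      refine Ok.seq (observe_ok (by simp [initStore])) fun τ hτ hQ => ?_
      have e1 : epoch 0 = 1 := (epoch_eq_iff le_rfl).2 (by norm_num)
      have g3 : τ.nat 3 0 = 0 := by rw [hτ.nat 3 rfl]; simp [initStore]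
      have g4 : τ.nat 4 0 = 0 := by rw [hτ.nat 4 rfl]; simp [initStore]
      have g5 : τ.nat 5 0 = 0 := by rw [hτ.nat 5 rfl]; simp [initStore]
      refine predict_ok g3 (fun _ => newEpoch_started hT hι hC hh hB ?_ ?_ ?_ ?_ ?_ ?_ rfl fun s => rfl)
        fun hb => absurd (by rw [g3, g4]) hb
      · rw [hτ.nat 0 rfl]; simp [initStore]
      · rw [hτ.real 0 rfl]; simp [initStore]
      · rw [hτ.real 0 rfl]; simp [initStore]
      · rw [g5, List.length_nil, e1]
      · rw [g4, List.length_nil, e1]; norm_num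
      · rw [hQ.1]; simp [initStore]
    rw [Ok, depth_forecastProg] at key
    exact key
  | x :: h, hh => by
    rw [List.length_cons] at hh
    obtain ⟨n, hs⟩ := (roundRun_solved hT hι hC hB h (by omega)).1
    have hF : progForecaster T C ι h = (roundRun forecastProg T C ι (h.map Prod.snd)).1.pmf := rfl
    set σ := (roundRun forecastProg T C ι (h.map Prod.snd)).1
    have key : Ok B forecastProg (σ.setNat 1 0 (if x.2 then 1 else 0)) fun τ =>
        ∃ n, Solved (progForecaster T C ι) T C ι B n (x :: h) τ := by
      refine Ok.seq (observe_ok (by simpa [hs.size] using hs.le)) fun τ hτ hQ => ?_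
      obtain ⟨gs, ga⟩ := hQ
      have hout : (((if x.2 then 1 else 0 : ℕ) : ℕ) : ℝ) = outcome x.2 := by
        unfold outcome; split_ifs <;> simp
      simp only [Store.setNat_real, Store.setNat_nat_self, Function.update_self, hout, ne_eq,
        show (2 : ℕ) ≠ 1 by omega, not_false_eq_true, Store.setNat_nat_ne, hs.size, hs.sum] at gs ga
      have e0 : τ.nat 0 0 = T := by rw [hτ.nat 0 rfl]; simpa using hs.horizon
      have e2 : τ.nat 2 0 = n + 1 := by rw [hτ.nat 2 rfl]; simpa using hs.size
      have e3 : τ.nat 3 0 = h.length + 1 := by rw [hτ.nat 3 rfl]; simpa using hs.rounds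
      have e4 : τ.nat 4 0 + 2 = 2 ^ (epoch h.length + 1) := by rw [hτ.nat 4 rfl]; simpa using hs.next
      have e5 : τ.nat 5 0 = epoch h.length := by rw [hτ.nat 5 rfl]; simpa using hs.epoch_eq
      have eC : τ.real 0 0 = C := by rw [hτ.real 0 rfl]; exact hs.deviation
      have eι : τ.real 0 1 = ι := by rw [hτ.real 0 rfl]; exact hs.parameter
      have e1 : τ.real 1 = σ.real 1 := by rw [hτ.real 1 rfl]; rfl
      have hm := epoch_pos h.length
      obtain ⟨hm1, hm2⟩ := (epoch_eq_iff hm).1 rfl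
      have hsum : τ.real 5 0 = epochSum (epoch h.length) (fun _ x => outcome x.2) (x :: h) := by
        rw [gs, epochSum_cons, if_pos rfl]
      refine predict_ok e3 (fun hb => ?_) fun hb => ?_
      · have hnext : epoch (h.length + 1) = epoch h.length + 1 := by
          rw [epoch_eq_iff (by omega), pow_succ]; omega
        refine newEpoch_started hT hι hC hh hB e0 eC eι (by rw [List.length_cons, hnext, e5])
          (by rw [List.length_cons, hnext, e4]) (by rw [List.length_cons, hnext, hsum, Nat.add_sub_cancel])
          (epochSum_new (by rw [List.length_cons, hnext]; omega) rfl) fun s => ?_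
        rw [ogd_cons, if_pos (by rw [hnext]; omega)]
      · have hnext : epoch (h.length + 1) = epoch h.length := by
          rw [epoch_eq_iff hm]; omega
        have hogd : ∀ s, ogd (progForecaster T C ι) (fun _ _ => 0) s (x :: h) = _ := fun s =>
          (ogd_cons s x h).trans (if_neg (by rw [hnext]; simp))
        refine ⟨n, e0, eC, eι, by rw [e5, List.length_cons, hnext], by rw [e4, List.length_cons, hnext],
          by rw [hsum, List.length_cons, hnext], hs.pos, e2, hs.le, ?_, fun i hi => ?_, fun i hi => ?_⟩
        · rw [List.length_cons, hnext, e1,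
            ← prevMean_of_suffix hm le_rfl (List.suffix_cons x h)]
          exact hs.chain
        · rw [hogd, e1, hF, hs.pmf_toReal hi, ← hs.action i hi, ← hs.weight i hi]
          exact (ga i (by omega)).2
        · rw [hogd, e1, hF, hs.pmf_toReal hi, ← hs.weight i hi]
          exact (ga i (by omega)).1
    rw [Ok, depth_forecastProg] at key
    exact key

/-- All initial actions are `0`. The program treats epoch 1 like the others, which is admissible
since any distribution on `[0,1]` is allowed there. -/
theorem runsAlgorithm_progForecaster (hT : 1 ≤ T) (hι : 1 ≤ ι) (hC : 0 ≤ C)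
    (hB : ∀ m y, 1 ≤ m → y ∈ Set.Icc (0 : ℝ) 1 →
      innerCount C ι m y + 2 * ((bandMax T + 1) * outerCount C ι) + 1 ≤ B) :
    RunsAlgorithm T C ι (progForecaster T C ι) := by
  refine ⟨fun _ _ => 0, fun _ _ => ⟨le_rfl, zero_le_one⟩, fun h hh => ?_⟩
  obtain ⟨n, hs⟩ := (roundRun_solved hT hι hC hB h hh).1
  have hF : progForecaster T C ι h = (roundRun forecastProg T C ι (h.map Prod.snd)).1.pmf := rfl
  refine ⟨fun _ z hz => hs.chain.endpoints_mem_Icc hs.pos (hs.support_subset hz),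
    fun _ => ⟨hs.support_subset, fun z hz => ?_⟩⟩
  rw [hs.chain.endpoints_eq hs.pos, Finset.mem_image] at hz
  obtain ⟨j, hj, rfl⟩ := hz
  rw [hs.chain.sum_endpoints hs.pos, hF, hs.pmf_toReal (Nat.lt_succ_iff.1 (Finset.mem_range.1 hj)),
    hs.fixed j (Nat.lt_succ_iff.1 (Finset.mem_range.1 hj))]
  refine Finset.sum_congr rfl fun s hsn => ?_
  have hsn := Nat.lt_succ_iff.1 (Finset.mem_range.1 hsn)
  rw [hs.pmf_toReal hsn, hs.action s hsn]

/-- One number bounds all loop lengths in all epochs. Up to constants, the inner region has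
`(1+C)^{1/3}` intervals and each of the `O(log T)` bands at most as many. -/
theorem exists_size_bound (hT : 2 ≤ T) (hι : 1 ≤ ι) (hC : 0 ≤ C) :
    ∃ B : ℕ, (∀ m y, 1 ≤ m → y ∈ Set.Icc (0 : ℝ) 1 →
      innerCount C ι m y + 2 * ((bandMax T + 1) * outerCount C ι) + 1 ≤ B) ∧
      (B : ℝ) + 1 ≤ 40 * ((1 + C) ^ (1 / 3 : ℝ) * Real.log T) := by
  have hT' : (2 : ℝ) ≤ T := by exact_mod_cast hT
  set c := (1 + C) ^ (1 / 3 : ℝ)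
  have hc : 1 ≤ c := Real.one_le_rpow (by linarith) (by norm_num)
  refine ⟨⌈4 * c + 1⌉₊ + 2 * ((bandMax T + 1) * outerCount C ι) + 1, fun m y hm hy => ?_, ?_⟩
  · have := (innerCount_le hι hC hm hy).trans (Nat.le_ceil _)
    have : innerCount C ι m y ≤ ⌈4 * c + 1⌉₊ := by exact_mod_cast this
    omega
  · have h1 : (⌈4 * c + 1⌉₊ : ℝ) ≤ 4 * c + 1 + 1 := (Nat.ceil_lt_add_one (by positivity)).le
    have h2 : (outerCount C ι : ℝ) ≤ 2 * c := by
      have := outerCount_le (ι := ι) (by linarith) hC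
      have : c / ι ≤ c := div_le_self (by linarith) hι
      linarith
    have hl2 := Real.log_two_gt_d9
    have hlT : Real.log 2 ≤ Real.log T := Real.log_le_log (by norm_num) hT'
    have h3 : (bandMax T : ℝ) ≤ 2 * Real.log T + 1 := by
      have h4 : Real.logb 2 T ≤ 2 * Real.log T := by
        rw [Real.logb, div_le_iff₀ (by linarith)]
        nlinarith
      have h5 : 0 ≤ Real.logb 2 T := Real.logb_nonneg (by norm_num) (by linarith)
      have := (Nat.ceil_lt_add_one h5).le
      unfold bandMax; linarith
    have h4 : ((bandMax T : ℝ) + 1) * outerCount C ι ≤ (5 * Real.log T) * (2 * c) :=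
      mul_le_mul (by linarith) h2 (by positivity) (by linarith)
    push_cast
    nlinarith
end

end Calib

theorem mainTheorem8 :
    ∃ (c₀ A : ℝ) (k : ℕ) (prog : Calib.Prog), 0 < c₀ ∧ 0 < A ∧
      ∀ (T : ℕ) (δ ι : ℝ) (q : ℕ → unitInterval),
        2 ≤ T → 0 < δ → δ < 1 → c₀ * Real.log ((T : ℝ) / δ) ≤ ι →
        (∀ F : Calib.Forecaster, Calib.RunsAlgorithm T (Calib.deviation q T) ι F →
          ENNReal.ofReal (1 - δ) ≤ (Calib.law F q T).toOuterMeasure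
            {h | Calib.pcal2 F h ≤
              A * (ι ^ 3 + Calib.deviation q T ^ (1 / 3 : ℝ) * ι ^ 2)} ∧
          ENNReal.ofReal (1 - δ) ≤ (Calib.law F q T).toOuterMeasure
            {h | Calib.cal2 h ≤
              A * (ι ^ 3 + Calib.deviation q T ^ (1 / 3 : ℝ) * ι ^ 2)}) ∧
        (∃ F : Calib.Forecaster, Calib.RunsAlgorithm T (Calib.deviation q T) ι F ∧
          ∀ h : Calib.History, h.length < T →
            (Calib.roundRun prog T (Calib.deviation q T) ι (h.map Prod.snd)).1.Outputs (F h) ∧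
            (Calib.roundCost prog T (Calib.deviation q T) ι (h.map Prod.snd) : ℝ) ≤
              A * (1 + Calib.deviation q T) ^ (2 / 3 : ℝ) * Real.log T ^ k) := by
  -- `100` comes from `calibration_bounds` and `2000` from `bound_le`. Loops are nested to depth
  -- `2`, so the cost is quadratic in a bound `B + 1 ≤ 40 (1+C)^{1/3} log T`: this gives `1600 =
  -- 40²` and the exponent `2` of the logarithm. The summand `1` next to the program weight pays for
  -- the listed points.
  refine ⟨100, 2000 + 1600 * (Calib.forecastProg.weight + 1), 2, Calib.forecastProg, by norm_num,
    by positivity, fun T δ ι q hT hδ0 hδ1 hι => ?_⟩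
  have hC := Calib.deviation_nonneg q T
  have hT' : (2 : ℝ) ≤ T := by exact_mod_cast hT
  have hι1 : 1 ≤ ι := by
    have h1 : Real.log 2 ≤ Real.log (T / δ) := Real.log_le_log (by norm_num) (by
      rw [le_div_iff₀ hδ0]; nlinarith)
    linarith [Real.log_two_gt_d9]
  set C := Calib.deviation q T
  have hbound : ∀ {X : ℝ}, X ≤ 2 + 600 * (ι ^ 3 + (1 + C) ^ (1 / 3 : ℝ) * ι ^ 2) →
      X ≤ (2000 + 1600 * (Calib.forecastProg.weight + 1)) * (ι ^ 3 + C ^ (1 / 3 : ℝ) * ι ^ 2) :=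
    fun hX => (Calib.bound_le hC hι1 hX).trans (by
      gcongr
      exact le_add_of_nonneg_right (by positivity))
  refine ⟨fun F hF => ?_, ?_⟩
  · have h := Calib.calibration_bounds hT hδ0 hδ1 hι hF
    exact ⟨h.trans (MeasureTheory.measure_mono fun g hg => hbound hg.1),
      h.trans (MeasureTheory.measure_mono fun g hg => hbound hg.2)⟩
  · obtain ⟨B, hB, hB'⟩ := Calib.exists_size_bound hT hι1 hC
    refine ⟨Calib.progForecaster T C ι, Calib.runsAlgorithm_progForecaster (by omega) hι1 hC hB,
      fun h hh => ?_⟩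
    obtain ⟨⟨n, hs⟩, hcost⟩ := Calib.roundRun_solved (by omega) hι1 hC hB h hh
    refine ⟨hs.outputs, ?_⟩
    set c := (1 + C) ^ (1 / 3 : ℝ)
    have hc : (1 + C) ^ (2 / 3 : ℝ) = c ^ 2 := by
      rw [← Real.rpow_natCast, ← Real.rpow_mul (by linarith)]; norm_num
    have hnat : Calib.roundCost Calib.forecastProg T C ι (h.map Prod.snd) ≤
        (Calib.forecastProg.weight + 1) * (B + 1) ^ 2 := by
      have h1 : n + 1 ≤ B := hs.le
      unfold Calib.roundCost Calib.Store.outSize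
      rw [hs.size, add_one_mul]
      exact Nat.add_le_add hcost (h1.trans ((Nat.le_succ B).trans (Nat.le_self_pow two_ne_zero _)))
    calc (Calib.roundCost Calib.forecastProg T C ι (h.map Prod.snd) : ℝ)
        ≤ ((Calib.forecastProg.weight + 1) * (B + 1) ^ 2 : ℕ) := by exact_mod_cast hnat
      _ = (Calib.forecastProg.weight + 1) * ((B : ℝ) + 1) ^ 2 := by push_cast; ring
      _ ≤ (Calib.forecastProg.weight + 1) * (40 * (c * Real.log T)) ^ 2 := by gcongr
      _ ≤ (2000 + 1600 * (Calib.forecastProg.weight + 1)) * (c ^ 2 * Real.log T ^ 2) := by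
        have : 0 ≤ c ^ 2 * Real.log T ^ 2 := by positivity
        nlinarith
      _ = _ := by rw [hc]; ring
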